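/- **Theorem 1.1.** Let $M$ be a connected, non-compact smooth manifold (Hausdorff, second countable, without boundary) of dimension $n$, let $0<T<\infty$, and let $g(t)=(g_{ij}(t))$, $0\le t<T$, be a family of smooth complete Riemannian metrics on $M$ which at each point of $M$ is continuous in $t\in[0,T)$ and differentiable in $t\in(0,T)$. Let $\nabla$, $\Delta$, $dV_t$ and $r_t(x,y)$ denote the gradient, the Laplace–Beltrami operator, the volume measure and the geodesic distance of $g(t)$, and fix $x_0\in M$. Suppose that there are constants $\alpha_1,\alpha_2,\alpha_3>0$ such that $$-\alpha_3\,g_{ij}\le\frac{\partial g_{ij}}{\partial t}\le\alpha_3\,g_{ij}\qquad\text{in }M\times(0,T)$$ (as quadratic forms on tangent vectors). Let $\vec a(\cdot,t)$, $0\le t<T$, be vector fields on $M$ and $b:M\times[0,T)\to\mathbb R$ a function with $$\sup_{M\times[0,T)}|\vec a|_{g(t)}\le\alpha_1,\qquad \sup_{M\times[0,T)}|b|\le\alpha_2 .$$ Let $u\in C(M\times[0,T))\cap C^{2,1}(M\times(0,T))$ satisfy $$u_t\le\Delta u+\vec a\cdot\nabla u+b\,u\qquad\text{in }M\times(0,T),$$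 where $\vec a\cdot\nabla u=g(t)(\vec a,\nabla u)$, and suppose that, with $u_+=\max(u,0)$, for some constant $\lambda>0$, $$\int_0^T\!\!\int_M u_+^2(x,t)\,e^{-\lambda r_t(x_0,x)^2}\,dV_t\,dt<\infty ,$$ and $$u(x,0)\le0\qquad\text{for all }x\in M .$$ Then $u(x,t)\le0$ for all $(x,t)\in M\times[0,T)$. -/

import Mathlib

open Set Filter MeasureTheory Bundle
open scoped Manifold ContDiff Topology ENNReal

noncomputable section

namespace MaxPrinciple

variable {n : ℕ} {M : Type*} [TopologicalSpace M] [ChartedSpace (EuclideanSpace ℝ (Fin n)) M]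
  [IsManifold (𝓡 n) ∞ M]

/-- A smooth Riemannian metric on the `n`-dimensional manifold `M`
(a smooth section of positive definite symmetric bilinear forms on the tangent bundle);
`g.inner x v w` is `g_x(v, w)`. -/
abbrev Metric (n : ℕ) (M : Type*) [TopologicalSpace M]
    [ChartedSpace (EuclideanSpace ℝ (Fin n)) M] [IsManifold (𝓡 n) ∞ M] :=
  ContMDiffRiemannianMetric (𝓡 n) ∞ (EuclideanSpace ℝ (Fin n))
    (fun x : M => TangentSpace (𝓡 n) x)

/-- The extended geodesic distance of `g`: the infimum of the `g`-lengths of the `C^1` paths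
joining the two points. -/
def geodesicEDist (g : Metric n M) (x y : M) : ℝ≥0∞ :=
  letI : RiemannianBundle (fun x : M => TangentSpace (𝓡 n) x) := ⟨g.toRiemannianMetric⟩
  Manifold.riemannianEDist (𝓡 n) x y

/-- The geodesic distance of `g` as a real number (on a connected manifold
`geodesicEDist` is finite). -/
def geodesicDist (g : Metric n M) (x y : M) : ℝ :=
  (geodesicEDist g x y).toReal

/-- `(M, g)` is complete: every sequence that is Cauchy for the geodesic distance converges. -/
def IsCompleteMetric (g : Metric n M) : Prop :=
  ∀ s : ℕ → M,
    (∀ ε : ℝ≥0∞, 0 < ε → ∃ N : ℕ, ∀ k ≥ N, ∀ l ≥ N, geodesicEDist g (s k) (s l) < ε) →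
      ∃ x : M, Tendsto (fun k => geodesicEDist g (s k) x) atTop (𝓝 0)

/-- The coordinate vector field `∂_i` of the chart `e`, at the point with coordinates `y`. -/
def coordVector (e : OpenPartialHomeomorph M (EuclideanSpace ℝ (Fin n))) (i : Fin n)
    (y : EuclideanSpace ℝ (Fin n)) : TangentSpace (𝓡 n) (e.symm y) :=
  mfderiv (𝓡 n) (𝓡 n) e.symm y (EuclideanSpace.single i (1 : ℝ))

/-- The matrix `g_ij = g(∂_i, ∂_j)` of the metric in the chart `e`, as a function of the
coordinates `y`. -/
def metricMatrix (g : Metric n M) (e : OpenPartialHomeomorph M (EuclideanSpace ℝ (Fin n)))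
    (y : EuclideanSpace ℝ (Fin n)) : Matrix (Fin n) (Fin n) ℝ :=
  fun i j => g.inner (e.symm y) (coordVector e i y) (coordVector e j y)

/-- The volume density `√(det g_ij)` in the chart `e`. -/
def volumeDensity (g : Metric n M) (e : OpenPartialHomeomorph M (EuclideanSpace ℝ (Fin n)))
    (y : EuclideanSpace ℝ (Fin n)) : ℝ :=
  √(metricMatrix g e y).det

/-- The gradient of `f` at `x`: the vector representing `df_x` through `g_x`. -/
def gradient (g : Metric n M) (f : M → ℝ) (x : M) : TangentSpace (𝓡 n) x :=
  letI : RiemannianBundle (fun x : M => TangentSpace (𝓡 n) x) := ⟨g.toRiemannianMetric⟩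
  haveI : FiniteDimensional ℝ (TangentSpace (𝓡 n) x) :=
    inferInstanceAs (FiniteDimensional ℝ (EuclideanSpace ℝ (Fin n)))
  haveI : CompleteSpace (TangentSpace (𝓡 n) x) := FiniteDimensional.complete ℝ _
  (InnerProductSpace.toDual ℝ (TangentSpace (𝓡 n) x)).symm (mfderiv (𝓡 n) 𝓘(ℝ, ℝ) f x)

/-- The defining property of the gradient: `g(∇f, v) = df(v)`. -/
theorem inner_gradient (g : Metric n M) (f : M → ℝ) (x : M) (v : TangentSpace (𝓡 n) x) :
    g.inner x (gradient g f x) v = mfderiv (𝓡 n) 𝓘(ℝ, ℝ) f x v := by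
  let : RiemannianBundle (fun x : M => TangentSpace (𝓡 n) x) := ⟨g.toRiemannianMetric⟩
  have : FiniteDimensional ℝ (TangentSpace (𝓡 n) x) :=
    inferInstanceAs (FiniteDimensional ℝ (EuclideanSpace ℝ (Fin n)))
  have : CompleteSpace (TangentSpace (𝓡 n) x) := FiniteDimensional.complete ℝ _
  exact InnerProductSpace.toDual_symm_apply (𝕜 := ℝ) (E := TangentSpace (𝓡 n) x)

/-- The Laplace-Beltrami operator in the chart `e`, at the point with coordinates `y`:
`Δf = (det g)^(-1/2) ∑_i ∂_i (∑_j (det g)^(1/2) g^{ij} ∂_j f)`. -/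
def laplacianInChart (g : Metric n M) (e : OpenPartialHomeomorph M (EuclideanSpace ℝ (Fin n)))
    (f : M → ℝ) (y : EuclideanSpace ℝ (Fin n)) : ℝ :=
  (volumeDensity g e y)⁻¹ * ∑ i : Fin n,
    fderiv ℝ (fun z => ∑ j : Fin n, volumeDensity g e z * (metricMatrix g e z)⁻¹ i j *
      fderiv ℝ (fun z' => f (e.symm z')) z (EuclideanSpace.single j (1 : ℝ)))
      y (EuclideanSpace.single i (1 : ℝ))

/-- The Laplace-Beltrami operator `Δ_g f` at `x`, computed in the preferred chart at `x`
(its value does not depend on the chart). -/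
def laplacian (g : Metric n M) (f : M → ℝ) (x : M) : ℝ :=
  laplacianInChart g (chartAt (EuclideanSpace ℝ (Fin n)) x) f
    (chartAt (EuclideanSpace ℝ (Fin n)) x x)

/-- The measure `√(det g_ij) dy` of the chart `e`, transported to the domain of `e` in `M`. -/
def chartVolume [MeasurableSpace M] (g : Metric n M)
    (e : OpenPartialHomeomorph M (EuclideanSpace ℝ (Fin n))) : Measure M :=
  (((volume : Measure (EuclideanSpace ℝ (Fin n))).restrict e.target).withDensity
    (fun y => ENNReal.ofReal (volumeDensity g e y))).map e.symm

/-- The Riemannian volume measure `dV` of `g`. The measures `√(det g_ij) dy` of two charts agree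
on the intersection of their domains; `dV` is the measure glued from them, that is, the smallest
measure on `M` that is at least `√(det g_ij) dy` on the domain of each chart. -/
def riemannianVolume [MeasurableSpace M] (g : Metric n M) : Measure M :=
  ⨆ x : M, chartVolume g (chartAt (EuclideanSpace ℝ (Fin n)) x)

/-- `u ∈ C^{2,1}(M × (0,T))`: in the charts of `M`, the derivatives of `u` of order at most two in
space and of order one in time exist and are continuous in `M × (0,T)`
(the continuity of `u` itself is a separate hypothesis). -/
def IsC21 (n : ℕ) {M : Type*} [TopologicalSpace M]
    [ChartedSpace (EuclideanSpace ℝ (Fin n)) M] (T : ℝ) (u : M → ℝ → ℝ) : Prop :=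
  ∀ e ∈ atlas (EuclideanSpace ℝ (Fin n)) M,
    (∀ t ∈ Ioo 0 T, ContDiffOn ℝ 2 (fun y => u (e.symm y) t) e.target) ∧
    (∀ y ∈ e.target, ∀ t ∈ Ioo 0 T, DifferentiableAt ℝ (fun s => u (e.symm y) s) t) ∧
    ContinuousOn (fun p : EuclideanSpace ℝ (Fin n) × ℝ =>
      fderiv ℝ (fun y => u (e.symm y) p.2) p.1) (e.target ×ˢ Ioo 0 T) ∧
    ContinuousOn (fun p : EuclideanSpace ℝ (Fin n) × ℝ =>
      fderiv ℝ (fderiv ℝ (fun y => u (e.symm y) p.2)) p.1) (e.target ×ˢ Ioo 0 T) ∧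
    ContinuousOn (fun p : EuclideanSpace ℝ (Fin n) × ℝ =>
      deriv (fun s => u (e.symm p.1) s) p.2) (e.target ×ˢ Ioo 0 T)

end MaxPrinciple

end

/-! The proof is an energy estimate with a moving Gaussian weight. Let ρ be the g(0)-distance to x₀.
Integrating the bound on ∂g/∂t makes all g(s) comparable to g(0) with factor A = exp(α₃ T), so ρ is
L-Lipschitz for every g(s), L = √A. Completeness of g(0) makes the sets {ρ ≤ R} compact (Hopf–Rinow,
`isCompact_geodesicDist_le`). Let φ_R be a cutoff in ρ, κ = 1/(K(τ - s)) with K = 4L², and F_R(s) =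
∫ φ_R² exp(-κρ² - Cs) u₊² dV_s.

Testing the inequality with ψ = φ_R² exp(-κρ² - Cs) u₊ and applying Green's formula (`green`) yields
a good term -2∫φ_R² exp(-κρ² - Cs)|∇u|² on {u > 0}. Young's inequality (`energy_absorption`) spends
it on the cross terms from φ_R, from the weight and from the drift. The weight costs 4κ²L²ρ², which
K = 4L² makes equal to the decrease Kκ²ρ² of the exponent in time; C pays for the drift, for b and
for the variation of dV_s. Only an error of order (L/R)² times the weighted energy remains
(`integral_energyDensityDeriv_le`).

On a time interval starting at t₀ with u(·,t₀) ≤ 0, and short enough that κ ≥ λA, the growth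
hypothesis bounds the time integral of that energy uniformly in R. Hence F_R(t) = O(R⁻²); since F_R
increases with R, it vanishes and u ≤ 0 (`nonpos_of_short_time`). The admissible length does not
depend on t₀, so finitely many steps reach any t < T.

Regularity dictates two detours. The metric is differentiable in t only pointwise, so dV_s is never
differentiated: only dV_t ≤ exp(c(t-s)) dV_s and its reverse are used, and F_R is controlled through
right slopes (`le_integral_of_slope_le`). Also ρ and u₊ are merely Lipschitz, so Green's formula is
proved for Lipschitz test functions by Rademacher's theorem. -/

set_option linter.unusedSectionVars false

/-! ### Metric, gradient and volume density in charts -/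

noncomputable section

namespace MaxPrinciple

variable {n : ℕ} {M : Type*} [TopologicalSpace M] [ChartedSpace (EuclideanSpace ℝ (Fin n)) M]
  [IsManifold (𝓡 n) ∞ M]

attribute [local instance 10000] chartedSpaceSelf

local notation "𝔼" => EuclideanSpace ℝ (Fin n)

/-- The differential of the inverse of the chart `e`, as a map from the model space. -/
def chartDeriv (e : OpenPartialHomeomorph M 𝔼) (y : 𝔼) : 𝔼 →L[ℝ] TangentSpace (𝓡 n) (e.symm y) :=
  mfderiv (𝓡 n) (𝓡 n) e.symm y

/-- The tangent map of the inverse chart is smooth, and it is composed here with a constant, hence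
smooth, vector field on the model space. -/
theorem contMDiffOn_chartDeriv {e : OpenPartialHomeomorph M 𝔼}
    (he : e ∈ IsManifold.maximalAtlas (𝓡 n) ∞ M) (v : 𝔼) :
    ContMDiffOn (𝓡 n) (𝓡 n).tangent ∞
      (fun y => (⟨e.symm y, chartDeriv e y v⟩ : TotalSpace 𝔼 (fun x : M => TangentSpace (𝓡 n) x)))
      e.target := by
  have h1 := (contMDiffOn_symm_of_mem_maximalAtlas (I := 𝓡 n) (n := ∞) he).contMDiffOn_tangentMapWithin
    (m := ∞) (by simp) e.open_target.uniqueMDiffOn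
  have h2 : ContMDiff (𝓡 n) (𝓡 n).tangent ∞
      (fun y : 𝔼 => (⟨y, v⟩ : TangentBundle (𝓡 n) 𝔼)) := by
    exact contMDiff_vectorSpace_iff_contDiff.2 contDiff_const
  refine (h1.comp h2.contMDiffOn (fun y hy => hy)).congr fun y hy => ?_
  simp only [Function.comp, tangentMapWithin, chartDeriv]
  rw [mfderivWithin_of_isOpen e.open_target hy]
  rfl

theorem contDiffOn_inner_chartDeriv (g : Metric n M) {e : OpenPartialHomeomorph M 𝔼}
    (he : e ∈ IsManifold.maximalAtlas (𝓡 n) ∞ M) (v w : 𝔼) :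
    ContDiffOn ℝ ∞ (fun y => g.inner (e.symm y) (chartDeriv e y v) (chartDeriv e y w)) e.target := by
  let _ : RiemannianBundle (fun x : M => TangentSpace (𝓡 n) x) := ⟨g.toRiemannianMetric⟩
  rw [← contMDiffOn_iff_contDiffOn]
  exact ContMDiffOn.inner_bundle (IB := 𝓡 n) (F := 𝔼) (E := fun x : M => TangentSpace (𝓡 n) x)
    (contMDiffOn_chartDeriv he v) (contMDiffOn_chartDeriv he w)

theorem contDiffOn_metricMatrix (g : Metric n M) {e : OpenPartialHomeomorph M 𝔼}
    (he : e ∈ IsManifold.maximalAtlas (𝓡 n) ∞ M) (i j : Fin n) :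
    ContDiffOn ℝ ∞ (fun y => metricMatrix g e y i j) e.target :=
  contDiffOn_inner_chartDeriv g he _ _

theorem mdifferentiable_of_mem_maximalAtlas {e : OpenPartialHomeomorph M 𝔼}
    (he : e ∈ IsManifold.maximalAtlas (𝓡 n) ∞ M) : e.MDifferentiable (𝓡 n) (𝓡 n) :=
  ⟨(contMDiffOn_of_mem_maximalAtlas he).mdifferentiableOn (by simp),
    (contMDiffOn_symm_of_mem_maximalAtlas he).mdifferentiableOn (by simp)⟩

theorem mem_maximalAtlas_chartAt (c : M) : chartAt 𝔼 c ∈ IsManifold.maximalAtlas (𝓡 n) ∞ M :=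
  IsManifold.chart_mem_maximalAtlas c

/-- The pairing `dψ(∇f) = g(∇ψ, ∇f)`. -/
def gradPairing (g : Metric n M) (ψ f : M → ℝ) (x : M) : ℝ :=
  mfderiv (𝓡 n) 𝓘(ℝ, ℝ) ψ x (gradient g f x)

theorem chartDeriv_bijective {e : OpenPartialHomeomorph M 𝔼}
    (he : e ∈ IsManifold.maximalAtlas (𝓡 n) ∞ M) {y : 𝔼} (hy : y ∈ e.target) :
    Function.Bijective (chartDeriv e y) :=
  (mdifferentiable_of_mem_maximalAtlas he).symm.mfderiv_bijective hy

theorem mdifferentiableAt_iff_comp_symm {e : OpenPartialHomeomorph M 𝔼}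
    (he : e ∈ IsManifold.maximalAtlas (𝓡 n) ∞ M) {y : 𝔼} (hy : y ∈ e.target) {f : M → ℝ} :
    MDifferentiableAt (𝓡 n) 𝓘(ℝ, ℝ) f (e.symm y) ↔
      DifferentiableAt ℝ (fun z => f (e.symm z)) y := by
  have hd := mdifferentiable_of_mem_maximalAtlas he
  constructor
  · intro h
    exact mdifferentiableAt_iff_differentiableAt.1 (h.comp y (hd.mdifferentiableAt_symm hy))
  · intro h
    have h1 : MDifferentiableAt (𝓡 n) 𝓘(ℝ, ℝ) ((fun z => f (e.symm z)) ∘ e) (e.symm y) := by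
      refine MDifferentiableAt.comp _ ?_ (hd.mdifferentiableAt (e.map_target hy))
      rw [e.right_inv hy]
      exact mdifferentiableAt_iff_differentiableAt.2 h
    refine h1.congr_of_eventuallyEq ?_
    filter_upwards [e.open_source.mem_nhds (e.map_target hy)] with x hx
    simp [e.left_inv hx]

theorem fderiv_comp_symm {e : OpenPartialHomeomorph M 𝔼}
    (he : e ∈ IsManifold.maximalAtlas (𝓡 n) ∞ M) {y : 𝔼} (hy : y ∈ e.target) {f : M → ℝ}
    (hf : MDifferentiableAt (𝓡 n) 𝓘(ℝ, ℝ) f (e.symm y)) (v : 𝔼) :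
    fderiv ℝ (fun z => f (e.symm z)) y v =
      mfderiv (𝓡 n) 𝓘(ℝ, ℝ) f (e.symm y) (chartDeriv e y v) := by
  have hd := mdifferentiable_of_mem_maximalAtlas he
  have h := mfderiv_comp_apply y hf (hd.mdifferentiableAt_symm hy) v
  rw [mfderiv_eq_fderiv] at h
  exact h

/-- The metric `g` in the chart `e`, as a bilinear form on the model space. -/
def chartInner (g : Metric n M) (e : OpenPartialHomeomorph M 𝔼) (y v w : 𝔼) : ℝ :=
  g.inner (e.symm y) (chartDeriv e y v) (chartDeriv e y w)

theorem metricMatrix_eq_chartInner (g : Metric n M) (e : OpenPartialHomeomorph M 𝔼) (y : 𝔼)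
    (i j : Fin n) : metricMatrix g e y i j =
      chartInner g e y (EuclideanSpace.single i 1) (EuclideanSpace.single j 1) := rfl

theorem chartInner_symm (g : Metric n M) (e : OpenPartialHomeomorph M 𝔼) (y v w : 𝔼) :
    chartInner g e y v w = chartInner g e y w v := g.symm _ _ _

theorem sum_single_eq (v : 𝔼) : ∑ i, v i • EuclideanSpace.single i (1 : ℝ) = v := by
  simpa using (EuclideanSpace.basisFun (Fin n) ℝ).sum_repr v

theorem chartInner_eq_sum (g : Metric n M) (e : OpenPartialHomeomorph M 𝔼) (y v w : 𝔼) :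
    chartInner g e y v w = ∑ i, ∑ j, v i * w j * metricMatrix g e y i j := by
  conv_lhs => rw [← sum_single_eq v, ← sum_single_eq w]
  simp only [chartInner, map_sum, map_smul, sum_apply,
    FunLike.coe_smul, Pi.smul_apply, smul_eq_mul, metricMatrix_eq_chartInner, Finset.mul_sum]
  rw [Finset.sum_comm]
  exact Finset.sum_congr rfl fun i _ => Finset.sum_congr rfl fun j _ => by ring

theorem chartInner_pos (g : Metric n M) {e : OpenPartialHomeomorph M 𝔼}
    (he : e ∈ IsManifold.maximalAtlas (𝓡 n) ∞ M) {y : 𝔼} (hy : y ∈ e.target) {v : 𝔼}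
    (hv : v ≠ 0) : 0 < chartInner g e y v v := by
  refine g.pos _ _ fun h => hv ((chartDeriv_bijective he hy).1 ?_)
  rw [h, map_zero]

theorem posDef_metricMatrix (g : Metric n M) {e : OpenPartialHomeomorph M 𝔼}
    (he : e ∈ IsManifold.maximalAtlas (𝓡 n) ∞ M) {y : 𝔼} (hy : y ∈ e.target) :
    (metricMatrix g e y).PosDef := by
  refine Matrix.PosDef.of_dotProduct_mulVec_pos ?_ fun v hv => ?_
  · exact Matrix.IsHermitian.ext fun i j => chartInner_symm g e y _ _
  · have h := chartInner_pos g he hy (v := WithLp.toLp 2 v) fun h0 => hv (congrArg WithLp.ofLp h0)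
    rw [chartInner_eq_sum] at h
    refine h.trans_eq ?_
    simp only [dotProduct, Matrix.mulVec, Finset.mul_sum]
    exact Finset.sum_congr rfl fun i _ => Finset.sum_congr rfl fun j _ => by
      simp [mul_comm]
      exact mul_assoc (G := ℝ) _ _ _

theorem volumeDensity_pos (g : Metric n M) {e : OpenPartialHomeomorph M 𝔼}
    (he : e ∈ IsManifold.maximalAtlas (𝓡 n) ∞ M) {y : 𝔼} (hy : y ∈ e.target) :
    0 < volumeDensity g e y :=
  Real.sqrt_pos.2 (posDef_metricMatrix g he hy).det_pos

theorem contDiffOn_det {E ι : Type*} [NormedAddCommGroup E] [NormedSpace ℝ E] [Fintype ι]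
    [DecidableEq ι] {s : Set E} {k : ℕ∞ω} {A : E → Matrix ι ι ℝ}
    (hA : ∀ i j, ContDiffOn ℝ k (fun y => A y i j) s) : ContDiffOn ℝ k (fun y => (A y).det) s := by
  simp only [Matrix.det_apply]
  exact ContDiffOn.sum fun σ _ => (contDiffOn_prod fun i _ => hA _ _).const_smul _

theorem contDiffOn_volumeDensity (g : Metric n M) {e : OpenPartialHomeomorph M 𝔼}
    (he : e ∈ IsManifold.maximalAtlas (𝓡 n) ∞ M) :
    ContDiffOn ℝ ∞ (volumeDensity g e) e.target :=
  (contDiffOn_det (contDiffOn_metricMatrix g he)).sqrt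
    fun _ hy => (posDef_metricMatrix g he hy).det_pos.ne'

/-- Cramer's rule: an entry of the inverse is a polynomial in the smooth entries divided by the
nonvanishing determinant. -/
theorem contDiffOn_metricMatrix_inv (g : Metric n M) {e : OpenPartialHomeomorph M 𝔼}
    (he : e ∈ IsManifold.maximalAtlas (𝓡 n) ∞ M) (i j : Fin n) :
    ContDiffOn ℝ ∞ (fun y => (metricMatrix g e y)⁻¹ i j) e.target := by
  have h : ContDiffOn ℝ ∞ (fun y => ((metricMatrix g e y).det)⁻¹ *
      ((metricMatrix g e y).updateRow j (Pi.single i 1)).det) e.target := by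
    refine ((contDiffOn_det (contDiffOn_metricMatrix g he)).inv
      fun _ hy => (posDef_metricMatrix g he hy).det_pos.ne').mul (contDiffOn_det fun k l => ?_)
    by_cases hk : k = j
    · subst hk
      simpa using contDiffOn_const
    · simpa [Matrix.updateRow_apply, hk] using contDiffOn_metricMatrix g he k l
  refine h.congr fun y _ => ?_
  simp [Matrix.inv_def, Matrix.adjugate_apply, Ring.inverse_eq_inv']

/-- If c is the coordinate vector of ∇f and G the metric matrix, the defining property of the
gradient reads G c = df; invert G and apply dh. -/
theorem gradPairing_eq_sum (g : Metric n M) {e : OpenPartialHomeomorph M 𝔼}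
    (he : e ∈ IsManifold.maximalAtlas (𝓡 n) ∞ M) {y : 𝔼} (hy : y ∈ e.target) {f h : M → ℝ}
    (hf : MDifferentiableAt (𝓡 n) 𝓘(ℝ, ℝ) f (e.symm y))
    (hh : MDifferentiableAt (𝓡 n) 𝓘(ℝ, ℝ) h (e.symm y)) :
    gradPairing g h f (e.symm y) =
      ∑ i, ∑ j, (metricMatrix g e y)⁻¹ i j *
        fderiv ℝ (fun z => h (e.symm z)) y (EuclideanSpace.single i 1) *
        fderiv ℝ (fun z => f (e.symm z)) y (EuclideanSpace.single j 1) := by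
  obtain ⟨c, hc⟩ := (chartDeriv_bijective he hy).2 (gradient g f (e.symm y))
  set G := metricMatrix g e y with hG
  set df : Fin n → ℝ := fun j => fderiv ℝ (fun z => f (e.symm z)) y (EuclideanSpace.single j 1)
    with hdf
  have h1 : G.mulVec c.ofLp = df := by
    ext k
    simp only [hdf, fderiv_comp_symm he hy hf]
    rw [← inner_gradient g f, ← hc, g.symm]
    change _ = chartInner g e y _ _
    rw [chartInner_eq_sum]
    simp only [Matrix.mulVec, dotProduct, EuclideanSpace.single, PiLp.single_apply, ite_mul, one_mul,
      zero_mul]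
    simp [mul_comm, hG]
  have h2 : c.ofLp = G⁻¹.mulVec df := by
    rw [← h1, Matrix.mulVec_mulVec, Matrix.nonsing_inv_mul, Matrix.one_mulVec]
    exact (posDef_metricMatrix g he hy).det_pos.ne'.isUnit
  rw [gradPairing, ← hc, ← fderiv_comp_symm he hy hh]
  conv_lhs => rw [← sum_single_eq c]
  simp only [map_sum, map_smul, smul_eq_mul, h2, Matrix.mulVec, dotProduct, Finset.sum_mul]
  exact Finset.sum_congr rfl fun i _ => Finset.sum_congr rfl fun j _ => by
    simp only [hdf]
    exact mul_right_comm (G := ℝ) _ _ _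

theorem chartInner_transition (g : Metric n M) {e e' : OpenPartialHomeomorph M 𝔼}
    (he : e ∈ IsManifold.maximalAtlas (𝓡 n) ∞ M) (he' : e' ∈ IsManifold.maximalAtlas (𝓡 n) ∞ M)
    {y : 𝔼} (hy : y ∈ e.target) (hy' : e.symm y ∈ e'.source) (v w : 𝔼) :
    chartInner g e y v w = chartInner g e' (e' (e.symm y))
      (fderiv ℝ (fun z => e' (e.symm z)) y v) (fderiv ℝ (fun z => e' (e.symm z)) y w) := by
  have hd := mdifferentiable_of_mem_maximalAtlas he
  have hd' := mdifferentiable_of_mem_maximalAtlas he'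
  -- All tangent spaces are definitionally the model space, so the base point can be replaced by an
  -- equal one without a cast on the vectors.
  have key : ∀ (x x' : M) (_ : x' = x) (a b : 𝔼),
      (g.inner x : 𝔼 →L[ℝ] 𝔼 →L[ℝ] ℝ) a b = (g.inner x' : 𝔼 →L[ℝ] 𝔼 →L[ℝ] ℝ) a b := by
    rintro x _ rfl a b; rfl
  have hτ : MDifferentiableAt (𝓡 n) (𝓡 n) (fun z => e' (e.symm z)) y :=
    (hd'.mdifferentiableAt hy').comp y (hd.mdifferentiableAt_symm hy)
  have h1 : ∀ u : 𝔼, (chartDeriv e y u : 𝔼) =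
      (chartDeriv e' (e' (e.symm y)) (fderiv ℝ (fun z => e' (e.symm z)) y u) : 𝔼) := by
    intro u
    have hev : (e.symm : 𝔼 → M) =ᶠ[𝓝 y] (e'.symm ∘ fun z => e' (e.symm z)) := by
      have : e.symm ⁻¹' e'.source ∈ 𝓝 y :=
        (e.continuousAt_symm hy).preimage_mem_nhds (e'.open_source.mem_nhds hy')
      filter_upwards [this] with z hz
      simp [e'.left_inv hz]
    have h2 := hev.mfderiv_eq (I := 𝓡 n) (I' := 𝓡 n)
    have h3 := mfderiv_comp_apply y (hd'.mdifferentiableAt_symm (e'.map_source hy')) hτ u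
    rw [mfderiv_eq_fderiv] at h3
    exact (congrArg (fun L : 𝔼 →L[ℝ] 𝔼 => L u) h2).trans h3
  unfold chartInner
  have h4 := key (e.symm y) (e'.symm (e' (e.symm y))) (e'.left_inv hy')
    (chartDeriv e' (e' (e.symm y)) (fderiv ℝ (fun z => e' (e.symm z)) y v))
    (chartDeriv e' (e' (e.symm y)) (fderiv ℝ (fun z => e' (e.symm z)) y w))
  refine Eq.trans ?_ h4
  exact congrArg₂ (fun a b => (g.inner (e.symm y) : 𝔼 →L[ℝ] 𝔼 →L[ℝ] ℝ) a b) (h1 v) (h1 w)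

/-- The metric matrices satisfy G = Jᵀ G' J, where J is the Jacobian matrix of the coordinate
change; take determinants and square roots. -/
theorem volumeDensity_transition (g : Metric n M) {e e' : OpenPartialHomeomorph M 𝔼}
    (he : e ∈ IsManifold.maximalAtlas (𝓡 n) ∞ M) (he' : e' ∈ IsManifold.maximalAtlas (𝓡 n) ∞ M)
    {y : 𝔼} (hy : y ∈ e.target) (hy' : e.symm y ∈ e'.source) :
    volumeDensity g e y = |(fderiv ℝ (fun z => e' (e.symm z)) y).det| *
      volumeDensity g e' (e' (e.symm y)) := by
  set D := fderiv ℝ (fun z => e' (e.symm z)) y with hD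
  set b := (EuclideanSpace.basisFun (Fin n) ℝ).toBasis
  set J := LinearMap.toMatrix b b (D : 𝔼 →ₗ[ℝ] 𝔼) with hJ
  have hJ' : ∀ i j, J i j = D (EuclideanSpace.single j 1) i := by
    intro i j
    simp [hJ, b, LinearMap.toMatrix_apply]
  have h1 : metricMatrix g e y = J.transpose * metricMatrix g e' (e' (e.symm y)) * J := by
    ext i j
    rw [metricMatrix_eq_chartInner, chartInner_transition g he he' hy hy', chartInner_eq_sum]
    simp only [Matrix.mul_apply, Matrix.transpose_apply, hJ', Finset.sum_mul]
    rw [Finset.sum_comm]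
    exact Finset.sum_congr rfl fun i _ => Finset.sum_congr rfl fun j _ => mul_right_comm _ _ _
  have h2 : D.det = J.det := by rw [hJ, LinearMap.det_toMatrix]
  rw [volumeDensity, h1, Matrix.det_mul, Matrix.det_mul, Matrix.det_transpose, h2, volumeDensity,
    show J.det * (metricMatrix g e' (e' (e.symm y))).det * J.det =
      J.det ^ 2 * (metricMatrix g e' (e' (e.symm y))).det by ring,
    Real.sqrt_mul (sq_nonneg _), Real.sqrt_sq_eq_abs]

end MaxPrinciple
end

/-! ### The Riemannian volume measure -/

noncomputable section

namespace MaxPrinciple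

variable {n : ℕ} {M : Type*} [TopologicalSpace M] [ChartedSpace (EuclideanSpace ℝ (Fin n)) M]
  [IsManifold (𝓡 n) ∞ M]

attribute [local instance 10000] chartedSpaceSelf

local notation "𝔼" => EuclideanSpace ℝ (Fin n)

theorem measurableSet_inter_preimage {α β : Type*} [TopologicalSpace α] [MeasurableSpace α]
    [OpensMeasurableSpace α] [TopologicalSpace β] [MeasurableSpace β] [BorelSpace β]
    {f : α → β} {s : Set α} (hf : ContinuousOn f s) (hs : MeasurableSet s) {B : Set β}
    (hB : MeasurableSet B) : MeasurableSet (s ∩ f ⁻¹' B) := by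
  have h := hs.subtype_image ((continuousOn_iff_continuous_domRestrict.1 hf).measurable hB)
  convert h using 1
  ext x
  simp [and_comm]

variable [MeasurableSpace M] [BorelSpace M]

/-- The measure `√(det g_ij) dy` on the model space. -/
def chartDensityMeasure (g : Metric n M) (e : OpenPartialHomeomorph M 𝔼) : Measure 𝔼 :=
  ((volume : Measure 𝔼).restrict e.target).withDensity
    (fun y => ENNReal.ofReal (volumeDensity g e y))

theorem aemeasurable_volumeDensity (g : Metric n M) {e : OpenPartialHomeomorph M 𝔼}
    (he : e ∈ IsManifold.maximalAtlas (𝓡 n) ∞ M) :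
    AEMeasurable (volumeDensity g e) ((volume : Measure 𝔼).restrict e.target) :=
  (contDiffOn_volumeDensity g he).continuousOn.aemeasurable e.open_target.measurableSet

theorem chartDensityMeasure_restrict (g : Metric n M) (e : OpenPartialHomeomorph M 𝔼) :
    (chartDensityMeasure g e).restrict e.target = chartDensityMeasure g e := by
  rw [chartDensityMeasure, restrict_withDensity e.open_target.measurableSet,
    Measure.restrict_restrict e.open_target.measurableSet, inter_self]

theorem isOpenEmbedding_symm (e : OpenPartialHomeomorph M 𝔼) :
    Topology.IsOpenEmbedding (fun y : e.target => e.symm y) :=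
  e.symm.isOpenEmbedding_restrict

/-- The inverse chart is controlled only on `e.target`. Restricted there it is an open embedding, so
integrals can be transported with no measurability assumption on the integrand. -/
theorem chartVolume_eq_map (g : Metric n M) (e : OpenPartialHomeomorph M 𝔼) :
    chartVolume g e = Measure.map (fun y : e.target => e.symm y)
      (Measure.comap (Subtype.val) (chartDensityMeasure g e)) := by
  have h1 : AEMeasurable e.symm (chartDensityMeasure g e) :=
    (e.continuousOn_symm.aemeasurable e.open_target.measurableSet).mono_ac
      (withDensity_absolutelyContinuous _ _)
  have h2 : chartDensityMeasure g e =
      Measure.map (Subtype.val : e.target → 𝔼) (Measure.comap (Subtype.val)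
        (chartDensityMeasure g e)) := by
    rw [map_comap_subtype_coe e.open_target.measurableSet, chartDensityMeasure_restrict]
  change Measure.map e.symm (chartDensityMeasure g e) = _
  rw [h2] at h1
  conv_lhs => rw [h2]
  rw [AEMeasurable.map_map_of_aemeasurable h1 measurable_subtype_coe.aemeasurable]
  rfl

theorem lintegral_chartVolume (g : Metric n M) {e : OpenPartialHomeomorph M 𝔼}
    (he : e ∈ IsManifold.maximalAtlas (𝓡 n) ∞ M) (f : M → ℝ≥0∞) :
    ∫⁻ x, f x ∂chartVolume g e =
      ∫⁻ y in e.target, ENNReal.ofReal (volumeDensity g e y) * f (e.symm y) := by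
  rw [chartVolume_eq_map, (isOpenEmbedding_symm e).measurableEmbedding.lintegral_map,
    lintegral_subtype_comap e.open_target.measurableSet (fun y => f (e.symm y)),
    chartDensityMeasure_restrict, chartDensityMeasure,
    lintegral_withDensity_eq_lintegral_mul_non_measurable₀ _
      (aemeasurable_volumeDensity g he).ennreal_ofReal (ae_of_all _ fun _ => ENNReal.ofReal_lt_top)]
  rfl

theorem integral_chartVolume (g : Metric n M) {e : OpenPartialHomeomorph M 𝔼}
    (he : e ∈ IsManifold.maximalAtlas (𝓡 n) ∞ M) (f : M → ℝ) :
    ∫ x, f x ∂chartVolume g e = ∫ y in e.target, volumeDensity g e y * f (e.symm y) := by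
  rw [chartVolume_eq_map, (isOpenEmbedding_symm e).measurableEmbedding.integral_map,
    integral_subtype_comap e.open_target.measurableSet (fun y => f (e.symm y)),
    chartDensityMeasure_restrict, chartDensityMeasure,
    integral_withDensity_eq_integral_toReal_smul₀
      (aemeasurable_volumeDensity g he).ennreal_ofReal (ae_of_all _ fun _ => ENNReal.ofReal_lt_top)]
  refine setIntegral_congr_fun e.open_target.measurableSet fun y hy => ?_
  simp [ENNReal.toReal_ofReal (volumeDensity_pos g he hy).le]

theorem integrable_chartVolume_iff (g : Metric n M) {e : OpenPartialHomeomorph M 𝔼}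
    (he : e ∈ IsManifold.maximalAtlas (𝓡 n) ∞ M) (f : M → ℝ) :
    Integrable f (chartVolume g e) ↔
      IntegrableOn (fun y => volumeDensity g e y * f (e.symm y)) e.target := by
  rw [chartVolume_eq_map, (isOpenEmbedding_symm e).measurableEmbedding.integrable_map_iff]
  have h1 : Integrable (f ∘ fun y : e.target => e.symm y)
      (Measure.comap Subtype.val (chartDensityMeasure g e)) ↔
      IntegrableOn (fun y => f (e.symm y)) e.target (chartDensityMeasure g e) :=
    (integrableOn_iff_comap_subtypeVal (f := fun y => f (e.symm y))
      e.open_target.measurableSet).symm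
  rw [h1, IntegrableOn, chartDensityMeasure_restrict, chartDensityMeasure,
    integrable_withDensity_iff_integrable_smul₀']
  · refine integrable_congr ((ae_restrict_iff' e.open_target.measurableSet).2 (ae_of_all _ ?_))
    intro y hy
    simp [ENNReal.toReal_ofReal (volumeDensity_pos g he hy).le]
  · exact (aemeasurable_volumeDensity g he).ennreal_ofReal
  · exact ae_of_all _ fun _ => ENNReal.ofReal_lt_top

theorem ae_chartVolume_iff (g : Metric n M) {e : OpenPartialHomeomorph M 𝔼}
    (he : e ∈ IsManifold.maximalAtlas (𝓡 n) ∞ M) (p : M → Prop) :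
    (∀ᵐ x ∂chartVolume g e, p x) ↔
      ∀ᵐ y ∂(volume : Measure 𝔼).restrict e.target, p (e.symm y) := by
  rw [chartVolume_eq_map, (isOpenEmbedding_symm e).measurableEmbedding.ae_map_iff,
    ← ae_restrict_iff_subtype e.open_target.measurableSet (p := fun y => p (e.symm y)),
    chartDensityMeasure_restrict, chartDensityMeasure,
    ae_withDensity_iff' (aemeasurable_volumeDensity g he).ennreal_ofReal]
  refine eventually_congr ((ae_restrict_iff' e.open_target.measurableSet).2 (ae_of_all _ ?_))
  intro y hy
  simp [volumeDensity_pos g he hy]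

theorem chartVolume_apply (g : Metric n M) {e : OpenPartialHomeomorph M 𝔼}
    (he : e ∈ IsManifold.maximalAtlas (𝓡 n) ∞ M) {B : Set M} (hB : MeasurableSet B) :
    chartVolume g e B =
      ∫⁻ y in e.target ∩ e.symm ⁻¹' B, ENNReal.ofReal (volumeDensity g e y) := by
  rw [← lintegral_indicator_one hB, lintegral_chartVolume g he,
    ← lintegral_indicator e.open_target.measurableSet, ← lintegral_indicator
      (measurableSet_inter_preimage e.continuousOn_symm e.open_target.measurableSet hB)]
  refine lintegral_congr fun y => ?_
  by_cases h1 : y ∈ e.target <;> by_cases h2 : e.symm y ∈ B <;> simp [h1, h2, indicator]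

/-- Change of variables along the transition map: its Jacobian is exactly the factor relating the
two densities. -/
theorem chartVolume_eq_of_subset (g : Metric n M) {e e' : OpenPartialHomeomorph M 𝔼}
    (he : e ∈ IsManifold.maximalAtlas (𝓡 n) ∞ M) (he' : e' ∈ IsManifold.maximalAtlas (𝓡 n) ∞ M)
    {B : Set M} (hB : MeasurableSet B) (hBe : B ⊆ e.source) (hBe' : B ⊆ e'.source) :
    chartVolume g e B = chartVolume g e' B := by
  rw [chartVolume_apply g he hB, chartVolume_apply g he' hB]
  have himg : (fun z => e' (e.symm z)) '' (e.target ∩ e.symm ⁻¹' B) =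
      e'.target ∩ e'.symm ⁻¹' B := by
    ext z
    constructor
    · rintro ⟨y, ⟨hy, hyB⟩, rfl⟩
      exact ⟨e'.map_source (hBe' hyB), by simpa [e'.left_inv (hBe' hyB)] using hyB⟩
    · rintro ⟨hz, hzB⟩
      refine ⟨e (e'.symm z), ⟨e.map_source (hBe hzB), ?_⟩, ?_⟩
      · simpa [e.left_inv (hBe hzB)] using hzB
      · simp [e.left_inv (hBe hzB), e'.right_inv hz]
  have hinj : InjOn (fun z => e' (e.symm z)) (e.target ∩ e.symm ⁻¹' B) := by
    rintro y ⟨hy, hyB⟩ z ⟨hz, hzB⟩ h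
    exact e.symm.injOn hy hz (e'.injOn (hBe' hyB) (hBe' hzB) h)
  have hms := measurableSet_inter_preimage e.continuousOn_symm e.open_target.measurableSet hB
  rw [← himg, lintegral_image_eq_lintegral_abs_det_fderiv_mul volume hms
    (f' := fderiv ℝ fun z => e' (e.symm z)) (fun y hy => ?_) hinj]
  · refine setLIntegral_congr_fun hms fun y hy => ?_
    rw [volumeDensity_transition g he he' hy.1 (hBe' hy.2), ENNReal.ofReal_mul (abs_nonneg _)]
  · refine (DifferentiableAt.hasFDerivAt ?_).hasFDerivWithinAt
    exact mdifferentiableAt_iff_differentiableAt.1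
      (((mdifferentiable_of_mem_maximalAtlas he').mdifferentiableAt (hBe' hy.2)).comp y
        ((mdifferentiable_of_mem_maximalAtlas he).mdifferentiableAt_symm hy.1))

theorem chartVolume_inter_source (g : Metric n M) {e : OpenPartialHomeomorph M 𝔼}
    (he : e ∈ IsManifold.maximalAtlas (𝓡 n) ∞ M) {B : Set M} (hB : MeasurableSet B) :
    chartVolume g e (B ∩ e.source) = chartVolume g e B := by
  rw [chartVolume_apply g he hB, chartVolume_apply g he (hB.inter e.open_source.measurableSet)]
  congr 2
  ext y
  simp only [mem_inter_iff, mem_preimage]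
  exact ⟨fun h => ⟨h.1, h.2.1⟩, fun h => ⟨h.1, h.2, e.map_target h.1⟩⟩

variable (n M) in
theorem exists_seq_chart_cover [SecondCountableTopology M] [Nonempty M] :
    ∃ c : ℕ → M, ⋃ k, (chartAt 𝔼 (c k)).source = univ := by
  obtain ⟨s, hs, hcov⟩ := TopologicalSpace.countable_cover_nhds
    (fun x : M => chart_source_mem_nhds 𝔼 x)
  have hne : s.Nonempty := by
    by_contra h
    rw [not_nonempty_iff_eq_empty.1 h] at hcov
    simp only [mem_empty_iff_false, iUnion_of_empty, iUnion_empty] at hcov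
    exact empty_ne_univ hcov
  obtain ⟨c, rfl⟩ := hs.exists_eq_range hne
  exact ⟨c, by simpa using hcov⟩

/-- A supremum of measures could a priori exceed each of them, so an upper bound needs a competitor.
The measure `μ` is glued from countably many charts along disjoint pieces of a cover. By agreement
on overlaps it equals the chart measure inside every chart, hence dominates them all and therefore
their supremum. -/
theorem riemannianVolume_apply_of_subset [SecondCountableTopology M] (g : Metric n M) {c : M}
    {B : Set M} (hB : MeasurableSet B) (hBc : B ⊆ (chartAt 𝔼 c).source) :
    riemannianVolume g B = chartVolume g (chartAt 𝔼 c) B := by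
  have : Nonempty M := ⟨c⟩
  obtain ⟨a, ha⟩ := exists_seq_chart_cover n M
  set A := disjointed fun k => (chartAt 𝔼 (a k)).source with hA
  have hAm : ∀ k, MeasurableSet (A k) :=
    fun k => MeasurableSet.disjointed (fun k => (chartAt 𝔼 (a k)).open_source.measurableSet) k
  set μ := Measure.sum fun k => (chartVolume g (chartAt 𝔼 (a k))).restrict (A k) with hμ
  have key : ∀ (x : M) (C : Set M), MeasurableSet C → C ⊆ (chartAt 𝔼 x).source →
      chartVolume g (chartAt 𝔼 x) C = μ C := by
    intro x C hC hCx
    have hC' : C = ⋃ k, C ∩ A k := by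
      rw [← inter_iUnion, hA, iUnion_disjointed, ha, inter_univ]
    rw [hμ, Measure.sum_apply _ hC]
    conv_lhs => rw [hC']
    rw [measure_iUnion (fun i j hij => (disjoint_disjointed _ hij).mono inter_subset_right
      inter_subset_right) fun k => hC.inter (hAm k)]
    refine tsum_congr fun k => ?_
    rw [Measure.restrict_apply hC]
    exact chartVolume_eq_of_subset g (mem_maximalAtlas_chartAt x) (mem_maximalAtlas_chartAt _)
      (hC.inter (hAm k)) (inter_subset_left.trans hCx)
      (inter_subset_right.trans (disjointed_subset _ k))
  have hle : riemannianVolume g ≤ μ := by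
    refine iSup_le fun x => Measure.le_iff.2 fun C hC => ?_
    rw [← chartVolume_inter_source g (mem_maximalAtlas_chartAt x) hC,
      key x _ (hC.inter (chartAt 𝔼 x).open_source.measurableSet) inter_subset_right]
    exact measure_mono inter_subset_left
  refine le_antisymm ((hle B).trans_eq (key c B hB hBc).symm) ?_
  exact (le_iSup (fun x : M => chartVolume g (chartAt 𝔼 x)) c) B

theorem riemannianVolume_restrict_source [SecondCountableTopology M] (g : Metric n M) (c : M) :
    (riemannianVolume g).restrict (chartAt 𝔼 c).source = chartVolume g (chartAt 𝔼 c) := by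
  ext B hB
  rw [Measure.restrict_apply hB, riemannianVolume_apply_of_subset g
    (hB.inter (chartAt 𝔼 c).open_source.measurableSet) inter_subset_right,
    chartVolume_inter_source g (mem_maximalAtlas_chartAt c) hB]

theorem ae_riemannianVolume_iff [SecondCountableTopology M] (g : Metric n M) (p : M → Prop) :
    (∀ᵐ x ∂riemannianVolume g, p x) ↔ ∀ c : M,
      ∀ᵐ y ∂(volume : Measure 𝔼).restrict (chartAt 𝔼 c).target, p ((chartAt 𝔼 c).symm y) := by
  constructor
  · intro h c
    rw [← ae_chartVolume_iff g (mem_maximalAtlas_chartAt c), ← riemannianVolume_restrict_source]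
    exact ae_restrict_of_ae h
  · intro h
    rcases isEmpty_or_nonempty M with hM | hM
    · exact ae_of_all _ fun x => (hM.false x).elim
    obtain ⟨a, ha⟩ := exists_seq_chart_cover n M
    rw [← Measure.restrict_univ (μ := riemannianVolume g), ← ha, ae_restrict_iUnion_iff]
    intro k
    rw [riemannianVolume_restrict_source, ae_chartVolume_iff g (mem_maximalAtlas_chartAt _)]
    exact h _

instance [SecondCountableTopology M] (g : Metric n M) :
    IsLocallyFiniteMeasure (riemannianVolume g) := by
  refine ⟨fun x => ?_⟩
  set e := chartAt 𝔼 x with he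
  have hex : e x ∈ e.target := mem_chart_target 𝔼 x
  have hc : ContinuousAt (volumeDensity g e) (e x) :=
    ((contDiffOn_volumeDensity g (mem_maximalAtlas_chartAt x)).continuousOn).continuousAt
      (e.open_target.mem_nhds hex)
  have h1 : ∀ᶠ y in 𝓝 (e x), volumeDensity g e y < volumeDensity g e (e x) + 1 :=
    hc.eventually (gt_mem_nhds (lt_add_one _))
  obtain ⟨U, hU, hUo, hxU⟩ := eventually_nhds_iff.1
    (h1.and (Metric.ball_mem_nhds (e x) one_pos))
  have hUm : e.source ∩ e ⁻¹' U ∈ 𝓝 x :=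
    (e.continuousOn.isOpen_inter_preimage e.open_source hUo).mem_nhds
      ⟨mem_chart_source 𝔼 x, hxU⟩
  refine ⟨_, hUm, ?_⟩
  have hms : MeasurableSet (e.source ∩ e ⁻¹' U) :=
    (e.continuousOn.isOpen_inter_preimage e.open_source hUo).measurableSet
  rw [riemannianVolume_apply_of_subset g hms inter_subset_left,
    chartVolume_apply g (mem_maximalAtlas_chartAt x) hms]
  have hsub : e.target ∩ e.symm ⁻¹' (e.source ∩ e ⁻¹' U) ⊆ U := by
    rintro y ⟨hy, hy2⟩
    simpa [e.right_inv hy] using hy2.2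
  calc ∫⁻ y in e.target ∩ e.symm ⁻¹' (e.source ∩ e ⁻¹' U), ENNReal.ofReal (volumeDensity g e y)
      ≤ ∫⁻ y in U, ENNReal.ofReal (volumeDensity g e y) := lintegral_mono_set hsub
    _ ≤ ∫⁻ _ in U, ENNReal.ofReal (volumeDensity g e (e x) + 1) :=
        setLIntegral_mono' hUo.measurableSet fun y hy => ENNReal.ofReal_le_ofReal (hU y hy).1.le
    _ = ENNReal.ofReal (volumeDensity g e (e x) + 1) * volume U := setLIntegral_const _ _
    _ ≤ ENNReal.ofReal (volumeDensity g e (e x) + 1) * volume (Metric.ball (e x) 1) := by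
        gcongr
        exact fun y hy => (hU y hy).2
    _ < ⊤ := ENNReal.mul_lt_top ENNReal.ofReal_lt_top measure_ball_lt_top

/-- Needed twice: to upgrade a.e. equality of continuous functions to equality, and to see that the
energy is positive if u is positive somewhere. -/
instance [SecondCountableTopology M] (g : Metric n M) :
    (riemannianVolume g).IsOpenPosMeasure := by
  refine ⟨fun U hU ⟨x, hx⟩ h0 => ?_⟩
  have h1 : ∀ᵐ z ∂riemannianVolume g, z ∉ U := measure_eq_zero_iff_ae_notMem.1 h0
  have h2 := (ae_riemannianVolume_iff g _).1 h1 x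
  set e := chartAt 𝔼 x
  rw [ae_restrict_iff' e.open_target.measurableSet] at h2
  have h3 : IsOpen (e.target ∩ e.symm ⁻¹' U) :=
    e.continuousOn_symm.isOpen_inter_preimage e.open_target hU
  refine (h3.measure_pos volume ⟨e x, mem_chart_target 𝔼 x, ?_⟩).ne' ?_
  · simpa [e] using hx
  · refine measure_mono_null (fun y hy => ?_) (ae_iff.1 h2)
    simpa using hy

theorem integral_riemannianVolume_of_support [SecondCountableTopology M] (g : Metric n M) {c : M}
    {f : M → ℝ} (hf : Function.support f ⊆ (chartAt 𝔼 c).source) :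
    ∫ x, f x ∂riemannianVolume g = ∫ y in (chartAt 𝔼 c).target,
      volumeDensity g (chartAt 𝔼 c) y * f ((chartAt 𝔼 c).symm y) := by
  rw [← integral_chartVolume g (mem_maximalAtlas_chartAt c), ← riemannianVolume_restrict_source,
    setIntegral_eq_integral_of_forall_compl_eq_zero]
  intro x hx
  by_contra h
  exact hx (hf h)

theorem integrable_riemannianVolume_of_support [SecondCountableTopology M] (g : Metric n M) {c : M}
    {f : M → ℝ} (hf : Function.support f ⊆ (chartAt 𝔼 c).source) :
    Integrable f (riemannianVolume g) ↔ IntegrableOn (fun y =>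
      volumeDensity g (chartAt 𝔼 c) y * f ((chartAt 𝔼 c).symm y)) (chartAt 𝔼 c).target := by
  rw [← integrable_chartVolume_iff g (mem_maximalAtlas_chartAt c),
    ← riemannianVolume_restrict_source]
  exact (integrableOn_iff_integrable_of_support_subset hf).symm

end MaxPrinciple
end

/-! ### Lipschitz functions on a finite dimensional space -/

noncomputable section

namespace MaxPrinciple

section LocallyLipschitz

open scoped NNReal

variable {E : Type*} [NormedAddCommGroup E] [NormedSpace ℝ E] {s : Set E} {f h : E → ℝ}

theorem _root_.LocallyLipschitzOn.locallyLipschitz_comp {α β γ : Type*} [PseudoEMetricSpace α]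
    [PseudoEMetricSpace β] [PseudoEMetricSpace γ] {s : Set α} {f : α → β} {φ : β → γ}
    (hφ : LocallyLipschitz φ) (hf : LocallyLipschitzOn s f) :
    LocallyLipschitzOn s (fun x => φ (f x)) := by
  rw [locallyLipschitzOn_iff_restrict] at hf ⊢
  exact hφ.comp hf

theorem _root_.LocallyLipschitzOn.fun_mul_real {α : Type*} [PseudoEMetricSpace α] {s : Set α}
    {f h : α → ℝ} (hf : LocallyLipschitzOn s f) (hh : LocallyLipschitzOn s h) :
    LocallyLipschitzOn s (fun x => f x * h x) := by
  rw [locallyLipschitzOn_iff_restrict] at hf hh ⊢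
  have h1 : ContDiff ℝ 1 (fun p : ℝ × ℝ => p.1 * p.2) := contDiff_fst.mul contDiff_snd
  exact h1.locallyLipschitz.comp (hf.prodMk hh)

theorem _root_.ContDiffOn.locallyLipschitzOn_of_isOpen {F : Type*} [NormedAddCommGroup F]
    [NormedSpace ℝ F] {f : E → F} (hf : ContDiffOn ℝ 1 f s)
    (hs : IsOpen s) : LocallyLipschitzOn s f := by
  intro x hx
  obtain ⟨K, t, ht, hK⟩ := (hf.contDiffAt (hs.mem_nhds hx)).exists_lipschitzOnWith
  exact ⟨K, t, mem_nhdsWithin_of_mem_nhds ht, hK⟩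

/-- Extension by zero: a point outside `s` has the neighbourhood `Kᶜ`, on which the extension
vanishes. -/
theorem locallyLipschitz_indicator (hs : IsOpen s) (hf : LocallyLipschitzOn s f) {K : Set E}
    (hK : IsClosed K) (hKs : K ⊆ s) (h0 : ∀ x ∈ s, x ∉ K → f x = 0) :
    LocallyLipschitz (s.indicator f) := by
  intro x
  by_cases hx : x ∈ s
  · obtain ⟨C, t, ht, hC⟩ := hf hx
    rw [hs.nhdsWithin_eq hx] at ht
    refine ⟨C, t ∩ s, inter_mem ht (hs.mem_nhds hx), fun a ha b hb => ?_⟩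
    rw [indicator_of_mem ha.2, indicator_of_mem hb.2]
    exact hC ha.1 hb.1
  · refine ⟨0, Kᶜ, hK.isOpen_compl.mem_nhds fun h => hx (hKs h), fun a ha b hb => ?_⟩
    have h1 : ∀ c ∈ Kᶜ, s.indicator f c = 0 := by
      intro c hc
      by_cases hcs : c ∈ s
      · rw [indicator_of_mem hcs, h0 c hcs hc]
      · exact indicator_of_notMem hcs _
    rw [h1 a ha, h1 b hb, edist_self]
    exact zero_le

/-- Pairs in the compact 1-thickening of the support share one Lipschitz constant. A support point
and a point outside the thickening are more than 1 apart, so there the sup bound serves as Lipschitz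
constant. -/
theorem _root_.LocallyLipschitz.exists_lipschitzWith_of_hasCompactSupport [ProperSpace E]
    (hf : LocallyLipschitz f) (hc : HasCompactSupport f) : ∃ C : ℝ≥0, LipschitzWith C f := by
  obtain ⟨C, hC⟩ := (hf.locallyLipschitzOn (s := Metric.cthickening 1 (tsupport f))).exists_lipschitzOnWith_of_compact
    (IsCompact.cthickening hc)
  obtain ⟨B, hB⟩ := hf.continuous.bounded_above_of_compact_support hc
  have hB0 : 0 ≤ B := (norm_nonneg _).trans (hB 0)
  refine ⟨max C ⟨B, hB0⟩, LipschitzWith.of_dist_le_mul fun x y => ?_⟩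
  have key : ∀ x y : E, x ∈ tsupport f →
      dist (f x) (f y) ≤ (max C ⟨B, hB0⟩ : ℝ≥0) * dist x y := by
    intro x y hx
    by_cases hy : y ∈ Metric.cthickening 1 (tsupport f)
    · refine (hC.dist_le_mul x (Metric.self_subset_cthickening _ hx) y hy).trans ?_
      gcongr
      exact le_max_left _ _
    · have h1 : 1 < dist x y := by
        by_contra h
        refine hy (Metric.mem_cthickening_of_dist_le y x 1 _ hx ?_)
        rw [dist_comm]
        exact not_lt.1 h
      have h2 : f y = 0 := image_eq_zero_of_notMem_tsupport
        fun h => hy (Metric.self_subset_cthickening _ h)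
      calc dist (f x) (f y) = ‖f x‖ := by rw [h2, dist_zero_right]
        _ ≤ B := hB x
        _ ≤ B * dist x y := le_mul_of_one_le_right hB0 h1.le
        _ ≤ (max C ⟨B, hB0⟩ : ℝ≥0) * dist x y := by
          gcongr
          exact NNReal.coe_le_coe.2 (le_max_right C ⟨B, hB0⟩)
  by_cases hx : x ∈ tsupport f
  · exact key x y hx
  by_cases hy : y ∈ tsupport f
  · rw [dist_comm, dist_comm x]
    exact key y x hy
  · rw [image_eq_zero_of_notMem_tsupport hx, image_eq_zero_of_notMem_tsupport hy, dist_self]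
    positivity

variable [FiniteDimensional ℝ E] [MeasurableSpace E] [BorelSpace E] (μ : Measure E)
  [μ.IsAddHaarMeasure]

/-- Integration by parts against the constant 1; Rademacher's theorem identifies the line derivative
with the differential almost everywhere. -/
theorem integral_fderiv_eq_zero_of_lipschitz {C : ℝ≥0} (hf : LipschitzWith C f)
    (hc : HasCompactSupport f) (v : E) :
    Integrable (fun x => fderiv ℝ f x v) μ ∧ ∫ x, fderiv ℝ f x v ∂μ = 0 := by
  constructor
  · have hsupp : Function.support (fun x => fderiv ℝ f x v) ⊆ tsupport f := by
      intro x hx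
      by_contra h
      refine hx ?_
      have := (notMem_tsupport_iff_eventuallyEq.1 h).fderiv_eq (𝕜 := ℝ)
      simp [this]
    rw [← integrableOn_iff_integrable_of_support_subset hsupp]
    refine Measure.integrableOn_of_bounded (M := C * ‖v‖) hc.measure_lt_top.ne
      (measurable_fderiv_apply_const ℝ f v).aestronglyMeasurable (ae_of_all _ fun x => ?_)
    exact (ContinuousLinearMap.le_opNorm _ _).trans
      (mul_le_mul_of_nonneg_right (norm_fderiv_le_of_lipschitz ℝ hf) (norm_nonneg _))
  · have h1 := LipschitzWith.integral_lineDeriv_mul_eq (μ := μ)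
      (LipschitzWith.const (1 : ℝ) : LipschitzWith 0 _) hf hc (-v)
    have h2 : ∀ x w, lineDeriv ℝ (fun _ : E => (1 : ℝ)) x w = 0 := by simp [lineDeriv]
    simp only [h2, zero_mul, integral_zero, neg_neg, mul_one] at h1
    rw [h1]
    refine integral_congr_ae ?_
    filter_upwards [hf.ae_differentiableAt (μ := μ)] with x hx
    exact hx.lineDeriv_eq_fderiv.symm

/-- Rademacher's theorem applies near each point of `s`, and a locally null set is null. -/
theorem _root_.LocallyLipschitzOn.ae_differentiableAt (hs : IsOpen s)
    (hf : LocallyLipschitzOn s f) : ∀ᵐ x ∂μ.restrict s, DifferentiableAt ℝ f x := by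
  rw [ae_restrict_iff' hs.measurableSet]
  refine measure_null_of_locally_null _ fun x hx => ?_
  have hxs : x ∈ s := by
    by_contra h
    exact hx fun h' => (h h').elim
  obtain ⟨C, t, ht, hC⟩ := hf hxs
  rw [hs.nhdsWithin_eq hxs] at ht
  obtain ⟨t', ht't, ht'o, hxt'⟩ := mem_nhds_iff.1 ht
  refine ⟨{y | y ∈ t' ∧ ¬ DifferentiableAt ℝ f y}, ?_, ?_⟩
  · filter_upwards [mem_nhdsWithin_of_mem_nhds (ht'o.mem_nhds hxt'), self_mem_nhdsWithin]
      with y hy hy2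
    exact ⟨hy, fun h => hy2 fun _ => h⟩
  · have h1 := (hC.mono ht't).ae_differentiableWithinAt_of_mem (μ := μ)
    refine measure_mono_null ?_ (ae_iff.1 h1)
    rintro y ⟨hy, hy2⟩ h
    exact hy2 ((h hy).differentiableAt (ht'o.mem_nhds hy))

end LocallyLipschitz

end MaxPrinciple
end

/-! ### Green's formula and chart independence of the Laplacian -/

noncomputable section

namespace MaxPrinciple

variable {n : ℕ} {M : Type*} [TopologicalSpace M] [ChartedSpace (EuclideanSpace ℝ (Fin n)) M]
  [IsManifold (𝓡 n) ∞ M]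

attribute [local instance 10000] chartedSpaceSelf

local notation "𝔼" => EuclideanSpace ℝ (Fin n)

variable (n) in
/-- `f` is locally Lipschitz in the preferred charts. -/
def IsChartLipschitz (f : M → ℝ) : Prop :=
  ∀ c : M, LocallyLipschitzOn (chartAt 𝔼 c).target (fun y => f ((chartAt 𝔼 c).symm y))

variable (n) in
/-- `f` is `C^2` in the preferred charts. -/
def IsChartC2 (f : M → ℝ) : Prop :=
  ∀ c : M, ContDiffOn ℝ 2 (fun y => f ((chartAt 𝔼 c).symm y)) (chartAt 𝔼 c).target

theorem IsChartLipschitz.mul {f h : M → ℝ} (hf : IsChartLipschitz n f) (hh : IsChartLipschitz n h) :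
    IsChartLipschitz n (fun x => f x * h x) :=
  fun c => (hf c).fun_mul_real (hh c)

theorem IsChartLipschitz.comp {f : M → ℝ} (hf : IsChartLipschitz n f) {φ : ℝ → ℝ}
    (hφ : LocallyLipschitz φ) : IsChartLipschitz n (fun x => φ (f x)) :=
  fun c => (hf c).locallyLipschitz_comp hφ

theorem IsChartC2.isChartLipschitz {f : M → ℝ} (hf : IsChartC2 n f) : IsChartLipschitz n f :=
  fun c => ((hf c).of_le (by norm_num)).locallyLipschitzOn_of_isOpen (chartAt 𝔼 c).open_target

theorem isChartC2_of_contMDiff {f : M → ℝ} (hf : ContMDiff (𝓡 n) 𝓘(ℝ, ℝ) ∞ f) :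
    IsChartC2 n f := by
  intro c
  have h := hf.comp_contMDiffOn (contMDiffOn_symm_of_mem_maximalAtlas (I := 𝓡 n) (n := ∞)
    (mem_maximalAtlas_chartAt c))
  exact (contMDiffOn_iff_contDiffOn.1 h).of_le ENat.LEInfty.out

theorem IsChartC2.mdifferentiableAt {f : M → ℝ} (hf : IsChartC2 n f) (x : M) :
    MDifferentiableAt (𝓡 n) 𝓘(ℝ, ℝ) f x := by
  have hx := mem_chart_target 𝔼 x
  have h := (mdifferentiableAt_iff_comp_symm (mem_maximalAtlas_chartAt x) hx).2
    (((hf x).differentiableOn (by norm_num)).differentiableAt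
      ((chartAt 𝔼 x).open_target.mem_nhds hx))
  rwa [(chartAt 𝔼 x).left_inv (mem_chart_source 𝔼 x)] at h

theorem IsChartLipschitz.continuous {f : M → ℝ} (hf : IsChartLipschitz n f) : Continuous f := by
  refine continuous_iff_continuousAt.2 fun x => ?_
  have h1 : ContinuousAt (fun y => f ((chartAt 𝔼 x).symm y)) (chartAt 𝔼 x x) :=
    (hf x).continuousOn.continuousAt
      ((chartAt 𝔼 x).open_target.mem_nhds (mem_chart_target 𝔼 x))
  have h2 := ContinuousAt.comp (f := chartAt 𝔼 x) h1
    ((chartAt 𝔼 x).continuousAt (mem_chart_source 𝔼 x))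
  refine h2.congr ?_
  filter_upwards [(chartAt 𝔼 x).open_source.mem_nhds (mem_chart_source 𝔼 x)] with z hz
  simp [(chartAt 𝔼 x).left_inv hz]

theorem hasMFDerivAt_finset_sum {ι : Type*} (S : Finset ι) (F : ι → M → ℝ) {x : M}
    (L : ι → 𝔼 →L[ℝ] ℝ) (h : ∀ i ∈ S, HasMFDerivAt (𝓡 n) 𝓘(ℝ, ℝ) (F i) x (L i)) :
    HasMFDerivAt (𝓡 n) 𝓘(ℝ, ℝ) (fun z => ∑ i ∈ S, F i z) x (∑ i ∈ S, L i : 𝔼 →L[ℝ] ℝ) := by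
  classical
  induction S using Finset.induction_on with
  | empty => exact hasMFDerivAt_const (0 : ℝ) x
  | insert a S ha ih =>
    have h1 := (h a (Finset.mem_insert_self a S)).add
      (ih fun i hi => h i (Finset.mem_insert_of_mem hi))
    have h2 : (∑ i ∈ insert a S, L i : 𝔼 →L[ℝ] ℝ) = L a + ∑ i ∈ S, L i := Finset.sum_insert ha
    have h3 : (fun z => ∑ i ∈ insert a S, F i z) = F a + fun z => ∑ i ∈ S, F i z := by
      ext z
      exact Finset.sum_insert ha
    exact (h1.congr_of_eventuallyEq (Eventually.of_forall fun z => congrFun h3 z)).congr_mfderiv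
      h2.symm

variable [MeasurableSpace M] [BorelSpace M]

theorem IsChartLipschitz.ae_mdifferentiableAt [SecondCountableTopology M] {f : M → ℝ}
    (hf : IsChartLipschitz n f) (g : Metric n M) :
    ∀ᵐ x ∂riemannianVolume g, MDifferentiableAt (𝓡 n) 𝓘(ℝ, ℝ) f x := by
  rw [ae_riemannianVolume_iff]
  intro c
  have h := (hf c).ae_differentiableAt volume (chartAt 𝔼 c).open_target
  filter_upwards [h, ae_restrict_mem (chartAt 𝔼 c).open_target.measurableSet] with y hy hyt
  exact (mdifferentiableAt_iff_comp_symm (mem_maximalAtlas_chartAt c) hyt).2 hy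

/-- The flux `√(det g) g^{ij} ∂_j f` in a chart. -/
def chartFlux (g : Metric n M) (e : OpenPartialHomeomorph M 𝔼) (f : M → ℝ) (i : Fin n) (z : 𝔼) : ℝ :=
  ∑ j : Fin n, volumeDensity g e z * (metricMatrix g e z)⁻¹ i j *
    fderiv ℝ (fun z' => f (e.symm z')) z (EuclideanSpace.single j (1 : ℝ))

theorem contDiffOn_chartFlux (g : Metric n M) {e : OpenPartialHomeomorph M 𝔼}
    (he : e ∈ IsManifold.maximalAtlas (𝓡 n) ∞ M) {f : M → ℝ}
    (hf : ContDiffOn ℝ 2 (fun y => f (e.symm y)) e.target) (i : Fin n) :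
    ContDiffOn ℝ 1 (chartFlux g e f i) e.target := by
  refine ContDiffOn.sum fun j _ => ?_
  have h1 : ContDiffOn ℝ 1 (fderiv ℝ (fun y => f (e.symm y))) e.target :=
    hf.fderiv_of_isOpen e.open_target (by norm_num)
  exact (((contDiffOn_volumeDensity g he).of_le (by exact_mod_cast le_top)).mul
    ((contDiffOn_metricMatrix_inv g he i j).of_le (by exact_mod_cast le_top))).mul
    (h1.clm_apply contDiffOn_const)

theorem continuousOn_laplacianInChart (g : Metric n M) {e : OpenPartialHomeomorph M 𝔼}
    (he : e ∈ IsManifold.maximalAtlas (𝓡 n) ∞ M) {f : M → ℝ}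
    (hf : ContDiffOn ℝ 2 (fun y => f (e.symm y)) e.target) :
    ContinuousOn (laplacianInChart g e f) e.target := by
  refine ((contDiffOn_volumeDensity g he).continuousOn.inv₀
    fun y hy => (volumeDensity_pos g he hy).ne').mul (continuousOn_finsetSum _ fun i _ => ?_)
  exact ((contDiffOn_chartFlux g he hf i).continuousOn_fderiv_of_isOpen e.open_target
    le_rfl).clm_apply continuousOn_const

/-- Let Z be ψ times the flux of f. Almost everywhere the integrand is the coordinate divergence of
Z, and Z extended by zero is Lipschitz with compact support, so each ∂ᵢZᵢ integrates to zero. -/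
theorem green_in_chart [T2Space M] (g : Metric n M) {e : OpenPartialHomeomorph M 𝔼}
    (he : e ∈ IsManifold.maximalAtlas (𝓡 n) ∞ M) {f ψ : M → ℝ}
    (hf : ContDiffOn ℝ 2 (fun y => f (e.symm y)) e.target)
    (hψ : LocallyLipschitzOn e.target (fun y => ψ (e.symm y))) (hc : HasCompactSupport ψ)
    (hsupp : tsupport ψ ⊆ e.source) :
    IntegrableOn (fun y => volumeDensity g e y * (ψ (e.symm y) * laplacianInChart g e f y +
        gradPairing g ψ f (e.symm y))) e.target ∧
      ∫ y in e.target, volumeDensity g e y * (ψ (e.symm y) * laplacianInChart g e f y +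
        gradPairing g ψ f (e.symm y)) = 0 := by
  set W := chartFlux g e f with hW
  have hWd := contDiffOn_chartFlux g he hf
  set K := e '' tsupport ψ with hK
  have hKc : IsCompact K := hc.isCompact.image_of_continuousOn (e.continuousOn.mono hsupp)
  have hKt : K ⊆ e.target := by
    rintro _ ⟨x, hx, rfl⟩
    exact e.map_source (hsupp hx)
  have hK0 : ∀ y ∈ e.target, y ∉ K → ψ (e.symm y) = 0 := by
    intro y hy hyK
    refine image_eq_zero_of_notMem_tsupport fun h => hyK ⟨_, h, e.right_inv hy⟩
  set Z : Fin n → 𝔼 → ℝ := fun i => e.target.indicator fun y => ψ (e.symm y) * W i y with hZ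
  have hZ0 : ∀ i, ∀ y ∉ K, Z i y = 0 := by
    intro i y hy
    by_cases hyt : y ∈ e.target
    · simp [hZ, indicator_of_mem hyt, hK0 y hyt hy]
    · exact indicator_of_notMem hyt _
  have hZl : ∀ i, LocallyLipschitz (Z i) := fun i =>
    locallyLipschitz_indicator e.open_target
      (hψ.fun_mul_real ((hWd i).locallyLipschitzOn_of_isOpen e.open_target)) hKc.isClosed hKt
      fun y hy hyK => by rw [hK0 y hy hyK, zero_mul]
  have hZc : ∀ i, HasCompactSupport (Z i) := fun i => HasCompactSupport.intro hKc (hZ0 i)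
  have hint : ∀ i, Integrable (fun y => fderiv ℝ (Z i) y (EuclideanSpace.single i 1)) ∧
      ∫ y, fderiv ℝ (Z i) y (EuclideanSpace.single i 1) = 0 := by
    intro i
    obtain ⟨C, hC⟩ := (hZl i).exists_lipschitzWith_of_hasCompactSupport (hZc i)
    exact integral_fderiv_eq_zero_of_lipschitz volume hC (hZc i) _
  have hsum0 : ∀ y ∉ e.target, ∑ i, fderiv ℝ (Z i) y (EuclideanSpace.single i 1) = 0 := by
    intro y hy
    refine Finset.sum_eq_zero fun i _ => ?_
    have : Z i =ᶠ[𝓝 y] fun _ => 0 := by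
      filter_upwards [hKc.isClosed.isOpen_compl.mem_nhds fun h => hy (hKt h)] with z hz
      exact hZ0 i z hz
    simp [this.fderiv_eq]
  have hae : (fun y => volumeDensity g e y * (ψ (e.symm y) * laplacianInChart g e f y +
        gradPairing g ψ f (e.symm y)))
      =ᵐ[volume.restrict e.target]
      fun y => ∑ i, fderiv ℝ (Z i) y (EuclideanSpace.single i 1) := by
    filter_upwards [hψ.ae_differentiableAt volume e.open_target,
      ae_restrict_mem e.open_target.measurableSet] with y hy hyt
    have hρ := (volumeDensity_pos g he hyt).ne'
    have hψm := (mdifferentiableAt_iff_comp_symm he hyt).2 hy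
    have hfm := (mdifferentiableAt_iff_comp_symm he hyt).2
      ((hf.differentiableOn (by norm_num)).differentiableAt (e.open_target.mem_nhds hyt))
    have h1 : ∀ i, fderiv ℝ (Z i) y (EuclideanSpace.single i 1) =
        ψ (e.symm y) * fderiv ℝ (W i) y (EuclideanSpace.single i 1) +
        W i y * fderiv ℝ (fun z => ψ (e.symm z)) y (EuclideanSpace.single i 1) := by
      intro i
      have hev : Z i =ᶠ[𝓝 y] fun y => ψ (e.symm y) * W i y := by
        filter_upwards [e.open_target.mem_nhds hyt] with z hz
        exact indicator_of_mem hz _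
      have hWy : DifferentiableAt ℝ (W i) y :=
        ((hWd i).differentiableOn (by norm_num)).differentiableAt (e.open_target.mem_nhds hyt)
      rw [hev.fderiv_eq, fderiv_fun_mul hy hWy]
      simp
    simp only [h1, Finset.sum_add_distrib]
    rw [gradPairing_eq_sum g he hyt hfm hψm, mul_add]
    congr 1
    · rw [laplacianInChart, ← Finset.mul_sum]
      rw [mul_left_comm, mul_inv_cancel_left₀ hρ]
      rfl
    · rw [Finset.mul_sum]
      refine Finset.sum_congr rfl fun i _ => ?_
      rw [hW, chartFlux, Finset.mul_sum, Finset.sum_mul]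
      refine Finset.sum_congr rfl fun j _ => ?_
      ring
  constructor
  · refine Integrable.congr ?_ hae.symm
    exact (integrable_finsetSum _ fun i _ => (hint i).1).integrableOn
  · rw [integral_congr_ae hae, setIntegral_eq_integral_of_forall_compl_eq_zero hsum0,
      integral_finsetSum _ fun i _ => (hint i).1]
    exact Finset.sum_eq_zero fun i _ => (hint i).2

variable [T2Space M] [SecondCountableTopology M]

/-- Green's formula for test functions supported in a chart, with the Laplacian of that chart. -/
theorem green_of_tsupport_subset (g : Metric n M) {c : M} {f ψ : M → ℝ} (hf : IsChartC2 n f)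
    (hψ : IsChartLipschitz n ψ) (hc : HasCompactSupport ψ)
    (hsupp : tsupport ψ ⊆ (chartAt 𝔼 c).source) :
    Integrable (fun x => ψ x * laplacianInChart g (chartAt 𝔼 c) f (chartAt 𝔼 c x) +
        gradPairing g ψ f x) (riemannianVolume g) ∧
      ∫ x, (ψ x * laplacianInChart g (chartAt 𝔼 c) f (chartAt 𝔼 c x) +
        gradPairing g ψ f x) ∂riemannianVolume g = 0 := by
  set e := chartAt 𝔼 c with he
  have hs : Function.support (fun x => ψ x * laplacianInChart g e f (e x) + gradPairing g ψ f x) ⊆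
      e.source := by
    refine Subset.trans (fun x hx => ?_) hsupp
    by_contra h
    refine hx ?_
    have h1 : mfderiv (𝓡 n) 𝓘(ℝ, ℝ) ψ x = 0 := by
      rw [(notMem_tsupport_iff_eventuallyEq.1 h).mfderiv_eq]
      exact mfderiv_const
    simp only [image_eq_zero_of_notMem_tsupport h, zero_mul, gradPairing, h1]
    exact add_zero (0 : ℝ)
  obtain ⟨h1, h2⟩ := green_in_chart g (mem_maximalAtlas_chartAt c) (hf c) (hψ c) hc hsupp
  rw [integrable_riemannianVolume_of_support g hs, integral_riemannianVolume_of_support g hs,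
    ← he]
  have hcongr : ∀ y ∈ e.target, volumeDensity g e y * (ψ (e.symm y) *
      laplacianInChart g e f (e (e.symm y)) + gradPairing g ψ f (e.symm y)) =
      volumeDensity g e y * (ψ (e.symm y) *
      laplacianInChart g e f y + gradPairing g ψ f (e.symm y)) := by
    intro y hy
    rw [e.right_inv hy]
  rw [integrableOn_congr_fun hcongr e.open_target.measurableSet,
    setIntegral_congr_fun e.open_target.measurableSet hcongr]
  exact ⟨h1, h2⟩

/-- The weak form avoids computing with transition maps. Green's formula gives both chart
expressions the same integral -∫ dψ(∇f) against every smooth ψ supported in the overlap, and this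
does not involve a chart. Hence they agree a.e. there, and everywhere by continuity. -/
theorem laplacianInChart_eq (g : Metric n M) {f : M → ℝ} (hf : IsChartC2 n f) {c c' x : M}
    (hx : x ∈ (chartAt 𝔼 c).source) (hx' : x ∈ (chartAt 𝔼 c').source) :
    laplacianInChart g (chartAt 𝔼 c) f (chartAt 𝔼 c x) =
      laplacianInChart g (chartAt 𝔼 c') f (chartAt 𝔼 c' x) := by
  have : LocallyCompactSpace M := ChartedSpace.locallyCompactSpace 𝔼 M
  have hcont : ∀ b : M, ContinuousOn
      (fun x => laplacianInChart g (chartAt 𝔼 b) f (chartAt 𝔼 b x)) (chartAt 𝔼 b).source :=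
    fun b => (continuousOn_laplacianInChart g (mem_maximalAtlas_chartAt b) (hf b)).comp
      (chartAt 𝔼 b).continuousOn fun _ h => (chartAt 𝔼 b).map_source h
  set U := (chartAt 𝔼 c).source ∩ (chartAt 𝔼 c').source with hU
  have hUo : IsOpen U := (chartAt 𝔼 c).open_source.inter (chartAt 𝔼 c').open_source
  have h1 := (hcont c).mono (inter_subset_left : U ⊆ _)
  have h2 := (hcont c').mono (inter_subset_right : U ⊆ _)
  refine Measure.eqOn_open_of_ae_eq (μ := riemannianVolume g) ?_ hUo h1 h2 ⟨hx, hx'⟩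
  rw [EventuallyEq, ae_restrict_iff' hUo.measurableSet]
  have key := IsOpen.ae_eq_zero_of_integral_contMDiff_smul_eq_zero (𝓡 n) hUo
    (f := fun x => laplacianInChart g (chartAt 𝔼 c) f (chartAt 𝔼 c x) -
      laplacianInChart g (chartAt 𝔼 c') f (chartAt 𝔼 c' x)) (μ := riemannianVolume g)
    ((h1.sub h2).locallyIntegrableOn hUo.measurableSet) ?_
  · filter_upwards [key] with z hz hzU
    exact sub_eq_zero.1 (hz hzU)
  · intro ψ hψ hψc hψU
    have hψl := (isChartC2_of_contMDiff hψ).isChartLipschitz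
    obtain ⟨i1, e1⟩ := green_of_tsupport_subset g hf hψl hψc (hψU.trans inter_subset_left)
    obtain ⟨i2, e2⟩ := green_of_tsupport_subset g hf hψl hψc (hψU.trans inter_subset_right)
    have h3 := integral_sub i1 i2
    rw [e1, e2, sub_zero] at h3
    rw [← h3]
    refine integral_congr_ae (ae_of_all _ fun z => ?_)
    simp only [smul_eq_mul]
    ring

theorem laplacian_eq_laplacianInChart (g : Metric n M) {f : M → ℝ} (hf : IsChartC2 n f) {c x : M}
    (hx : x ∈ (chartAt 𝔼 c).source) :
    laplacian g f x = laplacianInChart g (chartAt 𝔼 c) f (chartAt 𝔼 c x) :=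
  laplacianInChart_eq g hf (mem_chart_source 𝔼 x) hx

/-- Green's formula with a compactly supported locally Lipschitz test function. -/
theorem green (g : Metric n M) {f ψ : M → ℝ} (hf : IsChartC2 n f)
    (hψ : IsChartLipschitz n ψ) (hc : HasCompactSupport ψ) :
    Integrable (fun x => ψ x * laplacian g f x + gradPairing g ψ f x) (riemannianVolume g) ∧
      ∫ x, (ψ x * laplacian g f x + gradPairing g ψ f x) ∂riemannianVolume g = 0 := by
  have : LocallyCompactSpace M := ChartedSpace.locallyCompactSpace 𝔼 M
  obtain ⟨P, hP⟩ := SmoothPartitionOfUnity.exists_isSubordinate (𝓡 n) (isClosed_tsupport ψ)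
    (fun c : M => (chartAt 𝔼 c).source) (fun c => (chartAt 𝔼 c).open_source)
    fun x _ => mem_iUnion.2 ⟨x, mem_chart_source 𝔼 x⟩
  -- Finitely many members of the partition meet the compact support, so ψ is a finite sum of pieces
  -- each supported in a chart.
  have hfin := P.locallyFinite.finite_nonempty_inter_compact hc.isCompact
  set S := hfin.toFinset with hS
  have hsum : ∀ x, ∑ c ∈ S, P c x * ψ x = ψ x := by
    intro x
    by_cases hx : x ∈ tsupport ψ
    · have h1 : ∑ c ∈ S, P c x = 1 := by
        rw [← P.sum_eq_one hx]
        refine (finsum_eq_sum_of_support_subset _ fun c hcx => ?_).symm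
        simp only [hS, Finite.coe_toFinset, mem_ofPred_eq]
        exact ⟨x, hcx, hx⟩
      rw [← Finset.sum_mul, h1, one_mul]
    · simp [image_eq_zero_of_notMem_tsupport hx]
  have hPl : ∀ c, IsChartLipschitz n (P c) :=
    fun c => (isChartC2_of_contMDiff (P c).contMDiff).isChartLipschitz
  have hterm : ∀ c, Integrable (fun x => (P c x * ψ x) * laplacian g f x +
        gradPairing g (fun x => P c x * ψ x) f x) (riemannianVolume g) ∧
      ∫ x, ((P c x * ψ x) * laplacian g f x +
        gradPairing g (fun x => P c x * ψ x) f x) ∂riemannianVolume g = 0 := by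
    intro c
    have hsupp : tsupport (fun x => P c x * ψ x) ⊆ (chartAt 𝔼 c).source :=
      (tsupport_mul_subset_left (f := P c) (g := ψ)).trans (hP c)
    have h1 := green_of_tsupport_subset g hf ((hPl c).mul hψ) (hc.mul_left (f := P c)) hsupp
    have h2 : (fun x => (P c x * ψ x) * laplacian g f x +
        gradPairing g (fun x => P c x * ψ x) f x) =
        fun x => (P c x * ψ x) * laplacianInChart g (chartAt 𝔼 c) f (chartAt 𝔼 c x) +
        gradPairing g (fun x => P c x * ψ x) f x := by
      ext x
      by_cases hx : x ∈ (chartAt 𝔼 c).source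
      · rw [laplacian_eq_laplacianInChart g hf hx]
      · have : P c x * ψ x = 0 :=
          image_eq_zero_of_notMem_tsupport (f := fun x => P c x * ψ x) fun h => hx (hsupp h)
        rw [this, zero_mul, zero_mul]
    rw [h2]
    exact h1
  -- The pairing is additive in the test function only where the pieces are differentiable, which
  -- Rademacher's theorem guarantees almost everywhere.
  have hae : (fun x => ψ x * laplacian g f x + gradPairing g ψ f x) =ᵐ[riemannianVolume g]
      fun x => ∑ c ∈ S, ((P c x * ψ x) * laplacian g f x +
        gradPairing g (fun x => P c x * ψ x) f x) := by
    filter_upwards [hψ.ae_mdifferentiableAt g] with x hx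
    rw [Finset.sum_add_distrib, ← Finset.sum_mul, hsum]
    congr 1
    have hd : ∀ c, MDifferentiableAt (𝓡 n) 𝓘(ℝ, ℝ) (fun x => P c x * ψ x) x :=
      fun c => ((P c).contMDiff.mdifferentiableAt (by simp)).mul hx
    have h1 := (hasMFDerivAt_finset_sum S (fun c x => P c x * ψ x) _
      fun c _ => (hd c).hasMFDerivAt).congr_of_eventuallyEq
      (Eventually.of_forall fun z => (hsum z).symm)
    rw [gradPairing, h1.mfderiv]
    exact sum_apply (F := 𝔼 →L[ℝ] ℝ) (α := 𝔼) (β := ℝ) S _ _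
  exact ⟨(integrable_finsetSum _ fun c _ => (hterm c).1).congr hae.symm, by
    rw [integral_congr_ae hae, integral_finsetSum _ fun c _ => (hterm c).1]
    exact Finset.sum_eq_zero fun c _ => (hterm c).2⟩

end MaxPrinciple
end

/-! ### Comparison of metrics and of their volumes -/

noncomputable section

namespace MaxPrinciple

/-- The function exp(-αr) q(r) decreases and exp(αr) q(r) increases. Continuity at 0 suffices to
include the left endpoint. -/
theorem exp_bound_of_deriv_bound {q : ℝ → ℝ} {T α : ℝ} (hc : ContinuousOn q (Ico 0 T))
    (hd : ∀ t ∈ Ioo 0 T, DifferentiableAt ℝ q t)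
    (hb : ∀ t ∈ Ioo 0 T, -α * q t ≤ deriv q t ∧ deriv q t ≤ α * q t) {s t : ℝ}
    (hs : 0 ≤ s) (hst : s ≤ t) (ht : t < T) :
    q t ≤ Real.exp (α * (t - s)) * q s ∧ q s ≤ Real.exp (α * (t - s)) * q t := by
  have hsub : Icc s t ⊆ Ico 0 T := fun r hr => ⟨hs.trans hr.1, hr.2.trans_lt ht⟩
  have hint : interior (Icc s t) ⊆ Ioo 0 T := by
    rw [interior_Icc]
    exact fun r hr => ⟨hs.trans_lt hr.1, hr.2.trans ht⟩
  have hder : ∀ β r, r ∈ interior (Icc s t) →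
      HasDerivAt (fun r => Real.exp (β * r) * q r)
        (Real.exp (β * r) * (β * q r + deriv q r)) r := by
    intro β r hr
    have h1 : HasDerivAt (fun r => Real.exp (β * r)) (Real.exp (β * r) * β) r := by
      simpa using ((hasDerivAt_id r).const_mul β).exp
    exact (h1.mul (hd r (hint hr)).hasDerivAt).congr_deriv (by ring)
  have hcont : ∀ β, ContinuousOn (fun r => Real.exp (β * r) * q r) (Icc s t) := fun β =>
    (by fun_prop : Continuous fun r => Real.exp (β * r)).continuousOn.mul (hc.mono hsub)
  have h1 : AntitoneOn (fun r => Real.exp (-α * r) * q r) (Icc s t) := by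
    refine antitoneOn_of_deriv_nonpos (convex_Icc s t) (hcont _)
      (fun r hr => (hder _ r hr).differentiableAt.differentiableWithinAt) fun r hr => ?_
    rw [(hder _ r hr).deriv]
    exact mul_nonpos_of_nonneg_of_nonpos (Real.exp_pos _).le
      (by linarith [(hb r (hint hr)).2])
  have h2 : MonotoneOn (fun r => Real.exp (α * r) * q r) (Icc s t) := by
    refine monotoneOn_of_deriv_nonneg (convex_Icc s t) (hcont _)
      (fun r hr => (hder _ r hr).differentiableAt.differentiableWithinAt) fun r hr => ?_
    rw [(hder _ r hr).deriv]
    exact mul_nonneg (Real.exp_pos _).le (by linarith [(hb r (hint hr)).1])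
  have e1 := h1 (left_mem_Icc.2 hst) (right_mem_Icc.2 hst) hst
  have e2 := h2 (left_mem_Icc.2 hst) (right_mem_Icc.2 hst) hst
  simp only at e1 e2
  constructor
  · have h3 := mul_le_mul_of_nonneg_left e1 (Real.exp_pos (α * t)).le
    rw [← mul_assoc, ← mul_assoc, ← Real.exp_add, ← Real.exp_add] at h3
    rwa [show α * t + -α * t = 0 by ring, Real.exp_zero, one_mul,
      show α * t + -α * s = α * (t - s) by ring] at h3
  · have h3 := mul_le_mul_of_nonneg_left e2 (Real.exp_pos (-α * s)).le
    rw [← mul_assoc, ← mul_assoc, ← Real.exp_add, ← Real.exp_add] at h3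
    rwa [show -α * s + α * s = 0 by ring, Real.exp_zero, one_mul,
      show -α * s + α * t = α * (t - s) by ring] at h3

open scoped MatrixOrder in
-- Reduce A to the identity: write A = CᵀC and N = C⁻ᵀ B C⁻¹. The hypothesis becomes N ≥ 1 as a
-- form, so the eigenvalues and the determinant of N are at least 1, while det B = (det C)² det N
-- and det A = (det C)².
theorem _root_.Matrix.PosDef.det_le_det {ι : Type*} [Fintype ι] [DecidableEq ι]
    {A B : Matrix ι ι ℝ} (hA : A.PosDef) (hB : B.IsHermitian)
    (hAB : ∀ v : ι → ℝ, dotProduct v (A.mulVec v) ≤ dotProduct v (B.mulVec v)) :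
    A.det ≤ B.det := by
  obtain ⟨C, hC⟩ := CStarAlgebra.nonneg_iff_eq_star_mul_self.1 hA.posSemidef.nonneg
  rw [Matrix.star_eq_conjTranspose, Matrix.conjTranspose_eq_transpose_of_trivial] at hC
  have hCd : A.det = C.det ^ 2 := by rw [hC, Matrix.det_mul, Matrix.det_transpose, sq]
  have hCu : IsUnit C.det := by
    refine isUnit_iff_ne_zero.2 fun h => hA.det_pos.ne' ?_
    rw [hCd, h, zero_pow two_ne_zero]
  set D := C⁻¹ with hD
  have hCD : C * D = 1 := Matrix.mul_nonsing_inv C hCu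
  set N := D.transpose * B * D with hN
  have hNh : N.IsHermitian := by
    have := Matrix.isHermitian_conjTranspose_mul_mul D hB
    rwa [Matrix.conjTranspose_eq_transpose_of_trivial] at this
  have hquad : ∀ v : ι → ℝ, dotProduct v v ≤ dotProduct v (N.mulVec v) := by
    intro v
    have h1 := hAB (D.mulVec v)
    have h2 : ∀ X : Matrix ι ι ℝ, dotProduct (D.mulVec v) (X.mulVec (D.mulVec v)) =
        dotProduct v ((D.transpose * X * D).mulVec v) := by
      intro X
      rw [← Matrix.mulVec_mulVec, ← Matrix.mulVec_mulVec, Matrix.dotProduct_mulVec v,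
        Matrix.vecMul_transpose]
    rw [h2, h2, hC] at h1
    have h3 : D.transpose * (C.transpose * C) * D = 1 := by
      rw [← Matrix.mul_assoc, Matrix.mul_assoc, hCD, Matrix.mul_one, ← Matrix.transpose_mul, hCD,
        Matrix.transpose_one]
    rwa [h3, Matrix.one_mulVec] at h1
  have hev : ∀ i, 1 ≤ hNh.eigenvalues i := by
    intro i
    have h1 := hquad (hNh.eigenvectorBasis i)
    have h2 : dotProduct (hNh.eigenvectorBasis i : ι → ℝ) (hNh.eigenvectorBasis i) = 1 := by
      have := hNh.eigenvectorBasis.orthonormal.1 i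
      have h3 := EuclideanSpace.real_norm_sq_eq (hNh.eigenvectorBasis i)
      rw [this, one_pow] at h3
      simpa only [dotProduct, ← sq] using h3.symm
    have h4 := hNh.mulVec_eigenvectorBasis i
    rw [h4, dotProduct_smul, h2] at h1
    simpa using h1
  have hNdet : 1 ≤ N.det := by
    rw [hNh.det_eq_prod_eigenvalues]
    exact_mod_cast Finset.one_le_prod fun i _ => hev i
  have hBd : B.det = C.det ^ 2 * N.det := by
    rw [hN, Matrix.det_mul, Matrix.det_mul, Matrix.det_transpose]
    have : C.det * D.det = 1 := by rw [← Matrix.det_mul, hCD, Matrix.det_one]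
    linear_combination (-(C.det * D.det) - 1) * B.det * this
  rw [hBd, hCd]
  exact le_mul_of_one_le_right (sq_nonneg _) hNdet

variable {n : ℕ} {M : Type*} [TopologicalSpace M] [ChartedSpace (EuclideanSpace ℝ (Fin n)) M]
  [IsManifold (𝓡 n) ∞ M]

attribute [local instance 10000] chartedSpaceSelf

local notation "𝔼" => EuclideanSpace ℝ (Fin n)

theorem dotProduct_metricMatrix (g : Metric n M) (e : OpenPartialHomeomorph M 𝔼) (y : 𝔼)
    (v : Fin n → ℝ) : dotProduct v ((metricMatrix g e y).mulVec v) =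
      chartInner g e y (WithLp.toLp 2 v) (WithLp.toLp 2 v) := by
  rw [chartInner_eq_sum]
  simp only [dotProduct, Matrix.mulVec, Finset.mul_sum]
  exact Finset.sum_congr rfl fun i _ => Finset.sum_congr rfl fun j _ =>
    (mul_left_comm (G := ℝ) _ _ _).trans (mul_comm (G := ℝ) _ _)

theorem volumeDensity_le {g g' : Metric n M} {C : ℝ} (hC : 0 < C)
    (h : ∀ (x : M) (v : TangentSpace (𝓡 n) x), g.inner x v v ≤ C * g'.inner x v v)
    {e : OpenPartialHomeomorph M 𝔼} (he : e ∈ IsManifold.maximalAtlas (𝓡 n) ∞ M) {y : 𝔼}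
    (hy : y ∈ e.target) :
    volumeDensity g e y ≤ √(C ^ n) * volumeDensity g' e y := by
  rw [volumeDensity, volumeDensity, ← Real.sqrt_mul (pow_pos hC n).le]
  refine Real.sqrt_le_sqrt ?_
  have h1 := (posDef_metricMatrix g he hy).det_le_det
    (B := C • metricMatrix g' e y) ((posDef_metricMatrix g' he hy).isHermitian.smul (IsSelfAdjoint.all C)) ?_
  · rwa [Matrix.det_smul, Fintype.card_fin] at h1
  · intro v
    rw [Matrix.smul_mulVec, dotProduct_smul, dotProduct_metricMatrix, dotProduct_metricMatrix]
    exact h _ _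

variable [MeasurableSpace M] [BorelSpace M]

theorem riemannianVolume_le {g g' : Metric n M} {C : ℝ} (hC : 0 < C)
    (h : ∀ (x : M) (v : TangentSpace (𝓡 n) x), g.inner x v v ≤ C * g'.inner x v v) :
    riemannianVolume g ≤ ENNReal.ofReal √(C ^ n) • riemannianVolume g' := by
  refine iSup_le fun c => Measure.le_iff.2 fun B hB => ?_
  have hc := mem_maximalAtlas_chartAt (n := n) c
  have hms := measurableSet_inter_preimage (chartAt 𝔼 c).continuousOn_symm
    (chartAt 𝔼 c).open_target.measurableSet hB
  calc chartVolume g (chartAt 𝔼 c) B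
      ≤ ENNReal.ofReal √(C ^ n) * chartVolume g' (chartAt 𝔼 c) B := by
        rw [chartVolume_apply g hc hB, chartVolume_apply g' hc hB,
          ← lintegral_const_mul' _ _ ENNReal.ofReal_ne_top]
        refine setLIntegral_mono' hms fun y hy => ?_
        rw [← ENNReal.ofReal_mul (Real.sqrt_nonneg _)]
        exact ENNReal.ofReal_le_ofReal (volumeDensity_le hC h hc hy.1)
    _ ≤ ENNReal.ofReal √(C ^ n) * riemannianVolume g' B := by
        gcongr
        exact le_iSup (fun x : M => chartVolume g' (chartAt 𝔼 x)) c

end MaxPrinciple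
end

/-! ### Geodesic distance and distance-Lipschitz functions -/

noncomputable section

namespace MaxPrinciple

variable {n : ℕ} {M : Type*} [TopologicalSpace M] [ChartedSpace (EuclideanSpace ℝ (Fin n)) M]
  [IsManifold (𝓡 n) ∞ M]

attribute [local instance 10000] chartedSpaceSelf

local notation "𝔼" => EuclideanSpace ℝ (Fin n)

/-- The length of a tangent vector. -/
def tangentNorm (g : Metric n M) (x : M) (v : TangentSpace (𝓡 n) x) : ℝ := √(g.inner x v v)

/-- The speed of a curve. -/
def speed (g : Metric n M) (γ : ℝ → M) (t : ℝ) : ℝ≥0∞ :=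
  ENNReal.ofReal (tangentNorm g (γ t) (mfderiv 𝓘(ℝ, ℝ) (𝓡 n) γ t (1 : ℝ)))

theorem pathELength_eq (g : Metric n M) (γ : ℝ → M) (a b : ℝ) :
    letI : RiemannianBundle (fun x : M => TangentSpace (𝓡 n) x) := ⟨g.toRiemannianMetric⟩
    Manifold.pathELength (𝓡 n) γ a b = ∫⁻ t in Icc a b, speed g γ t := by
  let _ : RiemannianBundle (fun x : M => TangentSpace (𝓡 n) x) := ⟨g.toRiemannianMetric⟩
  rw [Manifold.pathELength_eq_lintegral_mfderiv_Icc]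
  refine lintegral_congr fun t => ?_
  rw [speed, tangentNorm, ← ofReal_norm, norm_eq_sqrt_real_inner]
  rfl

theorem geodesicEDist_le_lintegral (g : Metric n M) {γ : ℝ → M} {a b : ℝ}
    (hγ : ContMDiffOn 𝓘(ℝ, ℝ) (𝓡 n) 1 γ (Icc a b)) (hab : a ≤ b) :
    geodesicEDist g (γ a) (γ b) ≤ ∫⁻ t in Icc a b, speed g γ t := by
  rw [← pathELength_eq]
  let _ : RiemannianBundle (fun x : M => TangentSpace (𝓡 n) x) := ⟨g.toRiemannianMetric⟩
  exact Manifold.riemannianEDist_le_pathELength hγ rfl rfl hab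

theorem exists_path_of_geodesicEDist_lt (g : Metric n M) {x y : M} {r : ℝ≥0∞}
    (h : geodesicEDist g x y < r) : ∃ γ : ℝ → M, γ 0 = x ∧ γ 1 = y ∧
      ContMDiffOn 𝓘(ℝ, ℝ) (𝓡 n) 1 γ (Icc 0 1) ∧ ∫⁻ t in Icc 0 1, speed g γ t < r := by
  simp only [← pathELength_eq]
  let _ : RiemannianBundle (fun x : M => TangentSpace (𝓡 n) x) := ⟨g.toRiemannianMetric⟩
  exact Manifold.exists_lt_of_riemannianEDist_lt h

theorem geodesicEDist_self (g : Metric n M) (x : M) : geodesicEDist g x x = 0 := by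
  let _ : RiemannianBundle (fun x : M => TangentSpace (𝓡 n) x) := ⟨g.toRiemannianMetric⟩
  exact Manifold.riemannianEDist_self

theorem geodesicEDist_comm (g : Metric n M) (x y : M) :
    geodesicEDist g x y = geodesicEDist g y x := by
  let _ : RiemannianBundle (fun x : M => TangentSpace (𝓡 n) x) := ⟨g.toRiemannianMetric⟩
  exact Manifold.riemannianEDist_comm

theorem geodesicEDist_triangle (g : Metric n M) (x y z : M) :
    geodesicEDist g x z ≤ geodesicEDist g x y + geodesicEDist g y z := by
  let _ : RiemannianBundle (fun x : M => TangentSpace (𝓡 n) x) := ⟨g.toRiemannianMetric⟩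
  exact Manifold.riemannianEDist_triangle

theorem isContinuousRiemannianBundle (g : Metric n M) :
    letI : RiemannianBundle (fun x : M => TangentSpace (𝓡 n) x) := ⟨g.toRiemannianMetric⟩
    IsContinuousRiemannianBundle 𝔼 (fun x : M => TangentSpace (𝓡 n) x) :=
  letI : RiemannianBundle (fun x : M => TangentSpace (𝓡 n) x) := ⟨g.toRiemannianMetric⟩
  ⟨⟨g.inner, g.contMDiff.continuous, fun _ _ _ => rfl⟩⟩

theorem eventually_geodesicEDist_lt (g : Metric n M) (x : M) {c : ℝ≥0∞} (hc : 0 < c) :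
    ∀ᶠ y in 𝓝 x, geodesicEDist g x y < c := by
  let _ : RiemannianBundle (fun x : M => TangentSpace (𝓡 n) x) := ⟨g.toRiemannianMetric⟩
  have := isContinuousRiemannianBundle g
  exact eventually_riemannianEDist_lt (𝓡 n) x hc

/-- Nearby points are at finite distance, so the points at finite distance from x form a nonempty
clopen set. -/
theorem geodesicEDist_lt_top [ConnectedSpace M] (g : Metric n M) (x y : M) :
    geodesicEDist g x y < ⊤ := by
  have h : IsClopen {y | geodesicEDist g x y < ⊤} := by
    constructor
    · rw [← isOpen_compl_iff, isOpen_iff_mem_nhds]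
      intro y hy
      filter_upwards [eventually_geodesicEDist_lt g y ENNReal.zero_lt_top] with z hz hxz
      refine hy ((geodesicEDist_triangle g x z y).trans_lt (ENNReal.add_lt_top.2 ⟨hxz, ?_⟩))
      rwa [geodesicEDist_comm]
    · rw [isOpen_iff_mem_nhds]
      intro y hy
      filter_upwards [eventually_geodesicEDist_lt g y ENNReal.zero_lt_top] with z hz
      exact (geodesicEDist_triangle g x y z).trans_lt (ENNReal.add_lt_top.2 ⟨hy, hz⟩)
  have h1 := h.eq_univ ⟨x, by simp [geodesicEDist_self]⟩
  exact h1.ge (mem_univ y)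

theorem geodesicDist_comm (g : Metric n M) (x y : M) :
    geodesicDist g x y = geodesicDist g y x := by
  rw [geodesicDist, geodesicEDist_comm, geodesicDist]

theorem geodesicDist_nonneg (g : Metric n M) (x y : M) : 0 ≤ geodesicDist g x y :=
  ENNReal.toReal_nonneg

theorem abs_geodesicDist_sub_le [ConnectedSpace M] (g : Metric n M) (x y z : M) :
    |geodesicDist g x y - geodesicDist g x z| ≤ geodesicDist g y z := by
  have key : ∀ a b c : M, geodesicDist g a c ≤ geodesicDist g a b + geodesicDist g b c := by
    intro a b c
    rw [geodesicDist, geodesicDist, geodesicDist, ← ENNReal.toReal_add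
      (geodesicEDist_lt_top g _ _).ne (geodesicEDist_lt_top g _ _).ne]
    exact ENNReal.toReal_mono (ENNReal.add_ne_top.2 ⟨(geodesicEDist_lt_top g _ _).ne,
      (geodesicEDist_lt_top g _ _).ne⟩) (geodesicEDist_triangle g a b c)
  rw [abs_sub_le_iff]
  constructor
  · linarith [key x z y, geodesicDist_comm g y z]
  · linarith [key x y z]

theorem geodesicEDist_le_mul {g g' : Metric n M} {C : ℝ} (hC : 0 < C)
    (h : ∀ (x : M) (v : TangentSpace (𝓡 n) x), g.inner x v v ≤ C * g'.inner x v v) (x y : M) :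
    geodesicEDist g x y ≤ ENNReal.ofReal √C * geodesicEDist g' x y := by
  have hs : ∀ γ t, speed g γ t ≤ ENNReal.ofReal √C * speed g' γ t := by
    intro γ t
    rw [speed, speed, ← ENNReal.ofReal_mul (Real.sqrt_nonneg _), tangentNorm, tangentNorm,
      ← Real.sqrt_mul hC.le]
    exact ENNReal.ofReal_le_ofReal (Real.sqrt_le_sqrt (h _ _))
  have hc0 : ENNReal.ofReal √C ≠ 0 := by simpa using hC
  refine le_of_forall_gt fun r hr => ?_
  obtain ⟨γ, hγ0, hγ1, hγ, hlen⟩ := exists_path_of_geodesicEDist_lt g' (x := x) (y := y)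
    (r := r / ENNReal.ofReal √C)
    (by rwa [ENNReal.lt_div_iff_mul_lt (Or.inl hc0) (Or.inl ENNReal.ofReal_ne_top), mul_comm])
  rw [ENNReal.lt_div_iff_mul_lt (Or.inl hc0) (Or.inl ENNReal.ofReal_ne_top), mul_comm] at hlen
  refine lt_of_le_of_lt ?_ hlen
  have h1 := geodesicEDist_le_lintegral g hγ zero_le_one
  rw [hγ0, hγ1] at h1
  refine h1.trans ?_
  rw [← lintegral_const_mul' _ _ ENNReal.ofReal_ne_top]
  exact lintegral_mono fun t => hs γ t

theorem speed_symm_segment (g : Metric n M) {e : OpenPartialHomeomorph M 𝔼}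
    (he : e ∈ IsManifold.maximalAtlas (𝓡 n) ∞ M) {y w : 𝔼} {s : ℝ} (hs : y + s • w ∈ e.target) :
    speed g (fun s => e.symm (y + s • w)) s =
      ENNReal.ofReal √(chartInner g e (y + s • w) w w) := by
  have h1 : MDifferentiableAt 𝓘(ℝ, ℝ) (𝓡 n) (fun s : ℝ => y + s • w) s :=
    mdifferentiableAt_iff_differentiableAt.2 (by fun_prop)
  have h2 := mfderiv_comp_apply s
    ((mdifferentiable_of_mem_maximalAtlas he).mdifferentiableAt_symm hs) h1 (1 : ℝ)
  rw [mfderiv_eq_fderiv] at h2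
  have h3 : fderiv ℝ (fun s : ℝ => y + s • w) s 1 = w := by
    have : HasDerivAt (fun s : ℝ => y + s • w) w s := by
      simpa using ((hasDerivAt_id s).smul_const w).const_add y
    rw [this.hasFDerivAt.fderiv]
    simp
  have h4 : (mfderiv 𝓘(ℝ, ℝ) (𝓡 n) (fun s : ℝ => e.symm (y + s • w)) s (1 : ℝ) : 𝔼) =
      chartDeriv e (y + s • w) w := h2.trans (congrArg (chartDeriv e (y + s • w)) h3)
  exact congrArg (fun v : 𝔼 => ENNReal.ofReal
    √((g.inner (e.symm (y + s • w)) : 𝔼 →L[ℝ] 𝔼 →L[ℝ] ℝ) v v)) h4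

theorem geodesicEDist_symm_le (g : Metric n M) {e : OpenPartialHomeomorph M 𝔼}
    (he : e ∈ IsManifold.maximalAtlas (𝓡 n) ∞ M) {y w : 𝔼} {c : ℝ} (hc : 0 ≤ c)
    (h : ∀ s ∈ Icc (0 : ℝ) 1, y + s • w ∈ e.target ∧ chartInner g e (y + s • w) w w ≤ c ^ 2) :
    geodesicEDist g (e.symm y) (e.symm (y + w)) ≤ ENNReal.ofReal c := by
  have hγ : ContMDiffOn 𝓘(ℝ, ℝ) (𝓡 n) 1 (fun s : ℝ => e.symm (y + s • w)) (Icc 0 1) := by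
    refine ((contMDiffOn_symm_of_mem_maximalAtlas he).of_le (by simp)).comp
      (t := e.target) (contMDiffOn_iff_contDiffOn.2 ?_) fun s hs => (h s hs).1
    exact ContDiff.contDiffOn (by fun_prop)
  have h1 := geodesicEDist_le_lintegral g hγ zero_le_one
  simp only [zero_smul, add_zero, one_smul] at h1
  refine h1.trans ?_
  calc ∫⁻ t in Icc 0 1, speed g (fun s => e.symm (y + s • w)) t
      ≤ ∫⁻ _ in Icc (0 : ℝ) 1, ENNReal.ofReal c := by
        refine setLIntegral_mono' measurableSet_Icc fun s hs => ?_
        rw [speed_symm_segment g he (h s hs).1]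
        refine ENNReal.ofReal_le_ofReal ?_
        rw [← Real.sqrt_sq hc]
        exact Real.sqrt_le_sqrt (h s hs).2
    _ = ENNReal.ofReal c := by simp

theorem chartInner_smul (g : Metric n M) (e : OpenPartialHomeomorph M 𝔼) (y w : 𝔼) (s : ℝ) :
    chartInner g e y (s • w) (s • w) = s ^ 2 * chartInner g e y w w := by
  simp only [chartInner_eq_sum, Finset.mul_sum]
  refine Finset.sum_congr rfl fun i _ => Finset.sum_congr rfl fun j _ => ?_
  simp only [PiLp.smul_apply, smul_eq_mul]
  ring

theorem chartInner_le_sum_mul (g : Metric n M) (e : OpenPartialHomeomorph M 𝔼) (y w : 𝔼) :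
    chartInner g e y w w ≤ (∑ i, ∑ j, |metricMatrix g e y i j|) * ‖w‖ ^ 2 := by
  rw [chartInner_eq_sum]
  simp only [Finset.sum_mul]
  refine Finset.sum_le_sum fun i _ => Finset.sum_le_sum fun j _ => ?_
  have h1 : |w i * w j| ≤ ‖w‖ ^ 2 := by
    rw [abs_mul, sq]
    exact mul_le_mul (PiLp.norm_apply_le w i) (PiLp.norm_apply_le w j) (abs_nonneg _)
      (norm_nonneg _)
  calc w i * w j * metricMatrix g e y i j ≤ |w i * w j * metricMatrix g e y i j| := le_abs_self _
    _ = |metricMatrix g e y i j| * |w i * w j| := by rw [abs_mul, mul_comm]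
    _ ≤ |metricMatrix g e y i j| * ‖w‖ ^ 2 := by gcongr

/-- In a small coordinate ball straight segments are competitors for the distance, and their
g-length is at most √B times the Euclidean length when the metric coefficients are bounded by B in
total. -/
theorem isChartLipschitz_of_dist [ConnectedSpace M] (g : Metric n M) {f : M → ℝ} {L : ℝ}
    (hL : 0 ≤ L) (hf : ∀ x y, |f x - f y| ≤ L * geodesicDist g x y) : IsChartLipschitz n f := by
  intro c y₀ hy₀
  set e := chartAt 𝔼 c with he
  have hm := mem_maximalAtlas_chartAt (n := n) c
  have hcont : ContinuousAt (fun y => ∑ i, ∑ j, |metricMatrix g e y i j|) y₀ := by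
    have : ContinuousOn (fun y => ∑ i, ∑ j, |metricMatrix g e y i j|) e.target :=
      continuousOn_finsetSum _ fun i _ => continuousOn_finsetSum _ fun j _ =>
        (contDiffOn_metricMatrix g hm i j).continuousOn.abs
    exact this.continuousAt (e.open_target.mem_nhds hy₀)
  set B := (∑ i, ∑ j, |metricMatrix g e y₀ i j|) + 1 with hB
  have hB0 : 0 ≤ B := by positivity
  obtain ⟨r, hr, hball⟩ := Metric.mem_nhds_iff.1 (inter_mem (e.open_target.mem_nhds hy₀)
    (hcont.eventually (gt_mem_nhds (lt_add_one _))))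
  refine ⟨(L * √B).toNNReal, Metric.ball y₀ r,
    mem_nhdsWithin_of_mem_nhds (Metric.ball_mem_nhds _ hr),
    LipschitzOnWith.of_dist_le_mul fun y hy z hz => ?_⟩
  rw [Real.coe_toNNReal _ (by positivity), dist_comm y z, dist_eq_norm z y, dist_comm,
    Real.dist_eq, abs_sub_comm, mul_assoc]
  refine (hf _ _).trans (mul_le_mul_of_nonneg_left ?_ hL)
  have h1 := geodesicEDist_symm_le g hm (y := y) (w := z - y) (c := √B * ‖z - y‖) (by positivity) ?_
  · rw [add_sub_cancel] at h1
    exact ENNReal.toReal_le_of_le_ofReal (by positivity) h1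
  · intro s hs
    have hmem : y + s • (z - y) ∈ Metric.ball y₀ r :=
      (convex_ball y₀ r).add_smul_sub_mem hy hz hs
    refine ⟨(hball hmem).1, (chartInner_le_sum_mul g e _ _).trans ?_⟩
    rw [mul_pow, Real.sq_sqrt hB0]
    exact mul_le_mul_of_nonneg_right (hball hmem).2.le (sq_nonneg _)

/-- By continuity of the metric, a short coordinate segment in direction w has length at most c|s|
for any c > √g(w,w). This bounds the difference quotient by L c; then c decreases to √g(w,w). -/
theorem abs_fderiv_comp_symm_le_of_dist [ConnectedSpace M] (g : Metric n M) {f : M → ℝ} {L : ℝ}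
    (hL : 0 ≤ L) (hf : ∀ x y, |f x - f y| ≤ L * geodesicDist g x y)
    {e : OpenPartialHomeomorph M 𝔼} (he : e ∈ IsManifold.maximalAtlas (𝓡 n) ∞ M) {y : 𝔼}
    (hy : y ∈ e.target) (hd : DifferentiableAt ℝ (fun z => f (e.symm z)) y) (w : 𝔼) :
    |fderiv ℝ (fun z => f (e.symm z)) y w| ≤ L * √(chartInner g e y w w) := by
  have hline : HasDerivAt (fun s : ℝ => y + s • w) w 0 := by
    simpa using ((hasDerivAt_id (0 : ℝ)).smul_const w).const_add y
  have hder : HasDerivAt (fun s : ℝ => f (e.symm (y + s • w)))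
      (fderiv ℝ (fun z => f (e.symm z)) y w) 0 := by
    have h1 : HasFDerivAt (fun z => f (e.symm z)) (fderiv ℝ (fun z => f (e.symm z)) y)
        (y + (0 : ℝ) • w) := by simpa using hd.hasFDerivAt
    exact h1.comp_hasDerivAt (0 : ℝ) hline
  have hbound : ∀ c, √(chartInner g e y w w) < c →
      |fderiv ℝ (fun z => f (e.symm z)) y w| ≤ L * c := by
    intro c hc
    have hc0 : 0 < c := (Real.sqrt_nonneg _).trans_lt hc
    have hcont : ContinuousAt (fun z => chartInner g e z w w) y := by
      have : ContinuousOn (fun z => chartInner g e z w w) e.target := by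
        simp only [chartInner_eq_sum]
        exact continuousOn_finsetSum _ fun i _ => continuousOn_finsetSum _ fun j _ =>
          continuousOn_const.mul (contDiffOn_metricMatrix g he i j).continuousOn
      exact this.continuousAt (e.open_target.mem_nhds hy)
    have hlt : chartInner g e y w w < c ^ 2 := (Real.sqrt_lt' hc0).1 hc
    obtain ⟨r, hr, hball⟩ := Metric.mem_nhds_iff.1 (inter_mem (e.open_target.mem_nhds hy)
      (hcont.eventually (gt_mem_nhds hlt)))
    have hev : ∀ᶠ s : ℝ in 𝓝 0, y + s • w ∈ Metric.ball y r := by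
      refine hline.continuousAt.eventually (Metric.isOpen_ball.mem_nhds ?_)
      simpa using hr
    have := hder.hasFDerivAt.le_of_lip' (C := L * c) (by positivity) ?_
    · simpa using this
    filter_upwards [hev] with s hs
    simp only [zero_smul, add_zero, sub_zero, Real.norm_eq_abs]
    refine (hf _ _).trans ?_
    rw [mul_assoc]
    refine mul_le_mul_of_nonneg_left ?_ hL
    have h1 := geodesicEDist_symm_le g he (y := y) (w := s • w) (c := c * |s|) (by positivity) ?_
    · rw [geodesicDist_comm]
      exact ENNReal.toReal_le_of_le_ofReal (by positivity) h1
    · intro σ hσ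
      have hmem : y + σ • (s • w) ∈ Metric.ball y r := by
        have := (convex_ball y r).add_smul_sub_mem (Metric.mem_ball_self hr) hs hσ
        simpa using this
      refine ⟨(hball hmem).1, ?_⟩
      rw [chartInner_smul, mul_pow, sq_abs, mul_comm]
      exact mul_le_mul_of_nonneg_right (hball hmem).2.le (sq_nonneg _)
  have h2 : Tendsto (fun c => L * c) (𝓝[>] √(chartInner g e y w w))
      (𝓝 (L * √(chartInner g e y w w))) :=
    ((continuous_const.mul continuous_id).tendsto _).mono_left nhdsWithin_le_nhds
  exact ge_of_tendsto h2 (eventually_nhdsWithin_of_forall fun c hc => hbound c hc)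

theorem abs_mfderiv_le_of_dist [ConnectedSpace M] (g : Metric n M) {f : M → ℝ} {L : ℝ}
    (hL : 0 ≤ L) (hf : ∀ x y, |f x - f y| ≤ L * geodesicDist g x y) (x : M)
    (v : TangentSpace (𝓡 n) x) :
    abs (α := ℝ) (mfderiv (𝓡 n) 𝓘(ℝ, ℝ) f x v) ≤ L * tangentNorm g x v := by
  by_cases hd : MDifferentiableAt (𝓡 n) 𝓘(ℝ, ℝ) f x
  swap
  · rw [mfderiv_zero_of_not_mdifferentiableAt hd]
    change |(0 : ℝ)| ≤ _
    rw [abs_zero]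
    exact mul_nonneg hL (Real.sqrt_nonneg _)
  have key : ∀ (e : OpenPartialHomeomorph M 𝔼) (_ : e ∈ IsManifold.maximalAtlas (𝓡 n) ∞ M)
      (y : 𝔼) (_ : y ∈ e.target) (_ : MDifferentiableAt (𝓡 n) 𝓘(ℝ, ℝ) f (e.symm y))
      (v : TangentSpace (𝓡 n) (e.symm y)),
      abs (α := ℝ) (mfderiv (𝓡 n) 𝓘(ℝ, ℝ) f (e.symm y) v) ≤ L * tangentNorm g (e.symm y) v := by
    intro e he y hy hd v
    obtain ⟨w, rfl⟩ := (chartDeriv_bijective he hy).2 v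
    have h1 := abs_fderiv_comp_symm_le_of_dist g hL hf he hy
      ((mdifferentiableAt_iff_comp_symm he hy).1 hd) w
    rw [fderiv_comp_symm he hy hd] at h1
    exact h1
  have h := key (chartAt 𝔼 x) (mem_maximalAtlas_chartAt (n := n) x) _ (mem_chart_target 𝔼 x)
  rw [(chartAt 𝔼 x).left_inv (mem_chart_source 𝔼 x)] at h
  exact h hd v

end MaxPrinciple
end

/-! ### Hopf–Rinow: compactness of closed balls -/

noncomputable section

namespace MaxPrinciple

/-- In a complete locally compact length space, closed balls are compact. -/
theorem isCompact_closedEBall_of_length {X : Type*} [PseudoEMetricSpace X] [CompleteSpace X]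
    [LocallyCompactSpace X]
    (h : ∀ (x y : X) (a b : ℝ), 0 ≤ a → 0 < b → edist x y < ENNReal.ofReal (a + b) →
      ∃ z, edist x z ≤ ENNReal.ofReal a ∧ edist z y < ENNReal.ofReal b)
    (x : X) {r : ℝ} (hr : 0 ≤ r) : IsCompact {y | edist x y ≤ ENNReal.ofReal r} := by
  have hcl : ∀ r : ℝ, IsClosed {y | edist x y ≤ ENNReal.ofReal r} := fun r =>
    isClosed_le (Continuous.edist (α := X) continuous_const continuous_id) continuous_const
  have hmono : ∀ {r s : ℝ}, r ≤ s →
      {y | edist x y ≤ ENNReal.ofReal r} ⊆ {y | edist x y ≤ ENNReal.ofReal s} :=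
    fun hrs y hy => le_trans hy (ENNReal.ofReal_le_ofReal hrs)
  have hdown : ∀ {r s : ℝ}, r ≤ s → IsCompact {y | edist x y ≤ ENNReal.ofReal s} →
      IsCompact {y | edist x y ≤ ENNReal.ofReal r} :=
    fun hrs hs => hs.of_isClosed_subset (hcl _) (hmono hrs)
  -- Continuous induction on the radius: `S` contains 0, is stable under a small increase (`hgrow`)
  -- and under limits from below (`hlim`).
  set S : Set ℝ := {r | IsCompact {y | edist x y ≤ ENNReal.ofReal r}} with hS
  -- By local compactness a compact ball has a compact thickening, and by the length property that
  -- thickening contains a slightly larger ball.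
  have hgrow : ∀ s, 0 ≤ s → s ∈ S → ∃ δ, 0 < δ ∧ s + δ ∈ S := by
    intro s hs0 hs
    obtain ⟨δ, hδ, hcomp⟩ := IsCompact.exists_isCompact_cthickening hs
    refine ⟨δ / 2, by positivity, hcomp.of_isClosed_subset (hcl _) fun y hy => ?_⟩
    obtain ⟨z, hz, hzy⟩ := h x y s δ hs0 hδ
      (lt_of_le_of_lt hy ((ENNReal.ofReal_lt_ofReal_iff (by positivity)).2 (by linarith)))
    rw [edist_comm] at hzy
    exact (Metric.infEDist_le_edist_of_mem
      (show z ∈ {y | edist x y ≤ ENNReal.ofReal s} from hz)).trans hzy.le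
  have hzero : (0 : ℝ) ∈ S := by
    have hc : IsCompact (closure {x}) := isCompact_singleton.closure
    refine hc.of_isClosed_subset (hcl _) fun y hy => ?_
    rw [EMetric.mem_closure_iff]
    intro ε hε
    refine ⟨x, rfl, ?_⟩
    rw [edist_comm]
    refine lt_of_le_of_lt hy (by simpa using hε)
  -- Total boundedness at the limit radius: every point of the large ball is within η of a smaller
  -- compact ball, so a finite η-net of the latter is a 2η-net of the former.
  have hlim : ∀ s, 0 ≤ s → (∀ ε, 0 < ε → ∃ s' ∈ S, 0 ≤ s' ∧ s - ε < s') → s ∈ S := by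
    intro s hs0 hs
    refine isCompact_iff_totallyBounded_isComplete.2
      ⟨EMetric.totallyBounded_iff.2 fun ε hε => ?_, (hcl s).isComplete⟩
    obtain ⟨η, hη, hηε⟩ : ∃ η : ℝ, 0 < η ∧ ENNReal.ofReal (2 * η) ≤ ε := by
      rcases eq_or_ne ε ⊤ with rfl | hne
      · exact ⟨1, one_pos, le_top⟩
      · refine ⟨ε.toReal / 2, half_pos (ENNReal.toReal_pos hε.ne' hne), ?_⟩
        rw [mul_div_cancel₀ _ two_ne_zero, ENNReal.ofReal_toReal hne]
    obtain ⟨s', hs', hs'0, hlt⟩ := hs η hη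
    obtain ⟨t, ht, hcov⟩ := EMetric.totallyBounded_iff.1 (IsCompact.totallyBounded hs')
      (ENNReal.ofReal η) (by simpa using hη)
    refine ⟨t, ht, fun y hy => ?_⟩
    obtain ⟨z, hz, hzy⟩ := h x y s' η hs'0 hη
      (lt_of_le_of_lt hy ((ENNReal.ofReal_lt_ofReal_iff (by positivity)).2 (by linarith)))
    obtain ⟨w, hw, hzw⟩ := mem_iUnion₂.1 (hcov hz)
    refine mem_iUnion₂.2 ⟨w, hw, ?_⟩
    refine lt_of_lt_of_le ?_ hηε
    rw [two_mul, ENNReal.ofReal_add hη.le hη.le]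
    refine lt_of_le_of_lt (edist_triangle y z w) (ENNReal.add_lt_add ?_ hzw)
    rwa [edist_comm]
  have hclosed : IsClosed (S ∩ Icc 0 r) := by
    rw [← closure_subset_iff_isClosed]
    intro s hs
    have hsI : s ∈ Icc 0 r := isClosed_Icc.closure_subset_iff.2 inter_subset_right hs
    refine ⟨hlim s hsI.1 fun ε hε => ?_, hsI⟩
    obtain ⟨s', hs', hd⟩ := Metric.mem_closure_iff.1 hs ε hε
    refine ⟨s', hs'.1, hs'.2.1, ?_⟩
    rw [Real.dist_eq] at hd
    linarith [(abs_lt.1 hd).2]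
  refine hclosed.Icc_subset_of_forall_exists_gt hzero (fun s hs y hy => ?_) ⟨hr, le_rfl⟩
  obtain ⟨δ, hδ, hδS⟩ := hgrow s hs.2.1 hs.1
  exact ⟨min y (s + δ), hdown (min_le_right _ _) hδS, lt_min hy (by linarith), min_le_left _ _⟩

variable {n : ℕ} {M : Type*} [TopologicalSpace M] [ChartedSpace (EuclideanSpace ℝ (Fin n)) M]
  [IsManifold (𝓡 n) ∞ M]

attribute [local instance 10000] chartedSpaceSelf

local notation "𝔼" => EuclideanSpace ℝ (Fin n)

theorem continuous_geodesicEDist_comp (g : Metric n M) (x : M) {γ : ℝ → M} {s : Set ℝ}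
    (hγ : ContinuousOn γ s) : ContinuousOn (fun t => geodesicEDist g x (γ t)) s := by
  have h : Continuous (geodesicEDist g x) := by
    rw [continuous_iff_continuousAt]
    intro y
    rcases eq_or_ne (geodesicEDist g x y) ⊤ with htop | hne
    · refine tendsto_nhds_of_eventually_eq ?_
      filter_upwards [eventually_geodesicEDist_lt g y ENNReal.zero_lt_top] with z hz
      by_contra hne
      rw [htop] at hne
      refine (geodesicEDist_triangle g x z y).not_gt ?_
      rw [htop, geodesicEDist_comm g z y]
      exact ENNReal.add_lt_top.2 ⟨lt_top_iff_ne_top.2 hne, hz⟩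
    · refine (ENNReal.tendsto_nhds hne).2 fun ε hε => ?_
      filter_upwards [eventually_geodesicEDist_lt g y hε] with z hz
      refine ⟨tsub_le_iff_right.2 ((geodesicEDist_triangle g x z y).trans ?_),
        (geodesicEDist_triangle g x y z).trans ?_⟩
      · rw [geodesicEDist_comm g z y]
        gcongr
      · gcongr
  exact h.comp_continuousOn hγ

/-- Follow a path of length less than a + b until the distance from x equals a, by the intermediate
value theorem. The part already travelled has length at least a, so less than b is left. -/
theorem exists_between_geodesicEDist (g : Metric n M) (x y : M) (a b : ℝ) (ha : 0 ≤ a)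
    (hb : 0 < b) (h : geodesicEDist g x y < ENNReal.ofReal (a + b)) :
    ∃ z, geodesicEDist g x z ≤ ENNReal.ofReal a ∧ geodesicEDist g z y < ENNReal.ofReal b := by
  rcases le_total (geodesicEDist g x y) (ENNReal.ofReal a) with hle | hge
  · exact ⟨y, hle, by simpa [geodesicEDist_self] using hb⟩
  obtain ⟨γ, hγ0, hγ1, hγ, hlen⟩ := exists_path_of_geodesicEDist_lt g h
  have hivt := intermediate_value_Icc zero_le_one
    (continuous_geodesicEDist_comp g x hγ.continuousOn)
  rw [hγ0, hγ1, geodesicEDist_self] at hivt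
  obtain ⟨s, hs, hsa⟩ := hivt ⟨zero_le, hge⟩
  change geodesicEDist g x (γ s) = _ at hsa
  refine ⟨γ s, hsa.le, ?_⟩
  have h0 := geodesicEDist_le_lintegral g (hγ.mono (Icc_subset_Icc_right hs.2)) hs.1
  have h1 := geodesicEDist_le_lintegral g (hγ.mono (Icc_subset_Icc_left hs.1)) hs.2
  rw [hγ0, hsa] at h0
  rw [hγ1] at h1
  refine h1.trans_lt ?_
  have hadd : (∫⁻ t in Icc 0 s, speed g γ t) + ∫⁻ t in Icc s 1, speed g γ t =
      ∫⁻ t in Icc 0 1, speed g γ t := by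
    simp only [← pathELength_eq]
    let _ : RiemannianBundle (fun x : M => TangentSpace (𝓡 n) x) := ⟨g.toRiemannianMetric⟩
    exact Manifold.pathELength_add hs.1 hs.2
  rw [← hadd, ENNReal.ofReal_add ha hb.le] at hlen
  by_contra hcon
  exact (add_le_add h0 (not_lt.1 hcon)).not_gt hlen

theorem isCompact_geodesicDist_le [ConnectedSpace M] [T2Space M] (g : Metric n M)
    (hg : IsCompleteMetric g) (x : M) (r : ℝ) : IsCompact {y | geodesicDist g x y ≤ r} := by
  rcases lt_or_ge r 0 with hr | hr
  · convert isCompact_empty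
    refine eq_empty_of_forall_notMem fun y hy => ?_
    exact (hr.trans_le (geodesicDist_nonneg g x y)).not_ge hy
  have hset : {y | geodesicDist g x y ≤ r} = {y | geodesicEDist g x y ≤ ENNReal.ofReal r} := by
    ext y
    exact (ENNReal.le_ofReal_iff_toReal_le (geodesicEDist_lt_top g x y).ne hr).symm
  rw [hset]
  have : LocallyCompactSpace M := ChartedSpace.locallyCompactSpace 𝔼 M
  let _ : RiemannianBundle (fun x : M => TangentSpace (𝓡 n) x) := ⟨g.toRiemannianMetric⟩
  have := isContinuousRiemannianBundle g
  have : IsManifold (𝓡 n) 1 M := .of_le (n := ∞) (by simp)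
  let _ : PseudoEMetricSpace M := .ofRiemannianMetric (𝓡 n) M
  have : CompleteSpace M := by
    refine EMetric.complete_of_cauchySeq_tendsto fun u hu => ?_
    obtain ⟨z, hz⟩ := hg u fun ε hε => by
      obtain ⟨N, hN⟩ := EMetric.cauchySeq_iff.1 hu ε hε
      exact ⟨N, hN⟩
    exact ⟨z, tendsto_iff_edist_tendsto_0.2 hz⟩
  exact isCompact_closedEBall_of_length (X := M) (exists_between_geodesicEDist g) x hr

end MaxPrinciple
end

/-! ### Energy estimate at a fixed time -/

noncomputable section

namespace MaxPrinciple

/-- Here p stands for u₊, N for |∇u|, E for the Gaussian weight, r for ρ, and D₁, D₂ for the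
derivatives of φ and ρ along ∇u. The available 2φ²N² is divided as ½ + 1 + ½ of φ²N² between the
cutoff, the weight and the drift. -/
theorem energy_absorption {p φ E N D₁ D₂ Δ v b α₁ α₂ κ r L l : ℝ} (hp : 0 ≤ p) (hφ : 0 ≤ φ)
    (hE : 0 ≤ E) (hκ : 0 ≤ κ) (hr : 0 ≤ r) (hD₁ : |D₁| ≤ l * N) (hD₂ : |D₂| ≤ L * N)
    (hb : b ≤ α₂) (hv : v ≤ Δ + α₁ * N + b * p) :
    φ * φ * (E * p) * (2 * v) - (4 * κ ^ 2 * L ^ 2 * r ^ 2 + 2 * α₁ ^ 2 + 2 * α₂) *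
        (φ * φ * (E * p ^ 2)) ≤
      2 * (φ * φ * (E * p) * Δ + (φ * φ * (E * N ^ 2 + p * (E * (-2 * κ * r) * D₂)) +
        E * p * (φ * D₁ + φ * D₁))) + 8 * l ^ 2 * (E * p ^ 2) := by
  have h1 : φ ^ 2 * p * v ≤ φ ^ 2 * p * (Δ + α₁ * N + b * p) :=
    mul_le_mul_of_nonneg_left hv (by positivity)
  have h2 : φ ^ 2 * p ^ 2 * b ≤ φ ^ 2 * p ^ 2 * α₂ := mul_le_mul_of_nonneg_left hb (by positivity)
  have h3 : p * φ * -D₁ ≤ p * φ * (l * N) :=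
    mul_le_mul_of_nonneg_left ((neg_le_abs _).trans hD₁) (by positivity)
  have h4 : κ * r * φ ^ 2 * p * D₂ ≤ κ * r * φ ^ 2 * p * (L * N) :=
    mul_le_mul_of_nonneg_left ((le_abs_self _).trans hD₂) (by positivity)
  -- Completed squares for the three uses of Young's inequality: cutoff, Gaussian weight, drift.
  -- They enter with factors ½, 1, ½.
  have h5 := sq_nonneg (φ * N - 4 * p * l)
  have h6 := sq_nonneg (φ * (N - 2 * p * κ * r * L))
  have h7 := sq_nonneg (φ * (N - 2 * p * α₁))
  have h8 : φ ^ 2 * p * (2 * v) - (4 * κ ^ 2 * L ^ 2 * r ^ 2 + 2 * α₁ ^ 2 + 2 * α₂) *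
        (φ ^ 2 * p ^ 2) ≤ 2 * (φ ^ 2 * p * Δ + (φ ^ 2 * (N ^ 2 + p * ((-2 * κ * r) * D₂)) +
        p * (φ * D₁ + φ * D₁))) + 8 * l ^ 2 * p ^ 2 := by linarith
  have h9 := mul_le_mul_of_nonneg_left h8 hE
  linarith

variable {n : ℕ} {M : Type*} [TopologicalSpace M] [ChartedSpace (EuclideanSpace ℝ (Fin n)) M]
  [IsManifold (𝓡 n) ∞ M]

attribute [local instance 10000] chartedSpaceSelf

local notation "𝔼" => EuclideanSpace ℝ (Fin n)

theorem gradPairing_mul (g : Metric n M) {f h : M → ℝ} (u : M → ℝ) {x : M}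
    (hf : MDifferentiableAt (𝓡 n) 𝓘(ℝ, ℝ) f x) (hh : MDifferentiableAt (𝓡 n) 𝓘(ℝ, ℝ) h x) :
    gradPairing g (fun x => f x * h x) u x =
      f x * gradPairing g h u x + h x * gradPairing g f u x := by
  have h1 := (hf.hasMFDerivAt.mul hh.hasMFDerivAt).mfderiv
  exact congrArg (fun A : 𝔼 →L[ℝ] ℝ => A (gradient g u x)) h1

theorem mdifferentiableAt_real_comp {f : M → ℝ} {φ : ℝ → ℝ} {x : M}
    (hf : MDifferentiableAt (𝓡 n) 𝓘(ℝ, ℝ) f x) (hφ : DifferentiableAt ℝ φ (f x)) :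
    MDifferentiableAt (𝓡 n) 𝓘(ℝ, ℝ) (fun x => φ (f x)) x :=
  MDifferentiableAt.comp x hφ.mdifferentiableAt hf

theorem gradPairing_comp (g : Metric n M) {f : M → ℝ} (u : M → ℝ) {φ : ℝ → ℝ} {d : ℝ} {x : M}
    (hf : MDifferentiableAt (𝓡 n) 𝓘(ℝ, ℝ) f x) (hφ : HasDerivAt φ d (f x)) :
    gradPairing g (fun x => φ (f x)) u x = d * gradPairing g f u x := by
  have h1 := (HasMFDerivAt.comp x hφ.hasFDerivAt.hasMFDerivAt hf.hasMFDerivAt).mfderiv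
  have h2 := congrArg (fun A : 𝔼 →L[ℝ] ℝ => A (gradient g u x)) h1
  refine h2.trans ?_
  change (gradPairing g f u x) * d = _
  rw [mul_comm]

theorem gradPairing_self (g : Metric n M) (u : M → ℝ) (x : M) :
    gradPairing g u u x = tangentNorm g x (gradient g u x) ^ 2 := by
  rw [tangentNorm, gradPairing]
  have h := inner_gradient g u x (gradient g u x)
  rw [← h, Real.sq_sqrt]
  by_cases h0 : gradient g u x = 0
  · rw [h0, map_zero]
  · exact (g.pos x _ h0).le

theorem inner_le_tangentNorm_mul (g : Metric n M) (x : M) (v w : TangentSpace (𝓡 n) x) :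
    g.inner x v w ≤ tangentNorm g x v * tangentNorm g x w := by
  let _ : RiemannianBundle (fun x : M => TangentSpace (𝓡 n) x) := ⟨g.toRiemannianMetric⟩
  have h := real_inner_le_norm v w
  rw [norm_eq_sqrt_real_inner, norm_eq_sqrt_real_inner] at h
  exact h

/-- No differentiability is required, since `mfderiv` is zero by convention where it fails. The case
of interest is a zero of the nonnegative test function. -/
theorem mfderiv_eq_zero_of_forall_le {f : M → ℝ} {x : M} (h : ∀ z, f x ≤ f z) :
    (mfderiv (𝓡 n) 𝓘(ℝ, ℝ) f x : 𝔼 →L[ℝ] ℝ) = 0 := by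
  by_cases hd : MDifferentiableAt (𝓡 n) 𝓘(ℝ, ℝ) f x
  · rw [hd.mfderiv, fderivWithin_of_mem_nhds (by simp)]
    refine IsLocalMin.fderiv_eq_zero (Eventually.of_forall fun z => ?_)
    simp only [writtenInExtChartAt, Function.comp_apply, extChartAt_to_inv]
    exact h _
  · exact mfderiv_zero_of_not_mdifferentiableAt hd

/-- The Lipschitz cutoff function `max 0 (1 - ρ / R)`. -/
def cutoff (ρ : M → ℝ) (R : ℝ) (x : M) : ℝ := max 0 (1 - ρ x / R)

theorem cutoff_nonneg (ρ : M → ℝ) (R : ℝ) (x : M) : 0 ≤ cutoff ρ R x := le_max_left _ _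

theorem cutoff_le_one {ρ : M → ℝ} {R : ℝ} (hR : 0 < R) (hρ : ∀ x, 0 ≤ ρ x) (x : M) :
    cutoff ρ R x ≤ 1 :=
  max_le zero_le_one (by linarith [div_nonneg (hρ x) hR.le])

theorem cutoff_eq_zero {ρ : M → ℝ} {R : ℝ} (hR : 0 < R) {x : M} (hx : R ≤ ρ x) :
    cutoff ρ R x = 0 :=
  max_eq_left (by linarith [(one_le_div hR).2 hx])

theorem abs_cutoff_sub_le {g : Metric n M} {ρ : M → ℝ} {R L : ℝ} (hR : 0 < R)
    (hρL : ∀ x y, |ρ x - ρ y| ≤ L * geodesicDist g x y) (x y : M) :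
    |cutoff ρ R x - cutoff ρ R y| ≤ L / R * geodesicDist g x y := by
  refine (abs_max_sub_max_le_max _ _ _ _).trans ?_
  rw [sub_self, abs_zero, max_eq_right (abs_nonneg _),
    show 1 - ρ x / R - (1 - ρ y / R) = -((ρ x - ρ y) / R) by ring, abs_neg, abs_div,
    abs_of_pos hR, div_mul_eq_mul_div]
  gcongr
  exact hρL x y

theorem hasDerivAt_exp_neg_mul_sq (κ σ s : ℝ) :
    HasDerivAt (fun s => Real.exp (-κ * s ^ 2 - σ)) (Real.exp (-κ * s ^ 2 - σ) * (-2 * κ * s)) s := by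
  refine ((((hasDerivAt_pow 2 s).const_mul (-κ)).sub_const σ).exp).congr_deriv ?_
  simp
  ring

/-- This avoids differentiating u₊ across {u = 0}. Where ψ vanishes it is minimal, so dψ = 0 and the
inequality is trivial. Elsewhere u > 0, u₊ coincides with u nearby, the product rule expands dψ(∇u),
and `energy_absorption` concludes. -/
theorem pointwise_energy [ConnectedSpace M] (g : Metric n M) {ρ u : M → ℝ} {R L κ σ α₁ α₂ b v : ℝ}
    (hR : 0 < R) (hL : 0 ≤ L) (hκ : 0 ≤ κ) (hρ : ∀ x, 0 ≤ ρ x)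
    (hρL : ∀ x y, |ρ x - ρ y| ≤ L * geodesicDist g x y)
    (hu : IsChartC2 n u) {x : M} (a : TangentSpace (𝓡 n) x) (ha : tangentNorm g x a ≤ α₁)
    (hb : |b| ≤ α₂) (hv : v ≤ laplacian g u x + g.inner x a (gradient g u x) + b * u x)
    (hdρ : MDifferentiableAt (𝓡 n) 𝓘(ℝ, ℝ) ρ x)
    (hdφ : MDifferentiableAt (𝓡 n) 𝓘(ℝ, ℝ) (cutoff ρ R) x)
    (ψ : M → ℝ) (hψ : ψ = fun x => cutoff ρ R x * cutoff ρ R x *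
      (Real.exp (-κ * ρ x ^ 2 - σ) * max (u x) 0)) :
    ψ x * (2 * v) - (4 * κ ^ 2 * L ^ 2 * ρ x ^ 2 + 2 * α₁ ^ 2 + 2 * α₂) * (ψ x * max (u x) 0) ≤
      2 * (ψ x * laplacian g u x + gradPairing g ψ u x) +
        8 * (L / R) ^ 2 * {z | ρ z ≤ R}.indicator
          (fun z => Real.exp (-κ * ρ z ^ 2 - σ) * max (u z) 0 ^ 2) x := by
  have hψ0 : ∀ z, 0 ≤ ψ z := fun z => by
    rw [hψ]
    exact mul_nonneg (mul_self_nonneg _) (mul_nonneg (Real.exp_pos _).le (le_max_right _ _))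
  have hind : 0 ≤ 8 * (L / R) ^ 2 * {z | ρ z ≤ R}.indicator
      (fun z => Real.exp (-κ * ρ z ^ 2 - σ) * max (u z) 0 ^ 2) x :=
    mul_nonneg (by positivity) (indicator_nonneg (fun z _ => by positivity) x)
  by_cases hzero : ψ x = 0
  · have h1 : gradPairing g ψ u x = 0 := by
      have h2 : (mfderiv (𝓡 n) 𝓘(ℝ, ℝ) ψ x : 𝔼 →L[ℝ] ℝ) = 0 :=
        mfderiv_eq_zero_of_forall_le fun z => by rw [hzero]; exact hψ0 z
      exact congrArg (fun A : 𝔼 →L[ℝ] ℝ => A (gradient g u x)) h2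
    rw [hzero, h1]
    linarith
  have hux : 0 < u x := by
    by_contra hneg
    refine hzero ?_
    simp [hψ, max_eq_right (not_lt.1 hneg)]
  have hRx : ρ x ≤ R := by
    by_contra hlt
    refine hzero ?_
    simp [hψ, cutoff_eq_zero hR (not_le.1 hlt).le]
  have hmax : max (u x) 0 = u x := max_eq_left hux.le
  have hpos : (fun z => max (u z) 0) =ᶠ[𝓝 x] u := by
    filter_upwards [(hu.isChartLipschitz.continuous.tendsto x).eventually (lt_mem_nhds hux)]
      with z hz
    exact max_eq_left hz.le
  have hdu := hu.mdifferentiableAt x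
  have hdp : MDifferentiableAt (𝓡 n) 𝓘(ℝ, ℝ) (fun z => max (u z) 0) x :=
    hdu.congr_of_eventuallyEq hpos
  have hgp : gradPairing g (fun z => max (u z) 0) u x = gradPairing g u u x :=
    congrArg (fun A : 𝔼 →L[ℝ] ℝ => A (gradient g u x)) hpos.mfderiv_eq
  have hE := hasDerivAt_exp_neg_mul_sq κ σ (ρ x)
  have hdE := mdifferentiableAt_real_comp hdρ hE.differentiableAt
  have hgrad : gradPairing g ψ u x = cutoff ρ R x * cutoff ρ R x *
      (Real.exp (-κ * ρ x ^ 2 - σ) * tangentNorm g x (gradient g u x) ^ 2 +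
        u x * (Real.exp (-κ * ρ x ^ 2 - σ) * (-2 * κ * ρ x) * gradPairing g ρ u x)) +
      Real.exp (-κ * ρ x ^ 2 - σ) * u x * (cutoff ρ R x * gradPairing g (cutoff ρ R) u x +
        cutoff ρ R x * gradPairing g (cutoff ρ R) u x) := by
    have hdφφ : MDifferentiableAt (𝓡 n) 𝓘(ℝ, ℝ) (fun z => cutoff ρ R z * cutoff ρ R z) x :=
      hdφ.mul hdφ
    have hdEp : MDifferentiableAt (𝓡 n) 𝓘(ℝ, ℝ)
        (fun z => Real.exp (-κ * ρ z ^ 2 - σ) * max (u z) 0) x := hdE.mul hdp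
    rw [hψ, gradPairing_mul g u hdφφ hdEp, gradPairing_mul g u hdE hdp,
      gradPairing_mul g u hdφ hdφ, gradPairing_comp g u hdρ hE, hgp, gradPairing_self, hmax]
  have hψx : ψ x = cutoff ρ R x * cutoff ρ R x * (Real.exp (-κ * ρ x ^ 2 - σ) * u x) := by
    rw [hψ]
    simp only [hmax]
  have hD₁ := abs_mfderiv_le_of_dist g (div_nonneg hL hR.le) (abs_cutoff_sub_le hR hρL) x
    (gradient g u x)
  have hD₂ := abs_mfderiv_le_of_dist g hL hρL x (gradient g u x)
  have hN : 0 ≤ tangentNorm g x (gradient g u x) := Real.sqrt_nonneg _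
  have hv' : v ≤ laplacian g u x + α₁ * tangentNorm g x (gradient g u x) + b * u x := by
    have h1 := inner_le_tangentNorm_mul g x a (gradient g u x)
    have h2 := mul_le_mul_of_nonneg_right ha hN
    linarith
  have key := energy_absorption (E := Real.exp (-κ * ρ x ^ 2 - σ)) hux.le (cutoff_nonneg ρ R x)
    (Real.exp_pos _).le hκ (hρ x) hD₁ hD₂ ((le_abs_self b).trans hb) hv'
  rw [indicator_of_mem (show x ∈ {z | ρ z ≤ R} from hRx), hgrad, hψx, hmax]
  refine le_trans (le_of_eq ?_) key
  ring

variable [MeasurableSpace M] [BorelSpace M]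

/-- Integrate `pointwise_energy`, valid where ρ and the cutoff are differentiable, hence a.e.; the
Green term has zero integral because ψ is Lipschitz with compact support. -/
theorem energy_inequality [ConnectedSpace M] [T2Space M] [SecondCountableTopology M]
    (g : Metric n M) {ρ u v b : M → ℝ} {R L κ σ α₁ α₂ : ℝ}
    (hR : 0 < R) (hL : 0 ≤ L) (hκ : 0 ≤ κ) (hρ : ∀ x, 0 ≤ ρ x)
    (hρL : ∀ x y, |ρ x - ρ y| ≤ L * geodesicDist g x y) (hc : IsCompact {x | ρ x ≤ R})
    (hu : IsChartC2 n u) (hvc : Continuous v)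
    (a : (x : M) → TangentSpace (𝓡 n) x) (ha : ∀ x, tangentNorm g x (a x) ≤ α₁)
    (hb : ∀ x, |b x| ≤ α₂)
    (hv : ∀ x, v x ≤ laplacian g u x + g.inner x (a x) (gradient g u x) + b x * u x) :
    ∫ x, (cutoff ρ R x ^ 2 * Real.exp (-κ * ρ x ^ 2 - σ)) * (2 * max (u x) 0 * v x -
        (4 * κ ^ 2 * L ^ 2 * ρ x ^ 2 + 2 * α₁ ^ 2 + 2 * α₂) * max (u x) 0 ^ 2)
        ∂riemannianVolume g ≤
      8 * (L / R) ^ 2 * ∫ x in {x | ρ x ≤ R},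
        Real.exp (-κ * ρ x ^ 2 - σ) * max (u x) 0 ^ 2 ∂riemannianVolume g := by
  set ψ : M → ℝ := fun x => cutoff ρ R x * cutoff ρ R x *
      (Real.exp (-κ * ρ x ^ 2 - σ) * max (u x) 0) with hψ
  have hρl : IsChartLipschitz n ρ := isChartLipschitz_of_dist g hL hρL
  have hφl : IsChartLipschitz n (cutoff ρ R) :=
    isChartLipschitz_of_dist g (div_nonneg hL hR.le) (abs_cutoff_sub_le hR hρL)
  have hψl : IsChartLipschitz n ψ := by
    refine (hφl.mul hφl).mul (IsChartLipschitz.mul ?_ ?_)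
    · exact hρl.comp (φ := fun s => Real.exp (-κ * s ^ 2 - σ))
        (ContDiff.locallyLipschitz (𝕂 := ℝ) (by fun_prop))
    · exact hu.isChartLipschitz.comp (φ := fun s => max s 0)
        (LipschitzWith.id.max_const 0).locallyLipschitz
  have hψc : HasCompactSupport ψ := by
    refine HasCompactSupport.intro hc fun x hx => ?_
    simp [hψ, cutoff_eq_zero hR (not_le.1 hx).le]
  obtain ⟨hint, hzero⟩ := green g hu hψl hψc
  have hρc := hρl.continuous
  have huc := hu.isChartLipschitz.continuous
  have hφc := hφl.continuous
  have hfc : Continuous fun x => Real.exp (-κ * ρ x ^ 2 - σ) * max (u x) 0 ^ 2 := by fun_prop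
  have hms : MeasurableSet {x | ρ x ≤ R} := hc.isClosed.measurableSet
  have hint2 : Integrable ({x | ρ x ≤ R}.indicator
      fun x => Real.exp (-κ * ρ x ^ 2 - σ) * max (u x) 0 ^ 2) (riemannianVolume g) :=
    (integrable_indicator_iff hms).2 (hfc.continuousOn.integrableOn_compact hc)
  have hint1 : Integrable (fun x => (cutoff ρ R x ^ 2 * Real.exp (-κ * ρ x ^ 2 - σ)) *
      (2 * max (u x) 0 * v x -
        (4 * κ ^ 2 * L ^ 2 * ρ x ^ 2 + 2 * α₁ ^ 2 + 2 * α₂) * max (u x) 0 ^ 2))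
      (riemannianVolume g) := by
    refine Continuous.integrable_of_hasCompactSupport (by fun_prop)
      (HasCompactSupport.intro hc fun x hx => ?_)
    simp [cutoff_eq_zero hR (not_le.1 hx).le]
  have hrhs : 8 * (L / R) ^ 2 * ∫ x in {x | ρ x ≤ R},
        Real.exp (-κ * ρ x ^ 2 - σ) * max (u x) 0 ^ 2 ∂riemannianVolume g =
      ∫ x, (2 * (ψ x * laplacian g u x + gradPairing g ψ u x) +
        8 * (L / R) ^ 2 * {z | ρ z ≤ R}.indicator
          (fun z => Real.exp (-κ * ρ z ^ 2 - σ) * max (u z) 0 ^ 2) x) ∂riemannianVolume g := by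
    rw [integral_add (hint.const_mul 2) (hint2.const_mul _), integral_const_mul, hzero, mul_zero,
      zero_add, integral_const_mul, integral_indicator hms]
  rw [hrhs]
  refine integral_mono_ae hint1 ((hint.const_mul 2).add (hint2.const_mul _)) ?_
  filter_upwards [hρl.ae_mdifferentiableAt g, hφl.ae_mdifferentiableAt g] with x hx1 hx2
  refine le_trans (le_of_eq ?_) (pointwise_energy g hR hL hκ hρ hρL hu (a x) (ha x) (hb x)
    (hv x) hx1 hx2 ψ hψ)
  simp only [hψ]
  ring

end MaxPrinciple
end

/-! ### Integrals against a moving measure -/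

noncomputable section

namespace MaxPrinciple

/-- Squaring removes the kink: s₊² = s·s₊ has slope s₊ → 0 at the origin. -/
theorem hasDerivAt_max_zero_sq (s : ℝ) :
    HasDerivAt (fun s : ℝ => max s 0 ^ 2) (2 * max s 0) s := by
  rcases lt_trichotomy s 0 with hs | rfl | hs
  · rw [max_eq_right hs.le, mul_zero]
    refine (hasDerivAt_const s (0 : ℝ)).congr_of_eventuallyEq ?_
    filter_upwards [gt_mem_nhds hs] with r hr
    simp [max_eq_right hr.le]
  · have h : (fun s : ℝ => max s 0 ^ 2) = fun s => s * max s 0 := by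
      funext s
      rcases le_total s 0 with hs | hs
      · simp [max_eq_right hs]
      · rw [max_eq_left hs, sq]
    rw [h, hasDerivAt_iff_tendsto_slope]
    have h1 : Tendsto (fun s : ℝ => max s 0) (𝓝[≠] 0) (𝓝 (max 0 0)) :=
      ((continuous_id.max continuous_const).tendsto (0 : ℝ)).mono_left nhdsWithin_le_nhds
    rw [max_self] at h1 ⊢
    rw [mul_zero]
    refine h1.congr' ?_
    filter_upwards [self_mem_nhdsWithin] with s hs
    rw [slope_def_field]
    have hs' : s ≠ 0 := hs
    field_simp
    simp
  · rw [max_eq_left hs.le]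
    have h1 : HasDerivAt (fun s : ℝ => s ^ 2) (2 * s) s := by simpa using hasDerivAt_pow 2 s
    refine h1.congr_of_eventuallyEq ?_
    filter_upwards [lt_mem_nhds hs] with r hr
    simp [max_eq_left hr.le]

section Measure

variable {X : Type*} [TopologicalSpace X] [MeasurableSpace X] [BorelSpace X]
  [SecondCountableTopology X]

theorem hasDerivAt_integral_of_compact (μ : Measure X) [IsFiniteMeasureOnCompacts μ] {K : Set X}
    (hK : IsCompact K) (hKc : IsClosed K) {w w' : ℝ → X → ℝ} {T : ℝ}
    (hw : ContinuousOn w.uncurry (Ioo 0 T ×ˢ univ)) (hw' : ContinuousOn w'.uncurry (Ioo 0 T ×ˢ univ))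
    (hsupp : ∀ s ∈ Ioo 0 T, ∀ x, x ∉ K → w s x = 0)
    (hsupp' : ∀ s ∈ Ioo 0 T, ∀ x, x ∉ K → w' s x = 0)
    (hd : ∀ x, ∀ s ∈ Ioo 0 T, HasDerivAt (fun s => w s x) (w' s x) s) {t : ℝ} (ht : t ∈ Ioo 0 T) :
    HasDerivAt (fun s => ∫ x, w s x ∂μ) (∫ x, w' t x ∂μ) t := by
  have hslice : ∀ {v : ℝ → X → ℝ}, ContinuousOn v.uncurry (Ioo 0 T ×ˢ univ) →
      ∀ s ∈ Ioo 0 T, Continuous (v s) := by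
    intro v hv s hs
    exact hv.comp_continuous (f := fun x => (s, x)) (by fun_prop) fun x => ⟨hs, mem_univ x⟩
  obtain ⟨ε, hε, hball⟩ := Metric.nhds_basis_closedBall.mem_iff.1 (isOpen_Ioo.mem_nhds ht)
  obtain ⟨B, hB⟩ := ((isCompact_closedBall t ε).prod hK).exists_bound_of_continuousOn
    (hw'.mono (prod_mono hball (subset_univ _)))
  refine (hasDerivAt_integral_of_dominated_loc_of_deriv_le (s := Metric.closedBall t ε)
    (F := w) (F' := w') (bound := K.indicator fun _ => B) (Metric.closedBall_mem_nhds t hε)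
    ?_ ?_ ?_ ?_ ?_ ?_).2
  · filter_upwards [isOpen_Ioo.mem_nhds ht] with s hs
    exact (hslice hw s hs).aestronglyMeasurable
  · exact (hslice hw t ht).integrable_of_hasCompactSupport
      (HasCompactSupport.intro' hK hKc (hsupp t ht))
  · exact (hslice hw' t ht).aestronglyMeasurable
  · refine Eventually.of_forall fun x s hs => ?_
    by_cases hx : x ∈ K
    · rw [indicator_of_mem hx]
      exact hB (s, x) ⟨hs, hx⟩
    · rw [indicator_of_notMem hx, hsupp' s (hball hs) x hx, norm_zero]
  · rw [integrable_indicator_iff hKc.measurableSet]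
    exact integrableOn_const hK.measure_ne_top
  · exact Eventually.of_forall fun x s hs => hd x s (hball hs)

theorem integral_le_mul_of_measure_le {μ ν : Measure X} {C : ℝ} (hC : 0 ≤ C)
    (h : μ ≤ ENNReal.ofReal C • ν) {f : X → ℝ} (hf : ∀ x, 0 ≤ f x) (hfi : Integrable f ν) :
    ∫ x, f x ∂μ ≤ C * ∫ x, f x ∂ν := by
  refine (integral_mono_measure h (Eventually.of_forall hf)
    (hfi.smul_measure ENNReal.ofReal_ne_top)).trans_eq ?_
  rw [integral_smul_measure, ENNReal.toReal_ofReal hC, smul_eq_mul]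

/-- A time dependent measure whose densities have logarithmic derivative bounded by `c`. -/
def HasLogLipschitzDensity (μ : ℝ → Measure X) (c T : ℝ) : Prop :=
  ∀ s t, 0 ≤ s → s ≤ t → t < T → μ t ≤ ENNReal.ofReal (Real.exp (c * (t - s))) • μ s ∧
    μ s ≤ ENNReal.ofReal (Real.exp (c * (t - s))) • μ t

variable {μ : ℝ → Measure X} [∀ t, IsFiniteMeasureOnCompacts (μ t)] {c T : ℝ} {K : Set X}
  {w : ℝ → X → ℝ}

theorem integrable_slice (ν : Measure X) [IsFiniteMeasureOnCompacts ν] (hK : IsCompact K)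
    (hKc : IsClosed K) (hw : ContinuousOn w.uncurry (Ico 0 T ×ˢ univ))
    (hsupp : ∀ s ∈ Ico 0 T, ∀ x, x ∉ K → w s x = 0) {s : ℝ} (hs : s ∈ Ico 0 T) :
    Integrable (w s) ν :=
  Continuous.integrable_of_hasCompactSupport
    (hw.comp_continuous (f := fun x => (s, x)) (by fun_prop) fun x => ⟨hs, mem_univ x⟩)
    (HasCompactSupport.intro' hK hKc (hsupp s hs))

/-- Freeze the measure at t₀: the moving integral lies between exp(±c|t - t₀|) times the frozen one,
which is continuous in t. -/
theorem HasLogLipschitzDensity.continuousOn_integral (hμ : HasLogLipschitzDensity μ c T)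
    (hK : IsCompact K) (hKc : IsClosed K) (hw : ContinuousOn w.uncurry (Ico 0 T ×ˢ univ))
    (hsupp : ∀ s ∈ Ico 0 T, ∀ x, x ∉ K → w s x = 0) (hw0 : ∀ s x, 0 ≤ w s x) :
    ContinuousOn (fun t => ∫ x, w t x ∂μ t) (Ico 0 T) := by
  intro t₀ ht₀
  have hH := continuousOn_integral_of_compact_support (μ := μ t₀) hK hw
    (fun s x hs hx => hsupp s hs x hx) t₀ ht₀
  have hexp : ∀ β : ℝ, Tendsto (fun t => Real.exp (β * |t - t₀|) * ∫ x, w t x ∂μ t₀)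
      (𝓝[Ico 0 T] t₀) (𝓝 (∫ x, w t₀ x ∂μ t₀)) := by
    intro β
    have h1 : Tendsto (fun t => Real.exp (β * |t - t₀|)) (𝓝[Ico 0 T] t₀) (𝓝 1) := by
      have : Continuous (fun t => Real.exp (β * |t - t₀|)) := by fun_prop
      simpa using (this.tendsto t₀).mono_left nhdsWithin_le_nhds
    simpa using h1.mul hH
  have hcomp : ∀ t ∈ Ico 0 T, μ t ≤ ENNReal.ofReal (Real.exp (c * |t - t₀|)) • μ t₀ ∧
      μ t₀ ≤ ENNReal.ofReal (Real.exp (c * |t - t₀|)) • μ t := by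
    intro t ht
    rcases le_total t t₀ with h | h
    · rw [abs_sub_comm, abs_of_nonneg (sub_nonneg.2 h)]
      exact (hμ t t₀ ht.1 h ht₀.2).symm
    · rw [abs_of_nonneg (sub_nonneg.2 h)]
      exact hμ t₀ t ht₀.1 h ht.2
  refine tendsto_of_tendsto_of_tendsto_of_le_of_le' (hexp (-c)) (hexp c) ?_ ?_
  · filter_upwards [self_mem_nhdsWithin] with t ht
    have h1 := integral_le_mul_of_measure_le (Real.exp_pos _).le (hcomp t ht).2 (hw0 t)
      (integrable_slice (μ t) hK hKc hw hsupp ht)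
    rw [neg_mul, Real.exp_neg]
    exact (inv_mul_le_iff₀ (Real.exp_pos _)).2 h1
  · filter_upwards [self_mem_nhdsWithin] with t ht
    exact integral_le_mul_of_measure_le (Real.exp_pos _).le (hcomp t ht).1 (hw0 t)
      (integrable_slice (μ t₀) hK hKc hw hsupp ht)

/-- Replaces differentiation of the measure. To the right of t the integral is at most exp(c(s - t))
∫ w s dμ_t, with equality at s = t. This majorant is differentiable at t with derivative d + c ∫ w t
dμ_t, so it bounds the right slopes. -/
theorem HasLogLipschitzDensity.eventually_slope_lt (hμ : HasLogLipschitzDensity μ c T)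
    (hK : IsCompact K) (hKc : IsClosed K) (hw : ContinuousOn w.uncurry (Ico 0 T ×ˢ univ))
    (hsupp : ∀ s ∈ Ico 0 T, ∀ x, x ∉ K → w s x = 0) (hw0 : ∀ s x, 0 ≤ w s x) {t d r : ℝ}
    (ht : t ∈ Ico 0 T) (hd : HasDerivAt (fun s => ∫ x, w s x ∂μ t) d t)
    (hr : d + c * ∫ x, w t x ∂μ t < r) :
    ∀ᶠ z in 𝓝[>] t, slope (fun s => ∫ x, w s x ∂μ s) t z < r := by
  have h1 : HasDerivAt (fun s => Real.exp (c * (s - t))) c t := by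
    simpa using (((hasDerivAt_id t).sub_const t).const_mul c).exp
  have h2 : HasDerivAt (fun s => Real.exp (c * (s - t)) * ∫ x, w s x ∂μ t)
      (d + c * ∫ x, w t x ∂μ t) t := (h1.mul hd).congr_deriv (by simp; ring)
  have h3 := (hasDerivAt_iff_tendsto_slope.1 h2).mono_left
    (nhdsWithin_mono t fun z (hz : t < z) => hz.ne')
  filter_upwards [h3.eventually (gt_mem_nhds hr), Ioo_mem_nhdsGT ht.2] with z hz hzt
  refine lt_of_le_of_lt ?_ hz
  have h4 := integral_le_mul_of_measure_le (Real.exp_pos _).le (hμ t z ht.1 hzt.1.le hzt.2).1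
    (hw0 z) (integrable_slice (μ t) hK hKc hw hsupp ⟨ht.1.trans hzt.1.le, hzt.2⟩)
  rw [slope_def_field, slope_def_field, sub_self, mul_zero, Real.exp_zero, one_mul]
  exact div_le_div_of_nonneg_right (by linarith) (sub_nonneg.2 hzt.1.le)

end Measure

/-- Gronwall type comparison on a half open time interval. -/
theorem le_integral_of_slope_le {F m : ℝ → ℝ} {T t₀ t : ℝ} (hF : ContinuousOn F (Ico 0 T))
    (hm : ContinuousOn m (Ico 0 T)) (hm0 : ∀ s ∈ Ico 0 T, 0 ≤ m s)
    (h0 : 0 ≤ t₀) (ht₀ : t₀ < t) (ht : t < T) (hFt₀ : F t₀ ≤ 0)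
    (hslope : ∀ s ∈ Ioo t₀ t, ∀ r, m s < r → ∀ᶠ z in 𝓝[>] s, slope F s z < r) :
    F t ≤ ∫ s in t₀..t, m s := by
  have hsub : ∀ {a b}, t₀ ≤ a → b ≤ t → Icc a b ⊆ Ico 0 T := fun ha hb s hs =>
    ⟨h0.trans (ha.trans hs.1), (hs.2.trans hb).trans_lt ht⟩
  have hint : ∀ {a b}, t₀ ≤ a → a ≤ b → b ≤ t → IntervalIntegrable m volume a b :=
    fun ha hab hb => (hm.mono (by rw [uIcc_of_le hab]; exact hsub ha hb)).intervalIntegrable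
  -- The slope bound is available only after t₀, which may be the initial time 0. The comparison
  -- starts at a > t₀, and a decreases to t₀ by continuity of F.
  have key : ∀ a ∈ Ioo t₀ t, F t ≤ F a + ∫ s in t₀..t, m s := by
    intro a ha
    have h1 : F t ≤ F a + ∫ s in a..t, m s := by
      refine image_le_of_liminf_slope_right_le_deriv_boundary (f := F) (a := a) (b := t)
        (B := fun z => F a + ∫ s in a..z, m s) (B' := m) (hF.mono (hsub ha.1.le le_rfl))
        (by simp) ?_ ?_ (fun s hs r hr => (hslope s ⟨ha.1.trans_le hs.1, hs.2⟩ r hr).frequently)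
        ⟨ha.2.le, le_rfl⟩
      · refine continuousOn_const.add ?_
        have := intervalIntegral.continuousOn_primitive_interval'
          (hint ha.1.le ha.2.le le_rfl) left_mem_uIcc
        rwa [uIcc_of_le ha.2.le] at this
      · intro s hs
        have hs0 : s ∈ Ioo 0 T := ⟨h0.trans_lt (ha.1.trans_le hs.1), hs.2.trans ht⟩
        refine HasDerivAt.hasDerivWithinAt (HasDerivAt.const_add _ ?_)
        exact intervalIntegral.integral_hasDerivAt_right (hint ha.1.le hs.1 hs.2.le)
          ((hm.mono Ioo_subset_Ico_self).stronglyMeasurableAtFilter isOpen_Ioo s hs0)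
          (hm.continuousAt (Ico_mem_nhds hs0.1 hs0.2))
    have h2 := intervalIntegral.integral_add_adjacent_intervals (hint le_rfl ha.1.le ha.2.le)
      (hint ha.1.le ha.2.le le_rfl)
    have h3 : 0 ≤ ∫ s in t₀..a, m s := intervalIntegral.integral_nonneg ha.1.le
      fun s hs => hm0 s (hsub le_rfl ha.2.le hs)
    linarith
  have hlim : Tendsto (fun a => F a + ∫ s in t₀..t, m s) (𝓝[>] t₀)
      (𝓝 (F t₀ + ∫ s in t₀..t, m s)) := by
    refine Tendsto.add_const _ ((hF t₀ ⟨h0, ht₀.trans ht⟩).mono_left ?_)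
    refine nhdsWithin_le_of_mem (mem_of_superset (Ioo_mem_nhdsGT (ht₀.trans ht)) fun s hs => ?_)
    exact ⟨h0.trans hs.1.le, hs.2⟩
  have := ge_of_tendsto hlim (mem_of_superset (Ioo_mem_nhdsGT ht₀) key)
  linarith

end MaxPrinciple
end

/-! ### Subsolutions and the weighted energy density -/

noncomputable section

namespace MaxPrinciple

variable {n : ℕ} {M : Type*} [TopologicalSpace M] [ChartedSpace (EuclideanSpace ℝ (Fin n)) M]
  [IsManifold (𝓡 n) ∞ M]

attribute [local instance 10000] chartedSpaceSelf

local notation "𝔼" => EuclideanSpace ℝ (Fin n)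

theorem IsC21.isChartC2 {T : ℝ} {u : M → ℝ → ℝ} (hu : IsC21 n T u) {t : ℝ} (ht : t ∈ Ioo 0 T) :
    IsChartC2 n (fun x => u x t) :=
  fun c => (hu _ (chart_mem_atlas 𝔼 c)).1 t ht

theorem IsC21.differentiableAt {T : ℝ} {u : M → ℝ → ℝ} (hu : IsC21 n T u) (x : M) {t : ℝ}
    (ht : t ∈ Ioo 0 T) : DifferentiableAt ℝ (fun s => u x s) t := by
  have h := (hu _ (chart_mem_atlas 𝔼 x)).2.1 _ (mem_chart_target 𝔼 x) t ht
  rwa [(chartAt 𝔼 x).left_inv (mem_chart_source 𝔼 x)] at h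

theorem IsC21.continuousOn_deriv {T : ℝ} {u : M → ℝ → ℝ} (hu : IsC21 n T u) :
    ContinuousOn (fun p : ℝ × M => deriv (fun s => u p.2 s) p.1) (Ioo 0 T ×ˢ univ) := by
  rintro ⟨t, x⟩ ⟨ht, -⟩
  set e := chartAt 𝔼 x with he
  have hx : x ∈ e.source := mem_chart_source 𝔼 x
  have h := (hu e (chart_mem_atlas 𝔼 x)).2.2.2.2
  have h1 : ContinuousOn (fun p : ℝ × M => deriv (fun s => u (e.symm (e p.2)) s) p.1)
      (Ioo 0 T ×ˢ e.source) := by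
    refine h.comp (f := fun p : ℝ × M => (e p.2, p.1)) ?_ fun p hp => ⟨e.map_source hp.2, hp.1⟩
    exact (e.continuousOn.comp continuousOn_snd fun p hp => hp.2).prodMk continuousOn_fst
  have hnhds : Ioo 0 T ×ˢ e.source ∈ 𝓝 (t, x) :=
    prod_mem_nhds (isOpen_Ioo.mem_nhds ht) (e.open_source.mem_nhds hx)
  refine ((h1.continuousAt hnhds).congr ?_).continuousWithinAt
  filter_upwards [hnhds] with p hp
  rw [e.left_inv hp.2]

/-- The metrics `g t` for `0 ≤ t < T` have logarithmic time derivative bounded by `α`. -/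
def HasLogLipschitzMetric (g : ℝ → Metric n M) (α T : ℝ) : Prop :=
  ∀ s t, 0 ≤ s → s ≤ t → t < T → ∀ (x : M) (v : TangentSpace (𝓡 n) x),
    (g t).inner x v v ≤ Real.exp (α * (t - s)) * (g s).inner x v v ∧
      (g s).inner x v v ≤ Real.exp (α * (t - s)) * (g t).inner x v v

theorem hasLogLipschitzMetric_of_deriv {g : ℝ → Metric n M} {α T : ℝ}
    (hgcont : ∀ (x : M) (v : TangentSpace (𝓡 n) x),
      ContinuousOn (fun t => (g t).inner x v v) (Ico 0 T))
    (hgdiff : ∀ (x : M) (v : TangentSpace (𝓡 n) x), ∀ t ∈ Ioo 0 T,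
      DifferentiableAt ℝ (fun s => (g s).inner x v v) t)
    (hg : ∀ (x : M) (v : TangentSpace (𝓡 n) x), ∀ t ∈ Ioo 0 T,
      -α * (g t).inner x v v ≤ deriv (fun s => (g s).inner x v v) t ∧
        deriv (fun s => (g s).inner x v v) t ≤ α * (g t).inner x v v) :
    HasLogLipschitzMetric g α T :=
  fun _ _ hs hst ht x v => exp_bound_of_deriv_bound (hgcont x v) (hgdiff x v) (hg x v) hs hst ht

theorem sqrt_exp_pow (α r : ℝ) (n : ℕ) : √(Real.exp (α * r) ^ n) = Real.exp (n * α / 2 * r) := by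
  rw [← Real.exp_nat_mul, Real.sqrt_eq_iff_mul_self_eq (Real.exp_pos _).le (Real.exp_pos _).le,
    ← Real.exp_add]
  congr 1
  ring

variable [MeasurableSpace M] [BorelSpace M]

/-- The density is the square root of an n × n determinant, so the metric exponent α becomes nα/2.
-/
theorem HasLogLipschitzMetric.hasLogLipschitzDensity {g : ℝ → Metric n M} {α T : ℝ}
    (h : HasLogLipschitzMetric g α T) :
    HasLogLipschitzDensity (fun t => riemannianVolume (g t)) (n * α / 2) T := by
  intro s t hs hst ht
  rw [← sqrt_exp_pow]
  exact ⟨riemannianVolume_le (Real.exp_pos _) fun x v => (h s t hs hst ht x v).1,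
    riemannianVolume_le (Real.exp_pos _) fun x v => (h s t hs hst ht x v).2⟩

/-- `u` is a continuous `C^{2,1}` subsolution of `u_t = Δu + a · ∇u + b u` with bounds `α₁`, `α₂`
for the coefficients. -/
structure IsSubsolution (g : ℝ → Metric n M) (T α₁ α₂ : ℝ)
    (a : ℝ → (x : M) → TangentSpace (𝓡 n) x) (b u : M → ℝ → ℝ) : Prop where
  norm_le : ∀ x, ∀ t ∈ Ico 0 T, tangentNorm (g t) x (a t x) ≤ α₁
  abs_le : ∀ x, ∀ t ∈ Ico 0 T, |b x t| ≤ α₂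
  continuousOn : ContinuousOn (fun p : ℝ × M => u p.2 p.1) (Ico 0 T ×ˢ univ)
  isC21 : IsC21 n T u
  deriv_le : ∀ x, ∀ t ∈ Ioo 0 T, deriv (fun s => u x s) t ≤
    laplacian (g t) (fun y => u y t) x +
      (g t).inner x (a t x) (gradient (g t) (fun y => u y t) x) + b x t * u x t

/-- The localized energy density with the Gaussian weight `exp (-ρ² / (K (τ - s)) - C s)`. -/
def energyDensity (ρ : M → ℝ) (u : M → ℝ → ℝ) (R K C τ s : ℝ) (x : M) : ℝ :=
  cutoff ρ R x ^ 2 * Real.exp (-(K * (τ - s))⁻¹ * ρ x ^ 2 - C * s) * max (u x s) 0 ^ 2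

/-- The time derivative of `energyDensity`. -/
def energyDensityDeriv (ρ : M → ℝ) (u : M → ℝ → ℝ) (R K C τ s : ℝ) (x : M) : ℝ :=
  cutoff ρ R x ^ 2 * Real.exp (-(K * (τ - s))⁻¹ * ρ x ^ 2 - C * s) *
    (2 * max (u x s) 0 * deriv (fun r => u x r) s -
      (K * (K * (τ - s))⁻¹ ^ 2 * ρ x ^ 2 + C) * max (u x s) 0 ^ 2)

theorem energyDensity_nonneg (ρ : M → ℝ) (u : M → ℝ → ℝ) (R K C τ s : ℝ) (x : M) :
    0 ≤ energyDensity ρ u R K C τ s x := by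
  unfold energyDensity
  positivity

/-- For κ = (K(τ - s))⁻¹ one has κ' = Kκ², the source of the favourable term -Kκ²ρ². -/
theorem hasDerivAt_energyDensity {ρ : M → ℝ} {u : M → ℝ → ℝ} {R K C τ s : ℝ} (hK : 0 < K)
    (hs : s < τ) {x : M} (hu : DifferentiableAt ℝ (fun r => u x r) s) :
    HasDerivAt (fun s => energyDensity ρ u R K C τ s x) (energyDensityDeriv ρ u R K C τ s x) s := by
  have hne : K * (τ - s) ≠ 0 := (mul_pos hK (sub_pos.2 hs)).ne'
  have h1 : HasDerivAt (fun s => K * (τ - s)) (-K) s := by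
    simpa using ((hasDerivAt_id s).const_sub τ).const_mul K
  have h2 : HasDerivAt (fun s => -(K * (τ - s))⁻¹ * ρ x ^ 2 - C * s)
      (-(K * (K * (τ - s))⁻¹ ^ 2 * ρ x ^ 2 + C)) s := by
    have h3 := ((h1.inv hne).neg.mul_const (ρ x ^ 2)).sub ((hasDerivAt_id s).const_mul C)
    refine h3.congr_deriv ?_
    field_simp
    ring
  have h4 : HasDerivAt (fun s => max (u x s) 0 ^ 2)
      (2 * max (u x s) 0 * deriv (fun r => u x r) s) s :=
    (hasDerivAt_max_zero_sq (u x s)).comp s hu.hasDerivAt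
  refine (((h2.exp.const_mul (cutoff ρ R x ^ 2)).mul h4)).congr_deriv ?_
  simp only [energyDensityDeriv]
  ring

theorem continuous_cutoff {ρ : M → ℝ} (hρ : Continuous ρ) (R : ℝ) : Continuous (cutoff ρ R) :=
  continuous_const.max (continuous_const.sub (hρ.div_const R))

theorem continuousOn_weight {ρ : M → ℝ} (hρ : Continuous ρ) {K τ : ℝ} (R C : ℝ) (hK : 0 < K)
    {S : Set ℝ} (hS : ∀ s ∈ S, s < τ) :
    ContinuousOn (fun p : ℝ × M => cutoff ρ R p.2 ^ 2 *
      Real.exp (-(K * (τ - p.1))⁻¹ * ρ p.2 ^ 2 - C * p.1)) (S ×ˢ univ) := by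
  have h1 := continuous_cutoff hρ R
  have h2 : ContinuousOn (fun p : ℝ × M => (K * (τ - p.1))⁻¹) (S ×ˢ univ) :=
    ContinuousOn.inv₀ (by fun_prop) fun p hp => (mul_pos hK (sub_pos.2 (hS _ hp.1))).ne'
  have h3 : ContinuousOn (fun p : ℝ × M => cutoff ρ R p.2 ^ 2) (S ×ˢ univ) := by fun_prop
  have h4 : ContinuousOn (fun p : ℝ × M => ρ p.2 ^ 2) (S ×ˢ univ) := by fun_prop
  exact h3.mul (((h2.neg.mul h4).sub (by fun_prop)).rexp)

theorem continuousOn_energyDensity {ρ : M → ℝ} (hρ : Continuous ρ) {u : M → ℝ → ℝ} {K τ : ℝ}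
    (R C : ℝ) (hK : 0 < K) {S : Set ℝ} (hS : ∀ s ∈ S, s < τ)
    (hu : ContinuousOn (fun p : ℝ × M => u p.2 p.1) (S ×ˢ univ)) :
    ContinuousOn (energyDensity ρ u R K C τ).uncurry (S ×ˢ univ) :=
  (continuousOn_weight hρ R C hK hS).mul ((hu.sup continuousOn_const).pow 2)

theorem continuousOn_energyDensityDeriv {ρ : M → ℝ} (hρ : Continuous ρ) {u : M → ℝ → ℝ} {K τ : ℝ}
    (R C : ℝ) (hK : 0 < K) {S : Set ℝ} (hS : ∀ s ∈ S, s < τ)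
    (hu : ContinuousOn (fun p : ℝ × M => u p.2 p.1) (S ×ˢ univ))
    (hu' : ContinuousOn (fun p : ℝ × M => deriv (fun s => u p.2 s) p.1) (S ×ˢ univ)) :
    ContinuousOn (energyDensityDeriv ρ u R K C τ).uncurry (S ×ˢ univ) := by
  have h2 : ContinuousOn (fun p : ℝ × M => (K * (τ - p.1))⁻¹) (S ×ˢ univ) :=
    ContinuousOn.inv₀ (by fun_prop) fun p hp => (mul_pos hK (sub_pos.2 (hS _ hp.1))).ne'
  have h4 : ContinuousOn (fun p : ℝ × M => ρ p.2 ^ 2) (S ×ˢ univ) := by fun_prop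
  have hp := hu.sup (continuousOn_const (c := (0 : ℝ)))
  exact (continuousOn_weight hρ R C hK hS).mul (((continuousOn_const.mul hp).mul hu').sub
    ((((continuousOn_const.mul (h2.pow 2)).mul h4).add continuousOn_const).mul (hp.pow 2)))

theorem cutoff_mono {ρ : M → ℝ} (hρ : ∀ x, 0 ≤ ρ x) {R R' : ℝ} (hR : 0 < R) (h : R ≤ R') (x : M) :
    cutoff ρ R x ≤ cutoff ρ R' x :=
  max_le_max le_rfl (sub_le_sub_left (div_le_div_of_nonneg_left (hρ x) hR h) 1)

theorem half_le_cutoff {ρ : M → ℝ} {R : ℝ} (hR : 0 < R) {x : M} (hx : ρ x ≤ R) :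
    1 / 2 ≤ cutoff ρ (2 * R) x := by
  refine le_max_of_le_right ?_
  have : ρ x / (2 * R) ≤ 1 / 2 := by
    rw [div_le_div_iff₀ (by positivity) two_pos]
    linarith
  linarith

end MaxPrinciple
end

/-! ### The cutoff argument and the maximum principle -/

noncomputable section

namespace MaxPrinciple

variable {n : ℕ} {M : Type*} [TopologicalSpace M] [ChartedSpace (EuclideanSpace ℝ (Fin n)) M]
  [IsManifold (𝓡 n) ∞ M] [MeasurableSpace M] [BorelSpace M]

attribute [local instance 10000] chartedSpaceSelf

local notation "𝔼" => EuclideanSpace ℝ (Fin n)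

theorem energyDensity_eq_zero {ρ : M → ℝ} {R : ℝ} (hR : 0 < R) (u : M → ℝ → ℝ) (K C τ s : ℝ) {x : M}
    (hx : x ∉ {x | ρ x ≤ R}) : energyDensity ρ u R K C τ s x = 0 := by
  simp [energyDensity, cutoff_eq_zero hR (not_le.1 hx).le]

theorem energyDensityDeriv_eq_zero {ρ : M → ℝ} {R : ℝ} (hR : 0 < R) (u : M → ℝ → ℝ)
    (K C τ s : ℝ) {x : M} (hx : x ∉ {x | ρ x ≤ R}) : energyDensityDeriv ρ u R K C τ s x = 0 := by
  simp [energyDensityDeriv, cutoff_eq_zero hR (not_le.1 hx).le]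

theorem energyDensity_mono {ρ : M → ℝ} (hρ : ∀ x, 0 ≤ ρ x) {R R' : ℝ} (hR : 0 < R) (h : R ≤ R')
    (u : M → ℝ → ℝ) (K C τ s : ℝ) (x : M) :
    energyDensity ρ u R K C τ s x ≤ energyDensity ρ u R' K C τ s x := by
  unfold energyDensity
  gcongr
  · exact cutoff_nonneg ρ R x
  · exact cutoff_mono hρ hR h x

theorem energyDensity_le {ρ : M → ℝ} (hρ : ∀ x, 0 ≤ ρ x) {R K C τ s μ : ℝ} (hR : 0 < R)
    (hC : 0 ≤ C * s) (hμ : μ ≤ (K * (τ - s))⁻¹) (u : M → ℝ → ℝ) (x : M) :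
    energyDensity ρ u R K C τ s x ≤ max (u x s) 0 ^ 2 * Real.exp (-μ * ρ x ^ 2) := by
  have h1 : cutoff ρ R x ^ 2 ≤ 1 :=
    pow_le_one₀ (cutoff_nonneg ρ R x) (cutoff_le_one hR hρ x)
  have h2 : Real.exp (-(K * (τ - s))⁻¹ * ρ x ^ 2 - C * s) ≤ Real.exp (-μ * ρ x ^ 2) := by
    refine Real.exp_le_exp.2 ?_
    nlinarith [mul_le_mul_of_nonneg_right hμ (sq_nonneg (ρ x))]
  rw [energyDensity, mul_comm]
  refine mul_le_mul_of_nonneg_left ?_ (sq_nonneg _)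
  simpa using mul_le_mul h1 h2 (Real.exp_pos _).le zero_le_one

variable [ConnectedSpace M] [T2Space M] [SecondCountableTopology M]

/-- The constants are tuned to `energy_inequality`: with K = 4L² the decay Kκ²ρ² equals the cost
4κ²L²ρ², and the part 2α₁² + 2α₂ of C covers drift and zeroth order term. The remaining c in C is
reserved for the variation of the volume. -/
theorem integral_energyDensityDeriv_le {g : ℝ → Metric n M} {T α₁ α₂ : ℝ}
    {a : ℝ → (x : M) → TangentSpace (𝓡 n) x} {b u : M → ℝ → ℝ}
    (hu : IsSubsolution g T α₁ α₂ a b u) {ρ : M → ℝ} {R L τ s : ℝ} (c : ℝ) (hR : 0 < R) (hL : 0 < L)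
    (hρ : ∀ x, 0 ≤ ρ x) (hs : s ∈ Ioo 0 T) (hsτ : s < τ)
    (hρL : ∀ x y, |ρ x - ρ y| ≤ L * geodesicDist (g s) x y)
    (hc : ∀ R, IsCompact {x | ρ x ≤ R}) :
    ∫ x, energyDensityDeriv ρ u R (4 * L ^ 2) (c + 2 * α₁ ^ 2 + 2 * α₂) τ s x
        ∂riemannianVolume (g s) +
      c * ∫ x, energyDensity ρ u R (4 * L ^ 2) (c + 2 * α₁ ^ 2 + 2 * α₂) τ s x
        ∂riemannianVolume (g s) ≤
      32 * (L / R) ^ 2 *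
        ∫ x, energyDensity ρ u (2 * R) (4 * L ^ 2) (c + 2 * α₁ ^ 2 + 2 * α₂) τ s x
          ∂riemannianVolume (g s) := by
  set K := 4 * L ^ 2 with hK
  set C := c + 2 * α₁ ^ 2 + 2 * α₂ with hC
  have hK0 : 0 < K := by positivity
  set κ := (K * (τ - s))⁻¹ with hκ
  have hκ0 : 0 ≤ κ := (inv_pos.2 (mul_pos hK0 (sub_pos.2 hsτ))).le
  have hρc : Continuous ρ := (isChartLipschitz_of_dist (g s) hL.le hρL).continuous
  have hs' : s ∈ Ico 0 T := Ioo_subset_Ico_self hs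
  have hpt : ∀ r ∈ ({s} : Set ℝ), r < τ := fun r hr => by rw [mem_singleton_iff.1 hr]; exact hsτ
  have huc : ContinuousOn (fun p : ℝ × M => u p.2 p.1) ({s} ×ˢ univ) :=
    hu.continuousOn.mono (prod_mono (singleton_subset_iff.2 hs') le_rfl)
  have hu'c : ContinuousOn (fun p : ℝ × M => deriv (fun r => u p.2 r) p.1) ({s} ×ˢ univ) :=
    hu.isC21.continuousOn_deriv.mono (prod_mono (singleton_subset_iff.2 hs) le_rfl)
  have hslice : ∀ {v : ℝ → M → ℝ}, ContinuousOn v.uncurry ({s} ×ˢ univ) → Continuous (v s) :=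
    fun hv => hv.comp_continuous (f := fun x => (s, x)) (by fun_prop) fun x => ⟨rfl, mem_univ x⟩
  have hi : ∀ R, 0 < R → Integrable (energyDensity ρ u R K C τ s) (riemannianVolume (g s)) :=
    fun R hR => (hslice (continuousOn_energyDensity hρc R C hK0 hpt huc)
      ).integrable_of_hasCompactSupport
      (HasCompactSupport.intro (hc R) fun x hx => energyDensity_eq_zero hR u K C τ s hx)
  have hi' : Integrable (energyDensityDeriv ρ u R K C τ s) (riemannianVolume (g s)) :=
    (hslice (continuousOn_energyDensityDeriv hρc R C hK0 hpt huc hu'c)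
      ).integrable_of_hasCompactSupport
      (HasCompactSupport.intro (hc R) fun x hx => energyDensityDeriv_eq_zero hR u K C τ s hx)
  have henergy := energy_inequality (g s) (ρ := ρ) (u := fun x => u x s)
    (v := fun x => deriv (fun r => u x r) s) (b := fun x => b x s) (σ := C * s) hR hL.le hκ0 hρ hρL
    (hc R) (hu.isC21.isChartC2 hs) (hslice (v := fun r x => deriv (fun r => u x r) r) hu'c) (a s)
    (fun x => hu.norm_le x s hs') (fun x => hu.abs_le x s hs') fun x => hu.deriv_le x s hs
  rw [← integral_const_mul, ← integral_add hi' ((hi R hR).const_mul c)]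
  refine (le_of_eq (integral_congr_ae (Eventually.of_forall fun x => ?_))).trans
    (henergy.trans ?_)
  · simp only [energyDensityDeriv, energyDensity]
    rw [← hκ]
    simp only [hK, hC]
    ring
  -- The cutoff of radius 2R is at least 1/2 on {ρ ≤ R}, so its square costs a factor 4; this turns
  -- 8 into 32 and returns to an energy of the same form.
  · have h1 : ∫ x in {x | ρ x ≤ R}, Real.exp (-κ * ρ x ^ 2 - C * s) * max (u x s) 0 ^ 2
        ∂riemannianVolume (g s) ≤
        4 * ∫ x, energyDensity ρ u (2 * R) K C τ s x ∂riemannianVolume (g s) := by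
      have hms : MeasurableSet {x | ρ x ≤ R} := (hc R).isClosed.measurableSet
      rw [← integral_indicator hms, ← integral_const_mul]
      refine integral_mono_of_nonneg (Eventually.of_forall fun x =>
        indicator_nonneg (fun z _ => by positivity) x) ((hi _ (by positivity)).const_mul 4)
        (Eventually.of_forall fun x => ?_)
      by_cases hx : ρ x ≤ R
      · rw [indicator_of_mem (show x ∈ {x | ρ x ≤ R} from hx)]
        have h2 := half_le_cutoff hR hx
        have h3 : 1 ≤ 4 * cutoff ρ (2 * R) x ^ 2 := by nlinarith
        have h4 : 0 ≤ Real.exp (-κ * ρ x ^ 2 - C * s) * max (u x s) 0 ^ 2 := by positivity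
        have h5 := mul_le_mul_of_nonneg_right h3 h4
        simp only [energyDensity]
        rw [← hκ]
        linarith
      · rw [indicator_of_notMem (show x ∉ {x | ρ x ≤ R} from hx)]
        exact mul_nonneg (by norm_num) (energyDensity_nonneg _ _ _ _ _ _ _ _)
    calc 8 * (L / R) ^ 2 * _ ≤ 8 * (L / R) ^ 2 * _ := mul_le_mul_of_nonneg_left h1 (by positivity)
      _ = _ := by ring

/-- The localized energy of a subsolution that is nonpositive at time `t₀` is controlled by the
weighted energy in the larger ball. -/
theorem integral_energyDensity_le {g : ℝ → Metric n M} {T α₁ α₂ c : ℝ}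
    {a : ℝ → (x : M) → TangentSpace (𝓡 n) x} {b u : M → ℝ → ℝ}
    (hu : IsSubsolution g T α₁ α₂ a b u)
    (hμ : HasLogLipschitzDensity (fun t => riemannianVolume (g t)) c T) (hc0 : 0 ≤ c)
    {ρ : M → ℝ} {R L τ t₀ t T' : ℝ} (hR : 0 < R) (hL : 0 < L) (hρ : ∀ x, 0 ≤ ρ x)
    (hT' : T' ≤ T) (hτ : T' ≤ τ) (ht₀ : 0 ≤ t₀) (htt : t₀ < t) (ht : t < T')
    (hρL : ∀ s ∈ Ico 0 T, ∀ x y, |ρ x - ρ y| ≤ L * geodesicDist (g s) x y)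
    (hc : ∀ R, IsCompact {x | ρ x ≤ R}) (hut₀ : ∀ x, u x t₀ ≤ 0) :
    ∫ x, energyDensity ρ u R (4 * L ^ 2) (c + 2 * α₁ ^ 2 + 2 * α₂) τ t x ∂riemannianVolume (g t) ≤
      32 * (L / R) ^ 2 * Real.exp (c * T) * ∫ s in t₀..t,
        ∫ x, energyDensity ρ u (2 * R) (4 * L ^ 2) (c + 2 * α₁ ^ 2 + 2 * α₂) τ s x
          ∂riemannianVolume (g 0) := by
  set K := 4 * L ^ 2 with hK
  set C := c + 2 * α₁ ^ 2 + 2 * α₂ with hC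
  have hK0 : 0 < K := by positivity
  have hT0 : 0 < T := (ht₀.trans_lt htt).trans (ht.trans_le hT')
  have hρc : Continuous ρ :=
    (isChartLipschitz_of_dist (g 0) hL.le (hρL 0 ⟨le_rfl, hT0⟩)).continuous
  have hμ' : HasLogLipschitzDensity (fun t => riemannianVolume (g t)) c T' :=
    fun s t hs hst ht => hμ s t hs hst (ht.trans_le hT')
  have hlt : ∀ s ∈ Ico 0 T', s < τ := fun s hs => hs.2.trans_le hτ
  have hsub : Ico 0 T' ⊆ Ico 0 T := Ico_subset_Ico_right hT'
  have hw : ∀ R, ContinuousOn (energyDensity ρ u R K C τ).uncurry (Ico 0 T' ×ˢ univ) := fun R =>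
    continuousOn_energyDensity hρc R C hK0 hlt (hu.continuousOn.mono (prod_mono hsub le_rfl))
  have hw' : ContinuousOn (energyDensityDeriv ρ u R K C τ).uncurry (Ioo 0 T' ×ˢ univ) :=
    continuousOn_energyDensityDeriv hρc R C hK0 (fun s hs => hlt s (Ioo_subset_Ico_self hs))
      (hu.continuousOn.mono (prod_mono (Ioo_subset_Ico_self.trans hsub) le_rfl))
      (hu.isC21.continuousOn_deriv.mono (prod_mono (Ioo_subset_Ioo_right hT') le_rfl))
  have h2R : 0 < 2 * R := by positivity
  have hsupp : ∀ R, 0 < R → ∀ s ∈ Ico 0 T', ∀ x, x ∉ {x | ρ x ≤ R} →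
      energyDensity ρ u R K C τ s x = 0 := fun R hR s _ x hx => energyDensity_eq_zero hR u K C τ s hx
  have hFc := hμ'.continuousOn_integral (hc R) (hc R).isClosed (hw R) (hsupp R hR)
    fun s x => energyDensity_nonneg ρ u R K C τ s x
  have hmc : ContinuousOn (fun s => 32 * (L / R) ^ 2 * Real.exp (c * T) *
      ∫ x, energyDensity ρ u (2 * R) K C τ s x ∂riemannianVolume (g 0)) (Ico 0 T') :=
    continuousOn_const.mul (continuousOn_integral_of_compact_support (hc (2 * R)) (hw (2 * R))
      fun s x hs hx => hsupp _ h2R s hs x hx)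
  have hFt₀ : ∫ x, energyDensity ρ u R K C τ t₀ x ∂riemannianVolume (g t₀) ≤ 0 := by
    refine le_of_eq (integral_eq_zero_of_ae (Eventually.of_forall fun x => ?_))
    simp [energyDensity, max_eq_right (hut₀ x)]
  rw [← intervalIntegral.integral_const_mul]
  refine le_integral_of_slope_le hFc hmc (fun s hs => ?_) ht₀ htt ht hFt₀ fun s hs r hr => ?_
  · exact mul_nonneg (by positivity)
      (integral_nonneg fun x => energyDensity_nonneg ρ u (2 * R) K C τ s x)
  · have hs' : s ∈ Ioo 0 T' := ⟨ht₀.trans_lt hs.1, hs.2.trans ht⟩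
    have hsT : s ∈ Ioo 0 T := Ioo_subset_Ioo_right hT' hs'
    have hd := hasDerivAt_integral_of_compact (riemannianVolume (g s)) (hc R) (hc R).isClosed
      ((hw R).mono (prod_mono Ioo_subset_Ico_self le_rfl)) hw'
      (fun s hs => hsupp R hR s (Ioo_subset_Ico_self hs))
      (fun s _ x hx => energyDensityDeriv_eq_zero hR u K C τ s hx)
      (fun x s hs => hasDerivAt_energyDensity hK0 (hlt s (Ioo_subset_Ico_self hs))
        (hu.isC21.differentiableAt x (Ioo_subset_Ioo_right hT' hs))) hs'
    refine hμ'.eventually_slope_lt (hc R) (hc R).isClosed (hw R) (hsupp R hR)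
      (fun s x => energyDensity_nonneg ρ u R K C τ s x) (Ioo_subset_Ico_self hs') hd
      (lt_of_le_of_lt ?_ hr)
    refine (integral_energyDensityDeriv_le hu c hR hL hρ hsT (hlt s (Ioo_subset_Ico_self hs'))
      (hρL s (Ioo_subset_Ico_self hsT)) hc).trans ?_
    rw [mul_assoc (32 * (L / R) ^ 2)]
    refine mul_le_mul_of_nonneg_left ?_ (by positivity)
    -- Passing from dV_s to the fixed measure dV_0 costs at most exp(cT).
    have h1 := integral_le_mul_of_measure_le (Real.exp_pos _).le (hμ 0 s le_rfl hsT.1.le hsT.2).1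
      (fun x => energyDensity_nonneg ρ u (2 * R) K C τ s x)
      (integrable_slice (riemannianVolume (g 0)) (hc _) (hc _).isClosed (hw _) (hsupp _ h2R)
        (Ioo_subset_Ico_self hs'))
    refine h1.trans (mul_le_mul_of_nonneg_right ?_
      (integral_nonneg fun x => energyDensity_nonneg ρ u (2 * R) K C τ s x))
    refine Real.exp_le_exp.2 (mul_le_mul_of_nonneg_left ?_ hc0)
    linarith [hsT.2]

/-- The maximum principle on a short time interval. -/
theorem nonpos_of_short_time {g : ℝ → Metric n M} {T α₁ α₂ c : ℝ}
    {a : ℝ → (x : M) → TangentSpace (𝓡 n) x} {b u : M → ℝ → ℝ}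
    (hu : IsSubsolution g T α₁ α₂ a b u)
    (hμ : HasLogLipschitzDensity (fun t => riemannianVolume (g t)) c T) (hc0 : 0 ≤ c)
    (hα₂ : 0 ≤ α₂) {ρ : M → ℝ} {L t₀ t η lam : ℝ} (hL : 0 < L) (hlam : 0 ≤ lam) (hρ : ∀ x, 0 ≤ ρ x)
    (ht₀ : 0 ≤ t₀) (htt : t₀ < t) (ht : t < T) (htη : t < t₀ + η)
    (hη : lam * (4 * L ^ 2 * (2 * η)) ≤ 1)
    (hρL : ∀ s ∈ Ico 0 T, ∀ x y, |ρ x - ρ y| ≤ L * geodesicDist (g s) x y)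
    (hc : ∀ R, IsCompact {x | ρ x ≤ R}) (hut₀ : ∀ x, u x t₀ ≤ 0)
    (hint : ∫⁻ s in Ioo 0 T, ∫⁻ x, ENNReal.ofReal
      (max (u x s) 0 ^ 2 * Real.exp (-lam * ρ x ^ 2)) ∂riemannianVolume (g 0) < ⊤) (x : M) :
    u x t ≤ 0 := by
  by_contra hpos
  rw [not_le] at hpos
  set I := (∫⁻ s in Ioo 0 T, ∫⁻ x, ENNReal.ofReal
      (max (u x s) 0 ^ 2 * Real.exp (-lam * ρ x ^ 2)) ∂riemannianVolume (g 0)).toReal with hI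
  set K := 4 * L ^ 2 with hK
  set C := c + 2 * α₁ ^ 2 + 2 * α₂ with hC
  -- For t₀ < s < t₀ + η one has η < τ - s < 2η. The lower bound keeps the weight nonsingular; the
  -- upper one, with `hη`, gives κ ≥ lam, so the weight is below exp(-lam ρ²).
  set τ := t₀ + 2 * η with hτ
  have hK0 : 0 < K := by positivity
  have hC0 : 0 ≤ C := by positivity
  have hη0 : 0 < η := by linarith
  set T' := min T (t₀ + η) with hT'
  have htT' : t < T' := lt_min ht htη
  have hT'τ : T' ≤ τ := (min_le_right _ _).trans (by linarith)
  have hT0 : 0 < T := (ht₀.trans_lt htt).trans ht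
  have hρc : Continuous ρ :=
    (isChartLipschitz_of_dist (g 0) hL.le (hρL 0 ⟨le_rfl, hT0⟩)).continuous
  have hlt : ∀ s ∈ Ico 0 T', s < τ := fun s hs => hs.2.trans_le hT'τ
  have hw : ∀ R, ContinuousOn (energyDensity ρ u R K C τ).uncurry (Ico 0 T' ×ˢ univ) := fun R =>
    continuousOn_energyDensity hρc R C hK0 hlt
      (hu.continuousOn.mono (prod_mono (Ico_subset_Ico_right (min_le_left _ _)) le_rfl))
  have hsupp : ∀ R, 0 < R → ∀ s ∈ Ico 0 T', ∀ x, x ∉ {x | ρ x ≤ R} →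
      energyDensity ρ u R K C τ s x = 0 := fun R hR s _ x hx => energyDensity_eq_zero hR u K C τ s hx
  have htI : t ∈ Ico 0 T' := ⟨ht₀.trans htt.le, htT'⟩
  have hIoc : Ioc t₀ t ⊆ Ioo 0 T := fun s hs => ⟨ht₀.trans_lt hs.1, hs.2.trans_lt ht⟩
  have hIoc' : Ioc t₀ t ⊆ Ico 0 T' := fun s hs => ⟨(ht₀.trans_lt hs.1).le, hs.2.trans_lt htT'⟩
  -- The bound is uniform in R: cutoff at most 1, exp(-Cs) at most 1, and the Gaussian below the
  -- weight of the growth hypothesis.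
  have hbound : ∀ R, 0 < R → ∫ s in t₀..t, ∫ x, energyDensity ρ u R K C τ s x
      ∂riemannianVolume (g 0) ≤ I := by
    intro R hR
    have hmc : ContinuousOn (fun s => ∫ x, energyDensity ρ u R K C τ s x
        ∂riemannianVolume (g 0)) (Ico 0 T') :=
      continuousOn_integral_of_compact_support (hc R) (hw R) fun s x hs hx => hsupp R hR s hs x hx
    rw [intervalIntegral.integral_of_le htt.le, integral_eq_lintegral_of_nonneg_ae
      (Eventually.of_forall fun s => integral_nonneg fun x => energyDensity_nonneg ρ u R K C τ s x)
      ((hmc.mono hIoc').aestronglyMeasurable measurableSet_Ioc)]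
    refine ENNReal.toReal_mono hint.ne (le_trans ?_ (lintegral_mono_set hIoc))
    refine setLIntegral_mono' measurableSet_Ioc fun s hs => ?_
    rw [ofReal_integral_eq_lintegral_ofReal
      (integrable_slice _ (hc R) (hc R).isClosed (hw R) (hsupp R hR) (hIoc' hs))
      (Eventually.of_forall fun x => energyDensity_nonneg ρ u R K C τ s x)]
    refine lintegral_mono fun x => ENNReal.ofReal_le_ofReal ?_
    refine energyDensity_le hρ hR (mul_nonneg hC0 (hIoc hs).1.le) ?_ u x
    have h1 : 0 < K * (τ - s) := mul_pos hK0 (sub_pos.2 (hlt s (hIoc' hs)))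
    rw [← one_div, le_div_iff₀ h1]
    refine le_trans ?_ hη
    gcongr
    linarith [hs.1]
  -- A fixed radius whose cutoff is positive at x. Its energy at time t is then positive, yet by
  -- monotonicity in R it is at most a constant over R² for all R ≥ R₁.
  set R₁ := ρ x + 1 with hR₁
  have hR₁0 : 0 < R₁ := by linarith [hρ x]
  have hF₁ : 0 < ∫ z, energyDensity ρ u R₁ K C τ t z ∂riemannianVolume (g t) := by
    refine Continuous.integral_pos_of_hasCompactSupport_nonneg_nonzero (x := x)
      ((hw R₁).comp_continuous (f := fun z => (t, z)) (by fun_prop) fun z => ⟨htI, mem_univ z⟩)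
      (HasCompactSupport.intro (hc R₁) (hsupp R₁ hR₁0 t htI))
      (fun z => energyDensity_nonneg ρ u R₁ K C τ t z) (ne_of_gt ?_)
    have h1 : 0 < cutoff ρ R₁ x := by
      refine lt_max_of_lt_right (sub_pos.2 ((div_lt_one hR₁0).2 (by linarith)))
    have h2 : 0 < max (u x t) 0 := lt_max_of_lt_left hpos
    change 0 < energyDensity ρ u R₁ K C τ t x
    unfold energyDensity
    positivity
  have hle : ∀ R, R₁ ≤ R → ∫ z, energyDensity ρ u R₁ K C τ t z ∂riemannianVolume (g t) ≤
      32 * L ^ 2 * Real.exp (c * T) * I / R ^ 2 := by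
    intro R hR
    have hR0 : 0 < R := hR₁0.trans_le hR
    have h1 := integral_mono (μ := riemannianVolume (g t))
      (integrable_slice _ (hc R₁) (hc R₁).isClosed (hw R₁) (hsupp R₁ hR₁0) htI)
      (integrable_slice _ (hc R) (hc R).isClosed (hw R) (hsupp R hR0) htI)
      (fun z => energyDensity_mono hρ hR₁0 hR u K C τ t z)
    refine h1.trans ((integral_energyDensity_le hu hμ hc0 hR0 hL hρ (min_le_left _ _) hT'τ ht₀ htt
      htT' hρL hc hut₀).trans ?_)
    refine (mul_le_mul_of_nonneg_left (hbound (2 * R) (by positivity)) (by positivity)).trans_eq ?_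
    ring
  have hlim : Tendsto (fun R : ℝ => 32 * L ^ 2 * Real.exp (c * T) * I / R ^ 2) atTop (𝓝 0) :=
    tendsto_const_nhds.div_atTop (tendsto_pow_atTop two_ne_zero)
  exact hF₁.not_ge (ge_of_tendsto hlim ((eventually_ge_atTop R₁).mono hle))

theorem IsSubsolution.nonpos {g : ℝ → Metric n M} {T α₁ α₂ α₃ : ℝ} (hα₃ : 0 ≤ α₃) (hα₂ : 0 ≤ α₂)
    (hcomplete : IsCompleteMetric (g 0)) (hg : HasLogLipschitzMetric g α₃ T)
    {a : ℝ → (x : M) → TangentSpace (𝓡 n) x} {b u : M → ℝ → ℝ}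
    (hu : IsSubsolution g T α₁ α₂ a b u) (x₀ : M) {lam : ℝ} (hlam : 0 < lam)
    (hint : ∫⁻ t in Ioo 0 T, ∫⁻ x, ENNReal.ofReal
        (max (u x t) 0 ^ 2 * Real.exp (-lam * geodesicDist (g t) x₀ x ^ 2))
        ∂riemannianVolume (g t) < ⊤)
    (hu0 : ∀ x, u x 0 ≤ 0) (x : M) {t : ℝ} (ht : t ∈ Ico 0 T) : u x t ≤ 0 := by
  have hT : 0 < T := ht.1.trans_lt ht.2
  set A := Real.exp (α₃ * T) with hA
  have hA0 : 0 < A := Real.exp_pos _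
  set ρ : M → ℝ := geodesicDist (g 0) x₀ with hρdef
  have hρ : ∀ x, 0 ≤ ρ x := geodesicDist_nonneg _ _
  have hexp : ∀ s ∈ Ico 0 T, Real.exp (α₃ * (s - 0)) ≤ A := fun s hs =>
    Real.exp_le_exp.2 (mul_le_mul_of_nonneg_left (by linarith [hs.2]) hα₃)
  have hnonneg : ∀ s (x : M) (v : TangentSpace (𝓡 n) x), 0 ≤ (g s).inner x v v := by
    intro s x v
    by_cases h0 : v = 0
    · rw [h0, map_zero]
    · exact ((g s).pos x v h0).le
  have hg1 : ∀ s ∈ Ico 0 T, ∀ (x : M) (v : TangentSpace (𝓡 n) x),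
      (g s).inner x v v ≤ A * (g 0).inner x v v ∧ (g 0).inner x v v ≤ A * (g s).inner x v v :=
    fun s hs x v => ⟨(hg 0 s le_rfl hs.1 hs.2 x v).1.trans
      (mul_le_mul_of_nonneg_right (hexp s hs) (hnonneg 0 x v)),
      (hg 0 s le_rfl hs.1 hs.2 x v).2.trans
      (mul_le_mul_of_nonneg_right (hexp s hs) (hnonneg s x v))⟩
  have hdist : ∀ {g₁ g₂ : Metric n M}, (∀ (x : M) (v : TangentSpace (𝓡 n) x),
      g₁.inner x v v ≤ A * g₂.inner x v v) → ∀ x y,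
      geodesicDist g₁ x y ≤ √A * geodesicDist g₂ x y := by
    intro g₁ g₂ h x y
    have h1 := ENNReal.toReal_mono (ENNReal.mul_ne_top ENNReal.ofReal_ne_top
      (geodesicEDist_lt_top g₂ x y).ne) (geodesicEDist_le_mul hA0 h x y)
    rwa [ENNReal.toReal_mul, ENNReal.toReal_ofReal (Real.sqrt_nonneg _)] at h1
  have hρL : ∀ s ∈ Ico 0 T, ∀ x y, |ρ x - ρ y| ≤ √A * geodesicDist (g s) x y := fun s hs x y =>
    (abs_geodesicDist_sub_le (g 0) x₀ x y).trans (hdist (fun x v => (hg1 s hs x v).2) x y)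
  have hc : ∀ R, IsCompact {x | ρ x ≤ R} := isCompact_geodesicDist_le (g 0) hcomplete x₀
  -- The growth hypothesis is moved to time 0: r_s² ≤ Aρ² gives exp(-lam A ρ²) ≤ exp(-lam r_s²), and
  -- dV_0 ≤ √(Aⁿ) dV_s.
  have hint' : ∫⁻ s in Ioo 0 T, ∫⁻ x, ENNReal.ofReal
      (max (u x s) 0 ^ 2 * Real.exp (-(lam * A) * ρ x ^ 2)) ∂riemannianVolume (g 0) < ⊤ := by
    have hvol : ∀ s ∈ Ioo 0 T, riemannianVolume (g 0) ≤
        ENNReal.ofReal √(A ^ n) • riemannianVolume (g s) := fun s hs =>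
      riemannianVolume_le hA0 fun x v => (hg1 s (Ioo_subset_Ico_self hs) x v).2
    refine lt_of_le_of_lt (b := ENNReal.ofReal √(A ^ n) * ∫⁻ t in Ioo 0 T, ∫⁻ x, ENNReal.ofReal
        (max (u x t) 0 ^ 2 * Real.exp (-lam * geodesicDist (g t) x₀ x ^ 2))
        ∂riemannianVolume (g t)) ?_ (ENNReal.mul_lt_top ENNReal.ofReal_lt_top hint)
    rw [← lintegral_const_mul' _ _ ENNReal.ofReal_ne_top]
    refine setLIntegral_mono' measurableSet_Ioo fun s hs => ?_
    refine (lintegral_mono' (hvol s hs) le_rfl).trans ?_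
    rw [lintegral_smul_measure, smul_eq_mul]
    refine mul_le_mul_right (lintegral_mono fun y => ENNReal.ofReal_le_ofReal
      (mul_le_mul_of_nonneg_left (Real.exp_le_exp.2 ?_) (sq_nonneg _))) _
    have h1 := hdist (fun x v => (hg1 s (Ioo_subset_Ico_self hs) x v).1) x₀ y
    have h2 := pow_le_pow_left₀ (geodesicDist_nonneg _ _ _) h1 2
    rw [mul_pow, Real.sq_sqrt hA0.le] at h2
    have h3 := mul_le_mul_of_nonneg_left h2 hlam.le
    linarith
  -- Equality in the short time condition (lam A)(4L²)(2η) ≤ 1, since L² = A. The value is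
  -- independent of the starting time.
  set η := 1 / (lam * A * (8 * A)) with hη
  have hη0 : 0 < η := by positivity
  have hηle : lam * A * (4 * √A ^ 2 * (2 * η)) ≤ 1 := by
    rw [Real.sq_sqrt hA0.le, hη]
    refine le_of_eq ?_
    field_simp
    norm_num
  -- Steps of length η/2 rather than η, because the short time result requires t < t₀ + η strictly.
  have key : ∀ k : ℕ, ∀ s ∈ Ico 0 T, s ≤ k * (η / 2) → ∀ x, u x s ≤ 0 := by
    intro k
    induction k with
    | zero =>
      intro s hs hs0 x
      have : s = 0 := le_antisymm (by simpa using hs0) hs.1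
      rw [this]
      exact hu0 x
    | succ k ih =>
      intro s hs hsk x
      rcases le_or_gt s (k * (η / 2)) with h | h
      · exact ih s hs h x
      · have hk : (0 : ℝ) ≤ k * (η / 2) := by positivity
        push_cast at hsk
        exact nonpos_of_short_time hu hg.hasLogLipschitzDensity (by positivity) hα₂
          (Real.sqrt_pos.2 hA0) (by positivity) hρ hk h hs.2 (by linarith) hηle hρL hc
          (ih _ ⟨hk, h.trans hs.2⟩ le_rfl) hint' x
  obtain ⟨k, hk⟩ := exists_nat_ge (t / (η / 2))
  exact key k t ht ((div_le_iff₀ (by positivity)).1 hk) x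

end MaxPrinciple
end

theorem theorem1p1 {n : ℕ} {M : Type*} [TopologicalSpace M]
    [ChartedSpace (EuclideanSpace ℝ (Fin n)) M] [IsManifold (𝓡 n) ∞ M]
    [T2Space M] [SecondCountableTopology M] [ConnectedSpace M] [NoncompactSpace M]
    [MeasurableSpace M] [BorelSpace M]
    (T : ℝ) (hT : 0 < T)
    -- the time varying metric `g(t)`, `0 ≤ t < T`; values for other `t` are irrelevant
    (g : ℝ → MaxPrinciple.Metric n M)
    (hcomplete : ∀ t ∈ Ico 0 T, MaxPrinciple.IsCompleteMetric (g t))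
    (hgcont : ∀ (x : M) (v : TangentSpace (𝓡 n) x),
      ContinuousOn (fun t => (g t).inner x v v) (Ico 0 T))
    (hgdiff : ∀ (x : M) (v : TangentSpace (𝓡 n) x), ∀ t ∈ Ioo 0 T,
      DifferentiableAt ℝ (fun s => (g s).inner x v v) t)
    (α₁ α₂ α₃ : ℝ) (hα₁ : 0 < α₁) (hα₂ : 0 < α₂) (hα₃ : 0 < α₃)
    (a : ℝ → (x : M) → TangentSpace (𝓡 n) x)
    (ha : ∀ (x : M), ∀ t ∈ Ico 0 T, √((g t).inner x (a t x) (a t x)) ≤ α₁)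
    (b : M → ℝ → ℝ)
    (hb : ∀ (x : M), ∀ t ∈ Ico 0 T, |b x t| ≤ α₂)
    (hg : ∀ (x : M) (v : TangentSpace (𝓡 n) x), ∀ t ∈ Ioo 0 T,
      -α₃ * (g t).inner x v v ≤ deriv (fun s => (g s).inner x v v) t ∧
        deriv (fun s => (g s).inner x v v) t ≤ α₃ * (g t).inner x v v)
    (u : M → ℝ → ℝ)
    (hucont : ContinuousOn (fun p : M × ℝ => u p.1 p.2) (univ ×ˢ Ico 0 T))
    (huC21 : MaxPrinciple.IsC21 n T u)
    (hsub : ∀ (x : M), ∀ t ∈ Ioo 0 T,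
      deriv (fun s => u x s) t ≤
        MaxPrinciple.laplacian (g t) (fun y => u y t) x
          + (g t).inner x (a t x) (MaxPrinciple.gradient (g t) (fun y => u y t) x)
          + b x t * u x t)
    (x₀ : M) (lam : ℝ) (hlam : 0 < lam)
    (hint : ∫⁻ t in Ioo 0 T, ∫⁻ x, ENNReal.ofReal
        ((max (u x t) 0) ^ 2 * Real.exp (-lam * (MaxPrinciple.geodesicDist (g t) x₀ x) ^ 2))
        ∂(MaxPrinciple.riemannianVolume (g t)) < ⊤)
    (hu0 : ∀ x : M, u x 0 ≤ 0) :
    ∀ (x : M), ∀ t ∈ Ico 0 T, u x t ≤ 0 := by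
  exact fun x t ht => MaxPrinciple.IsSubsolution.nonpos hα₃.le hα₂.le (hcomplete 0 ⟨le_rfl, hT⟩)
    (MaxPrinciple.hasLogLipschitzMetric_of_deriv hgcont hgdiff hg)
    { norm_le := ha
      abs_le := hb
      continuousOn := hucont.comp (f := fun p : ℝ × M => (p.2, p.1)) (by fun_prop)
        fun p hp => ⟨hp.2, hp.1⟩
      isC21 := huC21
      deriv_le := hsub } x₀ hlam hint hu0 x ht
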